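/- Let $X,Y,W\in\mathbb{R}[t]$ with $W\neq 0$ and $\gcd(X,Y,W)=1$, put $\phi(t)=\left(\frac{X(t)}{W(t)},\frac{Y(t)}{W(t)}\right)$, and let $\mathcal{C}\subset\mathbb{C}^2$ be the Zariski closure of $\{\phi(t): t\in\mathbb{C},\ W(t)\ne 0\}$. Assume that $\mathcal{C}$ is neither a line nor a circle and that $\phi$ is proper, i.e. only finitely many $t\in\mathbb{C}$ with $W(t)\neq0$ satisfy $\phi(t)=\phi(t')$ for some $t'\neq t$ with $W(t')\neq 0$. Let $d>0$ be real, $U=X'W-XW'$, $V=Y'W-YW'$. The offset $\mathcal{O}_d(\mathcal{C})$ is the Zariski closure in $\mathbb{C}^2$ of the set of all points $$q=\left(\frac{X(t)}{W(t)}\pm d\,\frac{V(t)}{\sqrt{U(t)^2+V(t)^2}},\ \frac{Y(t)}{W(t)}\mp d\,\frac{U(t)}{\sqrt{U(t)^2+V(t)^2}}\right),\qquad t\in\mathbb{C},\ W(t)\neq0,\ U(t)^2+V(t)^2\neq 0;$$ we say that the point $\phi(t)$ generates $q$. An irreducible component of $\mathcal{O}_d(\mathcal{C})$ is simple if all but finitely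 many of its points are generated by exactly one point of $\mathcal{C}$, and special otherwise. Let $P$ and $Q$ in $\mathbb{C}[x,y,t]$ be obtained from $$U(Wx-X)+V(Wy-Y)\quad\text{and}\quad (Wx-X)^2+(Wy-Y)^2-d^2W^2,$$ respectively, by dividing out the content with respect to $t$ (the gcd in $\mathbb{C}[t]$ of the coefficients as a polynomial in $x,y$), and let $H(x,y)=\mathrm{Res}_t(P,Q)$. All equations between polynomials below are up to a nonzero constant factor. Then the following holds. (0) $\mathcal{O}_d(\mathcal{C})$ has one or two irreducible components, at most one of them is special, and if there is only one component then it is simple. So there are polynomials $f_1,f_2\in\mathbb{C}[x,y]$ such that $f_1$ is irreducible and defines a component, $f_2=1$ if there is only one component, $f_2$ is irreducible and defines the other component if there are two, and $f_2$ defines the special component if there is one. Moreover $H=F\cdot G$, where $F$ is an implicit equation of $\mathcal{O}_d(\mathcal{C})$ (its zero set is $\mathcal{O}_d(\mathcal{C})$) and $G$ is a nonzero constant times a (possibly empty) product of linear polynomials whose lines are not contained in $\mathcal{O}_d(\mathcal{C})$. For every such factorization $H=F\cdot G$ and all such $f_1,f_2$: (1) If $\mathcal{O}_d(\mathcal{C})$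 has no special component, then $F=f_1\cdot f_2$; in particular $F$ is square-free. (2) If $\mathcal{O}_d(\mathcal{C})$ has a special component, then $F=f_1\cdot f_2^2$. -/

import Mathlib

noncomputable section

namespace Offset

/-! ### Plane algebraic sets over `ℂ` -/

/-- The complex affine plane. -/
abbrev Plane : Type := Fin 2 → ℂ

/-- Polynomials in `x` (variable `0`) and `y` (variable `1`) with complex coefficients. -/
abbrev PolyXY : Type := MvPolynomial (Fin 2) ℂ

/-- The zero set of a polynomial in the plane. -/
def zeroSet (f : PolyXY) : Set Plane :=
  {p | MvPolynomial.eval p f = 0}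

/-- The Zariski closure of a subset of the plane. -/
def zariskiClosure (S : Set Plane) : Set Plane :=
  MvPolynomial.zeroLocus ℂ (MvPolynomial.vanishingIdeal ℂ S)

/-- Irreducible Zariski closed subsets of the plane. -/
def IsIrreducibleClosed (D : Set Plane) : Prop :=
  zariskiClosure D = D ∧ (MvPolynomial.vanishingIdeal ℂ D).IsPrime

/-- `D` is an irreducible component of `Z`: a maximal irreducible closed subset. -/
def IsComponent (D Z : Set Plane) : Prop :=
  Maximal (fun E : Set Plane => IsIrreducibleClosed E ∧ E ⊆ Z) D

/-- A line with real coefficients (its set of complex points). -/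
def IsLine (Z : Set Plane) : Prop :=
  ∃ a b c : ℝ, (a ≠ 0 ∨ b ≠ 0) ∧ Z = {p | (a : ℂ) * p 0 + (b : ℂ) * p 1 = (c : ℂ)}

/-- A circle with real center and positive radius (its set of complex points). -/
def IsCircle (Z : Set Plane) : Prop :=
  ∃ a b r : ℝ, 0 < r ∧ Z = {p | (p 0 - (a : ℂ)) ^ 2 + (p 1 - (b : ℂ)) ^ 2 = (r : ℂ) ^ 2}

/-! ### Polynomials in `x, y, t` -/

/-- Polynomials in `x, y, t`, written as polynomials in `t` over `ℂ[x, y]`. -/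
abbrev PolyXYT : Type := Polynomial PolyXY

/-- A complex polynomial in `t`, seen as a polynomial in `x, y, t`. -/
def inT (p : Polynomial ℂ) : PolyXYT :=
  p.map MvPolynomial.C

/-- A real polynomial in `t`, seen as a polynomial in `x, y, t`. -/
def realInT (p : Polynomial ℝ) : PolyXYT :=
  inT (p.map Complex.ofRealHom)

/-- The variable `x`. -/
def varX : PolyXYT := Polynomial.C (MvPolynomial.X 0)

/-- The variable `y`. -/
def varY : PolyXYT := Polynomial.C (MvPolynomial.X 1)

/-- `P` is the primitive part of `A` with respect to `t`, i.e. `A = c(t) * P` where `c` is the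
content of `A` with respect to `t` (the gcd of the coefficients of `A` as a polynomial in `x, y`
over `ℂ[t]`). Like the gcd, it is determined up to a nonzero constant. -/
def IsPrimitivePartT (A P : PolyXYT) : Prop :=
  (∃ c : Polynomial ℂ, c ≠ 0 ∧ A = inT c * P) ∧ ∀ e : Polynomial ℂ, inT e ∣ P → IsUnit e

/-! ### Rational parametrizations and offsets -/

/-- A real rational parametrization `t ↦ (X(t)/W(t), Y(t)/W(t))` with `gcd(X, Y, W) = 1`. -/
structure RatParam where
  X : Polynomial ℝ
  Y : Polynomial ℝ
  W : Polynomial ℝ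
  W_ne_zero : W ≠ 0
  gcd_eq_one : ∀ e : Polynomial ℝ, e ∣ X → e ∣ Y → e ∣ W → IsUnit e

namespace RatParam

variable (φ : RatParam)

/-- `U = X' W - X W'`. -/
def U : Polynomial ℝ :=
  Polynomial.derivative φ.X * φ.W - φ.X * Polynomial.derivative φ.W

/-- `V = Y' W - Y W'`. -/
def V : Polynomial ℝ :=
  Polynomial.derivative φ.Y * φ.W - φ.Y * Polynomial.derivative φ.W

/-- The parameter `t` yields an affine point. -/
def IsDefinedAt (t : ℂ) : Prop :=
  Polynomial.aeval t φ.W ≠ 0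

/-- The point `(X(t)/W(t), Y(t)/W(t))`; meaningful where `W(t) ≠ 0`. -/
def point (t : ℂ) : Plane :=
  ![Polynomial.aeval t φ.X / Polynomial.aeval t φ.W,
    Polynomial.aeval t φ.Y / Polynomial.aeval t φ.W]

/-- The curve: Zariski closure of the set of points of the parametrization. -/
def curve : Set Plane :=
  zariskiClosure {p | ∃ t : ℂ, φ.IsDefinedAt t ∧ p = φ.point t}

/-- The parametrization is injective up to finitely many parameter values. -/
def IsProper : Prop :=
  {t : ℂ | φ.IsDefinedAt t ∧
    ∃ t' : ℂ, φ.IsDefinedAt t' ∧ t' ≠ t ∧ φ.point t' = φ.point t}.Finite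

/-- The parameter `t` generates `q` at distance `d`: `q = φ(t) ± d (V, -U) / √(U² + V²)`, where
`W(t) ≠ 0` and `U(t)² + V(t)² ≠ 0`. The two signs are the two square roots `s`. -/
def ParamGenerates (d : ℝ) (t : ℂ) (q : Plane) : Prop :=
  φ.IsDefinedAt t ∧ ∃ s : ℂ, s ≠ 0 ∧
    s ^ 2 = (Polynomial.aeval t φ.U) ^ 2 + (Polynomial.aeval t φ.V) ^ 2 ∧
    q = ![φ.point t 0 + (d : ℂ) * Polynomial.aeval t φ.V / s,
          φ.point t 1 - (d : ℂ) * Polynomial.aeval t φ.U / s]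

/-- The point `p` of the curve generates the offset point `q`. -/
def Generates (d : ℝ) (p q : Plane) : Prop :=
  ∃ t : ℂ, p = φ.point t ∧ φ.ParamGenerates d t q

/-- The offset of the curve at distance `d`. -/
def offset (d : ℝ) : Set Plane :=
  zariskiClosure {q | ∃ t : ℂ, φ.ParamGenerates d t q}

/-- A simple component of the offset: almost every point of it is generated by exactly one point
of the curve. -/
def IsSimpleComponent (d : ℝ) (D : Set Plane) : Prop :=
  IsComponent D (φ.offset d) ∧ {q ∈ D | ¬ ∃! p : Plane, φ.Generates d p q}.Finite

/-- A special component of the offset: a component that is not simple. -/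
def IsSpecialComponent (d : ℝ) (D : Set Plane) : Prop :=
  IsComponent D (φ.offset d) ∧ ¬ φ.IsSimpleComponent d D

/-- The offset has a special component. -/
def HasSpecialComponent (d : ℝ) : Prop :=
  ∃ D : Set Plane, φ.IsSpecialComponent d D

/-- `U (W x - X) + V (W y - Y)`: the equation of the normal line at `t`. -/
def normalPoly : PolyXYT :=
  realInT φ.U * (realInT φ.W * varX - realInT φ.X) +
    realInT φ.V * (realInT φ.W * varY - realInT φ.Y)

/-- `(W x - X)² + (W y - Y)² - d² W²`: the equation of the circle of radius `d` at `t`. -/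
def circlePoly (d : ℝ) : PolyXYT :=
  (realInT φ.W * varX - realInT φ.X) ^ 2 + (realInT φ.W * varY - realInT φ.Y) ^ 2 -
    realInT (Polynomial.C (d ^ 2) * φ.W ^ 2)

/-- `H = F * G`, where `F` is an implicit equation of the offset, and the extraneous factor `G` is
a constant times a (possibly empty) product of linear polynomials, none of whose lines lies in the
offset. -/
def IsNonExtraneousPart (d : ℝ) (H F G : PolyXY) : Prop :=
  H = F * G ∧ zeroSet F = φ.offset d ∧
    ∃ (c : ℂ) (L : Multiset PolyXY), c ≠ 0 ∧ G = MvPolynomial.C c * L.prod ∧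
      ∀ l ∈ L, l.totalDegree = 1 ∧ ¬ zeroSet l ⊆ φ.offset d

/-- `f₁` and `f₂` are implicit equations of the components of the offset: `f₁` is irreducible,
`f₂` is irreducible if there is a second component and `f₂ = 1` otherwise, and a special
component, if there is one, is the one given by `f₂`. -/
structure IsComponentEquations (d : ℝ) (f₁ f₂ : PolyXY) : Prop where
  irreducible_fst : Irreducible f₁
  irreducible_snd : f₂ ≠ 1 → Irreducible f₂
  component_iff : ∀ D : Set Plane,
    IsComponent D (φ.offset d) ↔ D = zeroSet f₁ ∨ (f₂ ≠ 1 ∧ D = zeroSet f₂)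
  distinct : f₂ ≠ 1 → zeroSet f₁ ≠ zeroSet f₂
  special : ∀ D : Set Plane, φ.IsSpecialComponent d D → f₂ ≠ 1 ∧ D = zeroSet f₂

end RatParam

end Offset

end

/-!
Pairs `(t, s)` with `s ^ 2 = U(t) ^ 2 + V(t) ^ 2 ≠ 0` parametrize the offset, `s` choosing the side.
The curve of these flags is irreducible, or splits into two graphs `s = ± S(t)`; the image of each
branch is dense in an irreducible curve, and these curves are the components of the offset.

On the normal line through a generic point of a component, the parameters generating the point
remain roots of `P` and are simple roots of it, while `Q` vanishes to first order at the point for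
each of them. By Poisson's formula, the multiplicity of the component in `Res_t(P, Q)` is thus the
number of generating parameters. Two flags generating the same generic point have opposite normals.
If the flag curve were irreducible and doubled, or both of its branches were doubled, translating a
generic flag along its normal by a fixed nonzero distance would again give a flag; iterating, the
normal would meet the curve in infinitely many points, and the curve would be a line.

The remaining zeros of `Res_t(P, Q)` lie on the zero sets of the leading coefficient of `P` and of
`P` at finitely many exceptional `t`. These polynomials are affine, so only linear factors arise.
-/

noncomputable section

namespace Offset

section Polynomials

open MvPolynomial

variable {σ R : Type*}

theorem totalDegree_pderiv_lt [CommSemiring R] {f : MvPolynomial σ R} {i : σ}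
    (h : pderiv i f ≠ 0) : (pderiv i f).totalDegree < f.totalDegree := by
  obtain ⟨m, hm, hdeg⟩ : ∃ m ∈ (pderiv i f).support, (pderiv i f).totalDegree = m.degree :=
    Finset.exists_mem_eq_sup _ (support_nonempty.2 h) _
  rw [mem_support_iff, coeff_pderiv] at hm
  have hle : (m + Finsupp.single i 1).degree ≤ f.totalDegree :=
    le_totalDegree (mem_support_iff.2 (left_ne_zero_of_mul hm))
  rw [map_add, Finsupp.degree_single] at hle
  omega

theorem totalDegree_eq_zero_of_pderiv_eq_zero [CommSemiring R] [NoZeroDivisors R] [CharZero R]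
    {f : MvPolynomial σ R} (h : ∀ i, pderiv i f = 0) : f.totalDegree = 0 := by
  rw [totalDegree_eq_zero_iff]
  intro m hm i
  by_contra hmi
  have hcoeff : coeff (m - Finsupp.single i 1) (pderiv i f) = 0 := by rw [h, coeff_zero]
  rw [coeff_pderiv, tsub_add_cancel_of_le (by simpa using Nat.one_le_iff_ne_zero.2 hmi)] at hcoeff
  exact mul_ne_zero (mem_support_iff.1 hm) (Nat.cast_add_one_ne_zero _) hcoeff

theorem exists_not_dvd_pderiv [CommRing R] [IsDomain R] [CharZero R] {f : MvPolynomial σ R}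
    (hdeg : f.totalDegree ≠ 0) : ∃ i, ¬ f ∣ pderiv i f := by
  by_contra! h
  refine hdeg (totalDegree_eq_zero_of_pderiv_eq_zero fun i => ?_)
  by_contra h0
  exact (totalDegree_pderiv_lt h0).not_ge (totalDegree_le_of_dvd_of_isDomain (h i) h0)

theorem totalDegree_ne_zero_of_irreducible [Field R] {f : MvPolynomial σ R} (hf : Irreducible f) :
    f.totalDegree ≠ 0 := by
  intro h
  have hC := totalDegree_eq_zero_iff_eq_C.1 h
  have h0 : coeff 0 f ≠ 0 := fun h0 => hf.ne_zero (by rw [hC, h0, C_0])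
  exact hf.not_isUnit (isUnit_iff_totalDegree_of_isReduced.2 ⟨h0.isUnit, h⟩)

theorem irreducible_of_totalDegree_eq_one_of_field [Field R] {f : MvPolynomial σ R}
    (hf : f.totalDegree = 1) : Irreducible f := by
  refine irreducible_of_totalDegree_eq_one hf fun z hz => isUnit_iff_ne_zero.2 ?_
  rintro rfl
  have h0 : f = 0 := MvPolynomial.ext _ _ fun m => by simpa using hz m
  simp [h0] at hf

theorem exists_eval_ne_zero [CommRing R] [IsDomain R] [Infinite R] {f : MvPolynomial σ R}
    (hf : f ≠ 0) : ∃ p, eval p f ≠ 0 := by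
  by_contra! h
  exact hf (MvPolynomial.funext fun p => by rw [h p, map_zero])

theorem hasDerivAt_eval_comp [Fintype σ] [NontriviallyNormedField R] (f : MvPolynomial σ R)
    {γ : R → σ → R} {v : σ → R} {t : R} (h : ∀ i, HasDerivAt (fun τ => γ τ i) (v i) t) :
    HasDerivAt (fun τ => eval (γ τ) f) (∑ i, eval (γ t) (pderiv i f) * v i) t := by
  classical
  induction f using MvPolynomial.induction_on with
  | C a => simpa using hasDerivAt_const t a
  | add p q hp hq =>
    simp only [map_add, add_mul, Finset.sum_add_distrib]
    exact hp.add hq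
  | mul_X p i hp =>
    simp only [map_mul, eval_X, pderiv_mul, map_add, add_mul, Finset.sum_add_distrib]
    refine (hp.mul (h i)).congr_deriv ?_
    simp [pderiv_X, Pi.single_apply, Finset.sum_mul, mul_right_comm, apply_ite (eval (γ t))]

theorem exists_pow_mul_eval_mem [CommSemiring R] {T : Type*} (A : Subalgebra R (T → R)) {δ : T → R}
    {z : T → σ → R} (hδ : δ ∈ A) (hz : ∀ i, (fun τ => δ τ * z τ i) ∈ A) (g : MvPolynomial σ R) :
    ∃ n : ℕ, (fun τ => δ τ ^ n * eval (z τ) g) ∈ A := by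
  induction g using MvPolynomial.induction_on with
  | C a =>
    refine ⟨0, ?_⟩
    simp only [pow_zero, one_mul, eval_C]
    exact A.algebraMap_mem a
  | add p q hp hq =>
    obtain ⟨m, hm⟩ := hp
    obtain ⟨n, hn⟩ := hq
    refine ⟨m + n, ?_⟩
    convert A.add_mem (A.mul_mem (A.pow_mem hδ n) hm) (A.mul_mem (A.pow_mem hδ m) hn) using 1
    ext τ
    simp only [map_add, Pi.add_apply, Pi.mul_apply, Pi.pow_apply]
    ring
  | mul_X p i hp =>
    obtain ⟨m, hm⟩ := hp
    refine ⟨m + 1, ?_⟩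
    convert A.mul_mem hm (hz i) using 1
    ext τ
    simp only [map_mul, eval_X, Pi.mul_apply]
    ring

/-- The restriction of polynomial functions to the line through `q` with direction `v`, as
polynomials in the parameter of the line (which is `0` at `q`). -/
def lineHom [CommSemiring R] (q v : σ → R) : MvPolynomial σ R →+* Polynomial R :=
  eval₂Hom Polynomial.C fun i => Polynomial.C (q i) + Polynomial.C (v i) * Polynomial.X

section lineHom

variable [CommSemiring R] (q v : σ → R)

@[simp]
theorem lineHom_C (a : R) : lineHom q v (C a) = Polynomial.C a := by
  simp [lineHom]

@[simp]
theorem lineHom_X (i : σ) :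
    lineHom q v (X i) = Polynomial.C (q i) + Polynomial.C (v i) * Polynomial.X := by
  simp [lineHom]

theorem evalRingHom_comp_lineHom (τ : R) :
    (Polynomial.evalRingHom τ).comp (lineHom q v) = eval (q + τ • v) := by
  refine MvPolynomial.ringHom_ext (fun a => by simp) fun i => ?_
  simp only [RingHom.comp_apply, lineHom_X, Polynomial.coe_evalRingHom, Polynomial.eval_add,
    Polynomial.eval_mul, Polynomial.eval_C, Polynomial.eval_X, eval_X, Pi.add_apply,
    Pi.smul_apply, smul_eq_mul, mul_comm (v i)]

@[simp]
theorem eval_lineHom (f : MvPolynomial σ R) (τ : R) :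
    (lineHom q v f).eval τ = eval (q + τ • v) f :=
  RingHom.congr_fun (evalRingHom_comp_lineHom q v τ) f

theorem derivative_lineHom [Fintype σ] (f : MvPolynomial σ R) :
    Polynomial.derivative (lineHom q v f) =
      ∑ i, lineHom q v (pderiv i f) * Polynomial.C (v i) := by
  classical
  induction f using MvPolynomial.induction_on with
  | C a => simp
  | add p q hp hq => simp only [map_add, hp, hq, add_mul, Finset.sum_add_distrib]
  | mul_X p i hp =>
    have hX : Polynomial.derivative (lineHom q v (X i)) = Polynomial.C (v i) := by simp
    simp [hp, hX, pderiv_X, Pi.single_apply, add_mul, Finset.sum_add_distrib, Finset.sum_mul,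
      apply_ite (lineHom q v), mul_right_comm, mul_comm (lineHom q v (X i)), -lineHom_X, add_comm]

end lineHom

theorem rootMultiplicity_lineHom_eq_one [Fintype σ] [CommRing R] [IsDomain R] {q v : σ → R}
    {f : MvPolynomial σ R} (hq : eval q f = 0) (hv : ∑ i, eval q (pderiv i f) * v i ≠ 0) :
    (lineHom q v f).rootMultiplicity 0 = 1 := by
  have hderiv : ¬ (Polynomial.derivative (lineHom q v f)).IsRoot 0 := by
    simpa [derivative_lineHom, Polynomial.eval_finsetSum] using hv
  have h0 : lineHom q v f ≠ 0 := by
    rintro h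
    simp [h] at hderiv
  have hroot : (lineHom q v f).IsRoot 0 := by simpa using hq
  refine le_antisymm (not_lt.1 fun h => hderiv ?_) ((Polynomial.rootMultiplicity_pos h0).2 hroot)
  exact ((Polynomial.one_lt_rootMultiplicity_iff_isRoot h0).1 h).2

theorem rootMultiplicity_lineHom_pow_mul [Fintype σ] [CommRing R] [IsDomain R] {q v : σ → R}
    {f g : MvPolynomial σ R} (hq : eval q f = 0) (hv : ∑ i, eval q (pderiv i f) * v i ≠ 0)
    (hg : eval q g ≠ 0) (m : ℕ) : (lineHom q v (f ^ m * g)).rootMultiplicity 0 = m := by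
  classical
  have hf1 := rootMultiplicity_lineHom_eq_one hq hv
  have hf0 : lineHom q v f ≠ 0 := by
    intro h
    simp [h] at hf1
  have hgroot : ¬ (lineHom q v g).IsRoot 0 := by simpa using hg
  have hg0 : lineHom q v g ≠ 0 := by
    intro h
    simp [h] at hgroot
  rw [map_mul, map_pow, Polynomial.rootMultiplicity_mul (mul_ne_zero (pow_ne_zero m hf0) hg0),
    Polynomial.rootMultiplicity_eq_zero hgroot, ← Polynomial.count_roots, Polynomial.roots_pow,
    Multiset.count_nsmul, Polynomial.count_roots, hf1, mul_one, add_zero]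

end Polynomials

section Factorization

variable {R : Type*}

theorem associated_of_mul_eq_mul_of_forall_irreducible [CommMonoidWithZero R]
    [UniqueFactorizationMonoid R] {a b a' b' : R} {p : R → Prop} (h : a * b = a' * b')
    (h0 : a * b ≠ 0) (ha : ∀ k, Irreducible k → k ∣ a → p k)
    (hb : ∀ k, Irreducible k → k ∣ b → ¬ p k) (ha' : ∀ k, Irreducible k → k ∣ a' → p k)
    (hb' : ∀ k, Irreducible k → k ∣ b' → ¬ p k) : Associated a a' := by
  have relPrime {x y : R} (hx0 : x ≠ 0) (hx : ∀ k, Irreducible k → k ∣ x → p k)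
      (hy : ∀ k, Irreducible k → k ∣ y → ¬ p k) : IsRelPrime x y :=
    WfDvdMonoid.isRelPrime_of_no_irreducible_factors (fun h => hx0 h.1)
      fun k hk hkx hky => hy k hk hky (hx k hk hkx)
  have h0' : a' * b' ≠ 0 := h ▸ h0
  exact associated_of_dvd_dvd
    ((relPrime (left_ne_zero_of_mul h0) ha hb').dvd_of_dvd_mul_right (h ▸ dvd_mul_right a b))
    ((relPrime (left_ne_zero_of_mul h0') ha' hb).dvd_of_dvd_mul_right (h ▸ dvd_mul_right a' b'))

theorem exists_eq_pow_mul_pow_mul [CommMonoidWithZero R] [IsCancelMulZero R] {p q x a b : R}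
    {m n : ℕ} (hp : Prime p) (hpq : ¬ p ∣ q) (ha : x = p ^ m * a) (hpa : ¬ p ∣ a)
    (hb : x = q ^ n * b) (hqb : ¬ q ∣ b) : ∃ c, x = p ^ m * q ^ n * c ∧ ¬ p ∣ c ∧ ¬ q ∣ c := by
  obtain ⟨c, rfl⟩ : p ^ m ∣ b := hp.pow_dvd_of_dvd_mul_left m
    (fun h => hpq (hp.dvd_of_dvd_pow h)) (hb ▸ ha ▸ dvd_mul_right _ _)
  refine ⟨c, by rw [hb, mul_left_comm, mul_assoc], fun h => hpa ?_,
    fun h => hqb (h.mul_left _)⟩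
  have hac : a = q ^ n * c := mul_left_cancel₀ (pow_ne_zero m hp.ne_zero) (by
    rw [← ha, hb, mul_left_comm])
  exact hac ▸ h.mul_left _

end Factorization

section FactorizationMvPolynomial

open MvPolynomial

variable {σ R : Type*} [Field R] {f g : MvPolynomial σ R}

theorem isUnit_iff_exists_eq_C : IsUnit f ↔ ∃ c : R, c ≠ 0 ∧ f = C c := by
  simp only [MvPolynomial.isUnit_iff_eq_C_of_isReduced, isUnit_iff_ne_zero]

theorem exists_eq_C_mul_of_associated (h : Associated f g) : ∃ c : R, c ≠ 0 ∧ g = C c * f := by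
  obtain ⟨u, rfl⟩ := h
  obtain ⟨c, hc, hu⟩ := isUnit_iff_exists_eq_C.1 u.isUnit
  exact ⟨c, hc, by rw [hu, mul_comm]⟩

theorem exists_eq_C_mul_prod (hf : f ≠ 0) : ∃ (c : R) (L : Multiset (MvPolynomial σ R)), c ≠ 0 ∧
    f = C c * L.prod ∧ ∀ l ∈ L, Irreducible l ∧ l ∣ f := by
  obtain ⟨L, hL, hLf⟩ := WfDvdMonoid.exists_factors f hf
  obtain ⟨c, hc, hf⟩ := exists_eq_C_mul_of_associated hLf
  exact ⟨c, L, hc, hf, fun l hl => ⟨hL l hl, (Multiset.dvd_prod hl).trans hLf.dvd⟩⟩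

theorem exists_associated_of_dvd_C_mul_prod {c : R} {L : Multiset (MvPolynomial σ R)}
    (hf : Irreducible f) (hc : c ≠ 0) (hL : ∀ l ∈ L, Irreducible l) (h : f ∣ C c * L.prod) :
    ∃ l ∈ L, Associated f l := by
  rw [IsUnit.dvd_mul_left (isUnit_iff_exists_eq_C.2 ⟨c, hc, rfl⟩)] at h
  obtain ⟨l, hl, hfl⟩ := hf.prime.exists_mem_multiset_dvd h
  exact ⟨l, hl, hf.associated_of_dvd (hL l hl) hfl⟩

end FactorizationMvPolynomial

section PlaneCurves

open MvPolynomial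

theorem mem_zeroSet {f : PolyXY} {p : Plane} : p ∈ zeroSet f ↔ eval p f = 0 := Iff.rfl

theorem mem_zariskiClosure {S : Set Plane} {p : Plane} :
    p ∈ zariskiClosure S ↔ ∀ g : PolyXY, S ⊆ zeroSet g → p ∈ zeroSet g := by
  simp only [zariskiClosure, mem_zeroLocus_iff, mem_vanishingIdeal_iff, aeval_eq_eval,
    Set.subset_def, mem_zeroSet]

theorem subset_zariskiClosure (S : Set Plane) : S ⊆ zariskiClosure S :=
  fun _ hp => mem_zariskiClosure.2 fun _ hg => hg hp

theorem zariskiClosure_subset_zeroSet {S : Set Plane} {f : PolyXY} (h : S ⊆ zeroSet f) :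
    zariskiClosure S ⊆ zeroSet f :=
  fun _ hp => mem_zariskiClosure.1 hp f h

theorem zariskiClosure_mono {S T : Set Plane} (h : S ⊆ T) : zariskiClosure S ⊆ zariskiClosure T :=
  fun _ hp => mem_zariskiClosure.2 fun g hg => mem_zariskiClosure.1 hp g (h.trans hg)

theorem zariskiClosure_zeroSet (f : PolyXY) : zariskiClosure (zeroSet f) = zeroSet f :=
  (zariskiClosure_subset_zeroSet subset_rfl).antisymm (subset_zariskiClosure _)

theorem zeroSet_mul (f g : PolyXY) : zeroSet (f * g) = zeroSet f ∪ zeroSet g := by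
  ext p; simp [mem_zeroSet]

theorem zeroSet_one : zeroSet 1 = ∅ := by
  ext p; simp [mem_zeroSet]

theorem zeroSet_subset_of_dvd {f g : PolyXY} (h : f ∣ g) : zeroSet f ⊆ zeroSet g := by
  obtain ⟨k, rfl⟩ := h
  exact zeroSet_mul f k ▸ Set.subset_union_left

theorem zeroSet_eq_of_associated {f g : PolyXY} (h : Associated f g) : zeroSet f = zeroSet g :=
  (zeroSet_subset_of_dvd h.dvd).antisymm (zeroSet_subset_of_dvd h.symm.dvd)

theorem zariskiClosure_union_eq_zeroSet_mul {S T : Set Plane} {f g : PolyXY}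
    (hS : zariskiClosure S = zeroSet f) (hT : zariskiClosure T = zeroSet g) :
    zariskiClosure (S ∪ T) = zeroSet (f * g) := by
  apply Set.Subset.antisymm
  · apply zariskiClosure_subset_zeroSet
    rw [zeroSet_mul, ← hS, ← hT]
    exact Set.union_subset_union (subset_zariskiClosure _) (subset_zariskiClosure _)
  · rw [zeroSet_mul, ← hS, ← hT]
    exact Set.union_subset (zariskiClosure_mono Set.subset_union_left)
      (zariskiClosure_mono Set.subset_union_right)

theorem vanishingIdeal_zeroSet {f : PolyXY} (hf : Irreducible f) :
    vanishingIdeal ℂ (zeroSet f) = Ideal.span {f} := by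
  have hlocus : zeroSet f = zeroLocus ℂ (Ideal.span {f}) := by
    rw [zeroLocus_span]; ext p; simp [mem_zeroSet, aeval_eq_eval]
  have hprime : (Ideal.span {f}).IsPrime := (Ideal.span_singleton_prime hf.ne_zero).2 hf.prime
  rw [hlocus, vanishingIdeal_zeroLocus_eq_radical, hprime.radical]

theorem mem_vanishingIdeal_iff_subset_zeroSet {S : Set Plane} {g : PolyXY} :
    g ∈ vanishingIdeal ℂ S ↔ S ⊆ zeroSet g := by
  simp only [mem_vanishingIdeal_iff, aeval_eq_eval, Set.subset_def, mem_zeroSet]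

theorem dvd_iff_zeroSet_subset {f g : PolyXY} (hf : Irreducible f) :
    f ∣ g ↔ zeroSet f ⊆ zeroSet g := by
  rw [← Ideal.mem_span_singleton, ← vanishingIdeal_zeroSet hf,
    mem_vanishingIdeal_iff_subset_zeroSet]

theorem isIrreducibleClosed_zeroSet {f : PolyXY} (hf : Irreducible f) :
    IsIrreducibleClosed (zeroSet f) :=
  ⟨zariskiClosure_zeroSet f, by
    rw [vanishingIdeal_zeroSet hf]
    exact (Ideal.span_singleton_prime hf.ne_zero).2 hf.prime⟩

theorem IsIrreducibleClosed.subset_or_subset {E : Set Plane} (hE : IsIrreducibleClosed E)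
    {f g : PolyXY} (h : E ⊆ zeroSet (f * g)) : E ⊆ zeroSet f ∨ E ⊆ zeroSet g := by
  simp only [← mem_vanishingIdeal_iff_subset_zeroSet] at h ⊢
  exact hE.2.mem_or_mem h

theorem zeroSet_eq_of_subset {f g : PolyXY} (hf : Irreducible f) (hg : Irreducible g)
    (h : zeroSet f ⊆ zeroSet g) : zeroSet f = zeroSet g :=
  zeroSet_eq_of_associated (hf.associated_of_dvd hg ((dvd_iff_zeroSet_subset hf).2 h))

theorem isComponent_zeroSet_mul_iff {f g : PolyXY} (hf : Irreducible f) (hg : Irreducible g)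
    {D : Set Plane} :
    IsComponent D (zeroSet (f * g)) ↔ D = zeroSet f ∨ D = zeroSet g := by
  constructor
  · rintro ⟨⟨hD, hDZ⟩, hmax⟩
    refine (hD.subset_or_subset hDZ).imp (fun h => ?_) fun h => ?_
    · exact h.antisymm (hmax ⟨isIrreducibleClosed_zeroSet hf,
        zeroSet_subset_of_dvd (dvd_mul_right f g)⟩ h)
    · exact h.antisymm (hmax ⟨isIrreducibleClosed_zeroSet hg,
        zeroSet_subset_of_dvd (dvd_mul_left g f)⟩ h)
  · have hcomp {a b : PolyXY} (ha : Irreducible a) (hb : Irreducible b) :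
        IsComponent (zeroSet a) (zeroSet (a * b)) := by
      refine ⟨⟨isIrreducibleClosed_zeroSet ha, zeroSet_subset_of_dvd (dvd_mul_right a b)⟩,
        fun E hE haE => ?_⟩
      rcases hE.1.subset_or_subset hE.2 with h | h
      · exact h
      · rwa [zeroSet_eq_of_subset ha hb (haE.trans h)]
    rintro (rfl | rfl)
    · exact hcomp hf hg
    · exact mul_comm f g ▸ hcomp hg hf

theorem eq_of_le_of_ringKrullDim_le_two {R : Type*} [CommRing R] [IsNoetherianRing R]
    (hdim : ringKrullDim R ≤ 2) {I₀ I₁ I₂ M : Ideal R} [I₀.IsPrime] [I₁.IsPrime] [I₂.IsPrime]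
    [M.IsPrime] (h₀₁ : I₀ < I₁) (h₁₂ : I₁ < I₂) (h : I₂ ≤ M) : I₂ = M := by
  have height_succ {I J : Ideal R} [I.IsPrime] [J.IsPrime] (h : I < J) : I.height + 1 ≤ J.height :=
    Order.add_one_le_of_lt (Ideal.height_strict_mono_of_isPrime_of_isPrime h)
  by_contra hne
  have h₃ : (0 + 1 + 1 + 1 : ℕ∞) ≤ M.height :=
    calc (0 + 1 + 1 + 1 : ℕ∞) ≤ I₀.height + 1 + 1 + 1 := by gcongr; exact zero_le
      _ ≤ I₁.height + 1 + 1 := by gcongr; exact height_succ h₀₁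
      _ ≤ I₂.height + 1 := by gcongr; exact height_succ h₁₂
      _ ≤ M.height := height_succ (lt_of_le_of_ne h hne)
  have hM : M.height ≤ 2 := WithBot.coe_le_coe.1
    ((Ideal.height_le_ringKrullDim_of_ne_top Ideal.IsPrime.ne_top').trans hdim)
  exact absurd (h₃.trans hM) (by decide)

/-- Common zeros correspond to minimal primes over `(f, g)`, of which there are finitely many. -/
theorem finite_zeroSet_inter_zeroSet {f g : PolyXY} (hf : Irreducible f) (h : ¬ f ∣ g) :
    (zeroSet f ∩ zeroSet g).Finite := by
  let I : Ideal PolyXY := Ideal.span {f, g}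
  have hprime : (Ideal.span {f}).IsPrime := (Ideal.span_singleton_prime hf.ne_zero).2 hf.prime
  have hbot : (⊥ : Ideal PolyXY) < Ideal.span {f} := by
    rw [bot_lt_iff_ne_bot, Ne, Ideal.span_singleton_eq_bot]; exact hf.ne_zero
  have hlt : Ideal.span {f} < I := by
    refine lt_of_le_of_ne (Ideal.span_mono (by simp)) fun heq => h ?_
    rw [← Ideal.mem_span_singleton, heq]
    exact Ideal.subset_span (by simp)
  have hmin (p : Plane) (hp : p ∈ zeroSet f ∩ zeroSet g) :
      vanishingIdeal ℂ {p} ∈ I.minimalPrimes := by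
    refine ⟨⟨inferInstance, Ideal.span_le.2 ?_⟩, fun J ⟨hJ, hIJ⟩ hle => ?_⟩
    · rintro _ (rfl | rfl) <;> rw [SetLike.mem_coe, mem_vanishingIdeal_singleton_iff, aeval_eq_eval]
      exacts [hp.1, hp.2]
    · exact (eq_of_le_of_ringKrullDim_le_two (by simp) hbot (hlt.trans_le hIJ) hle).ge
  refine Set.Finite.of_finite_image ((I.finite_minimalPrimes_of_isNoetherianRing).subset
    (Set.image_subset_iff.2 hmin)) fun p _ q _ (hpq : vanishingIdeal ℂ {p} = _) => ?_
  ext i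
  have hmem : X i - C (q i) ∈ vanishingIdeal ℂ {p} := by
    simp [hpq]
  simpa [mem_vanishingIdeal_singleton_iff, sub_eq_zero] using hmem

theorem zariskiClosure_eq_zeroSet {f : PolyXY} (hf : Irreducible f) {S : Set Plane}
    (hS : S.Infinite) (h : S ⊆ zeroSet f) : zariskiClosure S = zeroSet f := by
  refine (zariskiClosure_subset_zeroSet h).antisymm fun p hp => mem_zariskiClosure.2 fun g hg => ?_
  have hfg : f ∣ g := by
    by_contra hfg
    exact hS ((finite_zeroSet_inter_zeroSet hf hfg).subset fun q hq => ⟨h hq, hg hq⟩)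
  exact zeroSet_subset_of_dvd hfg hp

end PlaneCurves

section Resultants

open Polynomial

variable {R K : Type*} [CommRing R] [Field K]

theorem eval_map_hom {S : Type*} [CommRing S] (ρ : R →+* S) (P : R[X]) (a : R) :
    (P.map ρ).eval (ρ a) = ρ (P.eval a) := by
  rw [eval_map, eval₂_at_apply]

theorem map_ne_zero_of_leadingCoeff {S : Type*} [Semiring S] {ρ : R →+* S} {P : R[X]}
    (h : ρ P.leadingCoeff ≠ 0) : P.map ρ ≠ 0 := by
  intro h0
  rw [leadingCoeff, ← coeff_map, h0, coeff_zero] at h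
  exact h rfl

theorem resultant_eq_zero_iff_exists_root {p l : K[X]} (hp : p ≠ 0) (hsplits : p.Splits) {m : ℕ}
    (hm : l.natDegree ≤ m) :
    resultant p l p.natDegree m = 0 ↔ ∃ t, p.eval t = 0 ∧ l.eval t = 0 := by
  rw [resultant_eq_prod_eval _ _ _ hm hsplits, mul_eq_zero,
    or_iff_right (pow_ne_zero _ (leadingCoeff_ne_zero.2 hp)), Multiset.prod_eq_zero_iff,
    Multiset.mem_map]
  simp only [mem_roots hp, IsRoot]

theorem map_resultant_eq_zero_iff [IsAlgClosed K] {ρ : R →+* K} {P L : R[X]}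
    (h : ρ P.leadingCoeff ≠ 0) {n : ℕ} (hn : L.natDegree ≤ n) :
    ρ (resultant P L P.natDegree n) = 0 ↔
      ∃ t, (P.map ρ).eval t = 0 ∧ (L.map ρ).eval t = 0 := by
  rw [← resultant_map_map, ← natDegree_map_of_leadingCoeff_ne_zero _ h]
  exact resultant_eq_zero_iff_exists_root (map_ne_zero_of_leadingCoeff h) (IsAlgClosed.splits _)
    (natDegree_map_le.trans hn)

theorem map_resultant_of_map_eq_prod_mul {A ι : Type*} [CommRing A] [IsDomain A] {ρ : R →+* A}
    {P : R[X]} {b : A[X]} {S : Finset ι} {τ : ι → A} (hlc : ρ P.leadingCoeff ≠ 0)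
    (hb : P.map ρ = (∏ i ∈ S, (X - C (τ i))) * b) (L : R[X]) :
    ρ (resultant P L) =
      (∏ i ∈ S, (L.map ρ).eval (τ i)) * resultant b (L.map ρ) b.natDegree L.natDegree := by
  have hmonic : (∏ i ∈ S, (X - C (τ i))).Monic := monic_prod_X_sub_C _ _
  have hb0 : b ≠ 0 := by
    rintro rfl
    exact map_ne_zero_of_leadingCoeff hlc (by rw [hb, mul_zero])
  have hdeg : P.natDegree = (∏ i ∈ S, (X - C (τ i))).natDegree + b.natDegree := by
    rw [← natDegree_map_of_leadingCoeff_ne_zero _ hlc, hb, hmonic.natDegree_mul' hb0]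
  rw [← resultant_map_map, hb, hdeg, resultant_mul_left _ _ _ _ natDegree_map_le,
    resultant_prod_left _ _ _ _ (by simp) natDegree_map_le]
  congr 1
  refine Finset.prod_congr rfl fun i _ => ?_
  rw [natDegree_X_sub_C, resultant_X_sub_C_left _ _ _ natDegree_map_le]

theorem prod_X_sub_C_C_dvd {S : Finset K} {p : K[X][X]} (h : ∀ t ∈ S, p.eval (C t) = 0) :
    ∏ t ∈ S, (X - C (C t)) ∣ p := by
  refine Finset.prod_dvd_of_coprime (fun s _ t _ hst => ?_) fun t ht => dvd_iff_isRoot.2 (h t ht)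
  refine isCoprime_X_sub_C_of_isUnit_sub ?_
  rw [← C_sub]
  exact isUnit_C.2 (sub_ne_zero.2 hst).isUnit

/-- Poisson's product formula near `0` on the line `ρ`: if the common roots of `P` and `L` at `0`
are simple for `P` and persist along the line, the other roots of `P` contribute a unit at `0`. -/
theorem exists_map_resultant_eq_prod_mul [IsAlgClosed K] {ρ : R →+* K[X]} {P L : R[X]}
    {S : Finset K} (hlc : (ρ P.leadingCoeff).eval 0 ≠ 0)
    (hroot : ∀ t ∈ S, (P.map ρ).eval (C t) = 0)
    (hsimple : ∀ t ∈ S, (derivative (P.map ((evalRingHom 0).comp ρ))).eval t ≠ 0)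
    (hcommon : ∀ t, (P.map ((evalRingHom 0).comp ρ)).eval t = 0 →
      (L.map ((evalRingHom 0).comp ρ)).eval t = 0 → t ∈ S) :
    ∃ r : K[X], r.eval 0 ≠ 0 ∧
      ρ (resultant P L) = (∏ t ∈ S, (L.map ρ).eval (C t)) * r := by
  obtain ⟨b, hb⟩ := prod_X_sub_C_C_dvd hroot
  have hρ : ρ P.leadingCoeff ≠ 0 := by
    intro h0
    exact hlc (by rw [h0, eval_zero])
  refine ⟨_, fun hr => ?_, map_resultant_of_map_eq_prod_mul hρ hb L⟩
  have hlead : ρ P.leadingCoeff = b.leadingCoeff := by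
    rw [← leadingCoeff_map_of_leadingCoeff_ne_zero _ hρ, hb,
      leadingCoeff_monic_mul (monic_prod_X_sub_C _ _)]
  have hP : P.map ((evalRingHom 0).comp ρ) =
      (∏ t ∈ S, (X - C t)) * b.map (evalRingHom 0) := by
    rw [← Polynomial.map_map, hb, Polynomial.map_mul, Polynomial.map_prod]
    simp
  obtain ⟨t, hbt, hLt⟩ := (map_resultant_eq_zero_iff (ρ := evalRingHom (0 : K))
    (hlead ▸ hlc) natDegree_map_le).1 hr
  rw [Polynomial.map_map] at hLt
  have htS : t ∈ S := hcommon t (by rw [hP, eval_mul, hbt, mul_zero]) hLt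
  have hprod : (∏ s ∈ S, (X - C s)).eval t = 0 := by
    rw [eval_prod]
    exact Finset.prod_eq_zero htS (by simp)
  refine hsimple t htS ?_
  rw [hP, derivative_mul, eval_add, eval_mul, eval_mul, hbt, hprod, mul_zero, zero_mul, add_zero]

end Resultants

section PrimitivePart

open MvPolynomial

theorem eval_map_eval (P : PolyXYT) (q : Plane) (t : ℂ) :
    (P.map (eval q)).eval t = eval q (P.eval (C t)) := by
  simpa using eval_map_hom (eval q) P (C t)

theorem eval_map_lineHom (P : PolyXYT) (q v : Plane) (t : ℂ) :
    (P.map (lineHom q v)).eval (Polynomial.C t) = lineHom q v (P.eval (C t)) := by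
  simpa using eval_map_hom (lineHom q v) P (C t)

@[simp]
theorem eval_inT (c : Polynomial ℂ) (t : ℂ) : (inT c).eval (C t) = C (c.eval t) := by
  rw [inT, eval_map_hom]

theorem map_inT (c : Polynomial ℂ) (q : Plane) : (inT c).map (eval q) = c := by
  have h : (eval q).comp C = RingHom.id ℂ := RingHom.ext fun z => by simp
  rw [inT, Polynomial.map_map, h, Polynomial.map_id]

theorem inT_mul (c e : Polynomial ℂ) : inT (c * e) = inT c * inT e :=
  Polynomial.map_mul _

theorem inT_ne_zero {c : Polynomial ℂ} (hc : c ≠ 0) : inT c ≠ 0 :=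
  (Polynomial.map_ne_zero_iff (C_injective _ _)).2 hc

theorem natDegree_inT (c : Polynomial ℂ) : (inT c).natDegree = c.natDegree :=
  Polynomial.natDegree_map_eq_of_injective (C_injective _ _) c

theorem IsPrimitivePartT.eval_ne_zero {A P : PolyXYT} (h : IsPrimitivePartT A P) (t : ℂ) :
    P.eval (C t) ≠ 0 := by
  intro h0
  refine Polynomial.not_isUnit_X_sub_C t (h.2 _ ?_)
  rwa [inT, Polynomial.map_sub, Polynomial.map_X, Polynomial.map_C, Polynomial.dvd_iff_isRoot]

theorem exists_isPrimitivePartT {A : PolyXYT} (hA : A ≠ 0) : ∃ P, IsPrimitivePartT A P := by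
  induction hn : A.natDegree using Nat.strong_induction_on generalizing A with
  | _ n ih =>
    by_cases h : ∀ e : Polynomial ℂ, inT e ∣ A → IsUnit e
    · exact ⟨A, ⟨1, one_ne_zero, by simp [inT]⟩, h⟩
    · push Not at h
      obtain ⟨e, ⟨B, rfl⟩, he⟩ := h
      have he0 : e ≠ 0 := by
        rintro rfl
        simp [inT] at hA
      have hB : B ≠ 0 := right_ne_zero_of_mul hA
      have hdeg : 0 < e.natDegree := Nat.pos_of_ne_zero fun h0 =>
        he (Polynomial.isUnit_iff_degree_eq_zero.2
          ((Polynomial.degree_eq_iff_natDegree_eq he0).2 h0))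
      rw [Polynomial.natDegree_mul (inT_ne_zero he0) hB, natDegree_inT] at hn
      obtain ⟨P, ⟨c, hc, hBP⟩, hP⟩ := ih B.natDegree (by omega) hB rfl
      exact ⟨P, ⟨e * c, mul_ne_zero he0 hc, by rw [hBP, inT_mul, mul_assoc]⟩, hP⟩

end PrimitivePart

section AffinePoly

open MvPolynomial

/-- The affine polynomial `a x + b y + c`, the equation of a line unless `a = b = 0`. -/
def affinePoly (a b c : ℂ) : PolyXY := C a * X 0 + C b * X 1 + C c

@[simp]
theorem eval_affinePoly (a b c : ℂ) (p : Plane) :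
    eval p (affinePoly a b c) = a * p 0 + b * p 1 + c := by
  simp [affinePoly]

theorem lineHom_affinePoly (q v : Plane) (a b c : ℂ) :
    lineHom q v (affinePoly a b c) =
      Polynomial.C (a * q 0 + b * q 1 + c) + Polynomial.C (a * v 0 + b * v 1) * Polynomial.X := by
  simp only [affinePoly, map_add, map_mul, lineHom_C, lineHom_X]
  ring

theorem totalDegree_affinePoly_le (a b c : ℂ) : (affinePoly a b c).totalDegree ≤ 1 := by
  have h (z : ℂ) (i : Fin 2) : (C z * X i : PolyXY).totalDegree ≤ 1 :=
    (totalDegree_mul _ _).trans (by simp)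
  refine (totalDegree_add _ _).trans (max_le ?_ (by simp))
  exact (totalDegree_add _ _).trans (max_le (h _ _) (h _ _))

theorem affinePoly_eq_zero_iff {a b c : ℂ} : affinePoly a b c = 0 ↔ a = 0 ∧ b = 0 ∧ c = 0 := by
  refine ⟨fun h => ?_, by rintro ⟨rfl, rfl, rfl⟩; simp [affinePoly]⟩
  have heval (p : Plane) : a * p 0 + b * p 1 + c = 0 := by rw [← eval_affinePoly, h, map_zero]
  have hc : c = 0 := by simpa using heval 0
  exact ⟨by simpa [hc] using heval ![1, 0], by simpa [hc] using heval ![0, 1], hc⟩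

end AffinePoly

section LinesAndCircles

open MvPolynomial

theorem totalDegree_affinePoly {a b : ℂ} (hab : a ≠ 0 ∨ b ≠ 0) (c : ℂ) :
    (affinePoly a b c).totalDegree = 1 := by
  refine le_antisymm (totalDegree_affinePoly_le a b c) (Nat.one_le_iff_ne_zero.2 fun h => ?_)
  rw [totalDegree_eq_zero_iff_eq_C] at h
  have heval (p : Plane) : a * p 0 + b * p 1 + c = coeff 0 (affinePoly a b c) := by
    rw [← eval_affinePoly, h, eval_C, coeff_C, if_pos rfl]
  have hc := heval 0
  simp only [Pi.zero_apply, mul_zero, add_zero, zero_add] at hc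
  rcases hab with ha | hb
  · exact ha (by simpa [← hc] using heval ![1, 0])
  · exact hb (by simpa [← hc] using heval ![0, 1])

theorem irreducible_affinePoly {a b : ℂ} (hab : a ≠ 0 ∨ b ≠ 0) (c : ℂ) :
    Irreducible (affinePoly a b c) :=
  irreducible_of_totalDegree_eq_one_of_field (totalDegree_affinePoly hab c)

/-- The equation of the circle with center `(a, b)` and squared radius `s`. -/
def centeredCircle (a b s : ℂ) : PolyXY := (X 0 - C a) ^ 2 + (X 1 - C b) ^ 2 - C s

@[simp]
theorem eval_centeredCircle (a b s : ℂ) (p : Plane) :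
    eval p (centeredCircle a b s) = (p 0 - a) ^ 2 + (p 1 - b) ^ 2 - s := by
  simp [centeredCircle]

/-- The affine coordinate change to the isotropic coordinates `(x - a) ± i (y - b)`, in which the
circles with center `(a, b)` are the hyperbolas with equations `x y = s`. -/
def isotropicEquiv (a b : ℂ) : PolyXY ≃ₐ[ℂ] PolyXY :=
  AlgEquiv.ofAlgHom
    (aeval ![X 0 - C a + C Complex.I * (X 1 - C b), X 0 - C a - C Complex.I * (X 1 - C b)])
    (aeval ![C a + C (1 / 2) * (X 0 + X 1), C b - C (Complex.I / 2) * (X 0 - X 1)])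
    (algHom_ext fun i => MvPolynomial.funext fun p => by
      fin_cases i
      · simp
        ring
      · simp
        linear_combination (-(p 1 - b)) * Complex.I_sq)
    (algHom_ext fun i => MvPolynomial.funext fun p => by
      fin_cases i
      · simp
        linear_combination ((p 1 - p 0) / 2) * Complex.I_sq
      · simp
        linear_combination ((p 0 - p 1) / 2) * Complex.I_sq)

theorem isotropicEquiv_mul_X_add_C (a b s : ℂ) :
    isotropicEquiv a b (X 1 * X 0 + C (-s)) = centeredCircle a b s := by
  have h0 : isotropicEquiv a b (X 0) = X 0 - C a + C Complex.I * (X 1 - C b) := aeval_X _ 0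
  have h1 : isotropicEquiv a b (X 1) = X 0 - C a - C Complex.I * (X 1 - C b) := aeval_X _ 1
  have hC : isotropicEquiv a b (C (-s)) = C (-s) := aeval_C _ _
  have hI : (C Complex.I : PolyXY) ^ 2 = -1 := by rw [← C_pow, Complex.I_sq, C_neg, C_1]
  rw [map_add, map_mul, h0, h1, hC, centeredCircle, C_neg]
  linear_combination (-(X 1 - C b) ^ 2) * hI

theorem irreducible_centeredCircle (a b : ℂ) {s : ℂ} (hs : s ≠ 0) :
    Irreducible (centeredCircle a b s) := by
  have hunit : IsUnit (C (-s) : PolyXY) := (neg_ne_zero.2 hs).isUnit.map C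
  rw [← isotropicEquiv_mul_X_add_C, MulEquiv.irreducible_iff (isotropicEquiv a b)]
  exact irreducible_mul_X_add _ _ 0 (X_ne_zero 1) (by simp) (by simp) hunit.isRelPrime_right

end LinesAndCircles

section LocalConstancy

open MvPolynomial

theorem eventually_eq_of_hasDerivAt_zero {E : Type*} [NormedAddCommGroup E] [NormedSpace ℂ E]
    {f : ℂ → E} {t : ℂ} (h : ∀ᶠ τ in nhds t, HasDerivAt f 0 τ) : ∀ᶠ τ in nhds t, f τ = f t := by
  obtain ⟨r, hr, hb⟩ := Metric.eventually_nhds_iff_ball.1 h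
  refine Metric.eventually_nhds_iff_ball.2 ⟨r, hr, fun τ hτ => ?_⟩
  exact Metric.isOpen_ball.is_const_of_deriv_eq_zero (convex_ball t r).isPreconnected
    (fun x hx => (hb x hx).differentiableAt.differentiableWithinAt)
    (fun x hx => (hb x hx).deriv) hτ (Metric.mem_ball_self hr)

end LocalConstancy

/-- A real polynomial as a complex polynomial. -/
def toC (p : Polynomial ℝ) : Polynomial ℂ := p.map Complex.ofRealHom

theorem toC_injective : Function.Injective toC :=
  Polynomial.map_injective _ Complex.ofRealHom.injective

theorem aeval_eq_eval_toC (p : Polynomial ℝ) (t : ℂ) : Polynomial.aeval t p = (toC p).eval t := by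
  rw [toC, Polynomial.eval_map]; rfl

namespace RatParam

open MvPolynomial

variable (φ : RatParam)

section ComplexCoefficients

/-- The polynomial `X` over `ℂ`. -/
def cX : Polynomial ℂ := toC φ.X

/-- The polynomial `Y` over `ℂ`. -/
def cY : Polynomial ℂ := toC φ.Y

/-- The polynomial `W` over `ℂ`. -/
def cW : Polynomial ℂ := toC φ.W

/-- The polynomial `U` over `ℂ`. -/
def cU : Polynomial ℂ := toC φ.U

/-- The polynomial `V` over `ℂ`. -/
def cV : Polynomial ℂ := toC φ.V

/-- The squared speed `U² + V²`, whose square roots parametrize the unit normals. -/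
def sqSpeed : Polynomial ℂ := φ.cU ^ 2 + φ.cV ^ 2

/-- The vector `(U(t), V(t))`, which is tangent to the curve at `φ(t)`. -/
def tangent (t : ℂ) : Plane := ![φ.cU.eval t, φ.cV.eval t]

variable {φ}

@[simp]
theorem tangent_zero (t : ℂ) : φ.tangent t 0 = φ.cU.eval t := rfl

@[simp]
theorem tangent_one (t : ℂ) : φ.tangent t 1 = φ.cV.eval t := rfl

theorem eval_sqSpeed (t : ℂ) : φ.sqSpeed.eval t = φ.cU.eval t ^ 2 + φ.cV.eval t ^ 2 := by
  simp [sqSpeed]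

theorem cU_eq : φ.cU = φ.cX.derivative * φ.cW - φ.cX * φ.cW.derivative := by
  simp [toC, U, cU, cX, cW, Polynomial.derivative_map]

theorem cV_eq : φ.cV = φ.cY.derivative * φ.cW - φ.cY * φ.cW.derivative := by
  simp [toC, V, cV, cY, cW, Polynomial.derivative_map]

theorem cW_ne_zero : φ.cW ≠ 0 := fun h =>
  φ.W_ne_zero (toC_injective (by simpa [toC, cW] using h))

theorem isDefinedAt_iff {t : ℂ} : φ.IsDefinedAt t ↔ φ.cW.eval t ≠ 0 := by
  rw [IsDefinedAt, aeval_eq_eval_toC, cW]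

theorem finite_not_isDefinedAt : {t : ℂ | ¬ φ.IsDefinedAt t}.Finite := by
  simpa only [isDefinedAt_iff, not_not] using!
    Polynomial.finite_setOfPred_isRoot φ.cW_ne_zero

theorem IsDefinedAt.eventually {t : ℂ} (ht : φ.IsDefinedAt t) :
    ∀ᶠ τ in nhds t, φ.IsDefinedAt τ := by
  simp only [isDefinedAt_iff] at ht ⊢
  exact φ.cW.continuous.continuousAt.eventually_ne ht

theorem point_zero (t : ℂ) : φ.point t 0 = φ.cX.eval t / φ.cW.eval t := by
  simp [point, aeval_eq_eval_toC, cX, cW]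

theorem point_one (t : ℂ) : φ.point t 1 = φ.cY.eval t / φ.cW.eval t := by
  simp [point, aeval_eq_eval_toC, cY, cW]

open scoped ComplexConjugate in
theorem isDefinedAt_conj {t : ℂ} : φ.IsDefinedAt (conj t) ↔ φ.IsDefinedAt t := by
  rw [IsDefinedAt, IsDefinedAt, Polynomial.aeval_conj, map_ne_zero]

open scoped ComplexConjugate in
theorem point_conj (t : ℂ) (i : Fin 2) : φ.point (conj t) i = conj (φ.point t i) := by
  fin_cases i <;> simp [point, Polynomial.aeval_conj]

theorem hasDerivAt_point {t : ℂ} (ht : φ.IsDefinedAt t) :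
    HasDerivAt φ.point ((φ.cW.eval t ^ 2)⁻¹ • φ.tangent t) t := by
  have h (p : Polynomial ℂ) : HasDerivAt (fun τ => p.eval τ / φ.cW.eval τ)
      ((φ.cW.eval t ^ 2)⁻¹ * (p.derivative * φ.cW - p * φ.cW.derivative).eval t) t :=
    ((p.hasDerivAt t).div (φ.cW.hasDerivAt t) (isDefinedAt_iff.1 ht)).congr_deriv (by
      simp [div_eq_inv_mul])
  refine hasDerivAt_pi.2 fun i => ?_
  fin_cases i
  · simpa [point_zero, cU_eq] using h φ.cX
  · simpa [point_one, cV_eq] using h φ.cY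

theorem U_eq_zero_and_V_eq_zero_of_sqSpeed_eq_zero (h : φ.sqSpeed = 0) : φ.U = 0 ∧ φ.V = 0 := by
  have hUV : φ.U ^ 2 + φ.V ^ 2 = 0 := toC_injective (by simpa [sqSpeed, cU, cV, toC] using h)
  have heval (t : ℝ) : φ.U.eval t = 0 ∧ φ.V.eval t = 0 := by
    have : φ.U.eval t ^ 2 + φ.V.eval t ^ 2 = 0 := by
      simpa using congrArg (Polynomial.eval t) hUV
    constructor <;> nlinarith [sq_nonneg (φ.U.eval t), sq_nonneg (φ.V.eval t)]
  exact ⟨Polynomial.funext fun t => by simp [(heval t).1],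
    Polynomial.funext fun t => by simp [(heval t).2]⟩

theorem sqSpeed_ne_zero (hφ : φ.IsProper) : φ.sqSpeed ≠ 0 := by
  intro h
  obtain ⟨hU, hV⟩ := U_eq_zero_and_V_eq_zero_of_sqSpeed_eq_zero h
  have htangent (t : ℂ) : φ.tangent t = 0 := by
    ext i
    fin_cases i <;> simp [tangent, cU, cV, hU, hV, toC]
  obtain ⟨t, ht⟩ := φ.finite_not_isDefinedAt.infinite_compl.nonempty
  rw [Set.mem_compl_iff, Set.mem_ofPred_eq, not_not] at ht
  have hconst : ∀ᶠ τ in nhds t, φ.point τ = φ.point t := by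
    refine eventually_eq_of_hasDerivAt_zero ?_
    filter_upwards [ht.eventually] with τ hτ
    exact (hasDerivAt_point hτ).congr_deriv (by rw [htangent, smul_zero])
  have hinf := (infinite_of_mem_nhds t (ht.eventually.and hconst)).sdiff (Set.finite_singleton t)
  refine hinf (hφ.subset ?_)
  rintro τ ⟨⟨hτ, heq⟩, hne⟩
  exact ⟨hτ, t, ht, Ne.symm hne, heq.symm⟩

end ComplexCoefficients

section Curve

variable {φ}

theorem infinite_setOf_isDefinedAt : {t : ℂ | φ.IsDefinedAt t}.Infinite := by
  simpa [Set.compl_def] using φ.finite_not_isDefinedAt.infinite_compl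

theorem infinite_points (hφ : φ.IsProper) :
    {p | ∃ t : ℂ, φ.IsDefinedAt t ∧ p = φ.point t}.Infinite := by
  refine ((φ.infinite_setOf_isDefinedAt.sdiff hφ).image (f := φ.point) ?_).mono ?_
  · intro s hs t ht hst
    by_contra hne
    exact hs.2 ⟨hs.1, t, ht.1, Ne.symm hne, hst.symm⟩
  · rintro _ ⟨t, ht, rfl⟩
    exact ⟨t, ht.1, rfl⟩

theorem exists_cW_pow_mul_eval_point_eq (g : PolyXY) : ∃ (n : ℕ) (N : Polynomial ℂ),
    ∀ t, φ.IsDefinedAt t → φ.cW.eval t ^ n * eval (φ.point t) g = N.eval t := by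
  let ev : Polynomial ℂ →ₐ[ℂ] ({t // φ.IsDefinedAt t} → ℂ) :=
    AlgHom.pi fun t => Polynomial.aeval t.1
  have hev (N : Polynomial ℂ) (t) : ev N t = N.eval t.1 := Polynomial.aeval_def _ _
  obtain ⟨n, N, hN⟩ := exists_pow_mul_eval_mem ev.range (δ := fun t => φ.cW.eval t.1)
    (z := fun t => φ.point t.1) ⟨φ.cW, funext fun t => hev _ t⟩ (fun i => by
      have hW (t : {t // φ.IsDefinedAt t}) : φ.cW.eval t.1 ≠ 0 := isDefinedAt_iff.1 t.2
      fin_cases i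
      · exact ⟨φ.cX, funext fun t => by simp [hev, point_zero, mul_div_cancel₀ _ (hW t)]⟩
      · exact ⟨φ.cY, funext fun t => by simp [hev, point_one, mul_div_cancel₀ _ (hW t)]⟩) g
  exact ⟨n, N, fun t ht => by rw [← hev N ⟨t, ht⟩]; exact (congrFun hN ⟨t, ht⟩).symm⟩

theorem eval_point_eq_zero_of_infinite {g : PolyXY}
    (h : {t | φ.IsDefinedAt t ∧ eval (φ.point t) g = 0}.Infinite) {t : ℂ} (ht : φ.IsDefinedAt t) :
    eval (φ.point t) g = 0 := by
  obtain ⟨n, N, hN⟩ := φ.exists_cW_pow_mul_eval_point_eq g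
  have hN0 : N = 0 := Polynomial.eq_zero_of_infinite_isRoot _ (h.mono fun t ht => by
    rw [Set.mem_ofPred_eq, Polynomial.IsRoot, ← hN t ht.1, ht.2, mul_zero])
  have := hN t ht
  rw [hN0, Polynomial.eval_zero] at this
  exact (mul_eq_zero.1 this).resolve_left (pow_ne_zero _ (isDefinedAt_iff.1 ht))

theorem curve_eq_zeroSet (hφ : φ.IsProper) {f : PolyXY} (hf : Irreducible f)
    (h : ∀ t, φ.IsDefinedAt t → eval (φ.point t) f = 0) : φ.curve = zeroSet f :=
  zariskiClosure_eq_zeroSet hf (infinite_points hφ) (by rintro _ ⟨t, ht, rfl⟩; exact h t ht)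

open scoped ComplexConjugate

theorem isLine_curve_of_real (hφ : φ.IsProper) {a b c : ℝ} (hab : a ≠ 0 ∨ b ≠ 0)
    (h : ∀ t, φ.IsDefinedAt t → eval (φ.point t) (affinePoly a b c) = 0) : IsLine φ.curve := by
  have hab' : (a : ℂ) ≠ 0 ∨ (b : ℂ) ≠ 0 := by exact_mod_cast hab
  refine ⟨a, b, -c, hab, ?_⟩
  rw [curve_eq_zeroSet hφ (irreducible_affinePoly hab' c) h]
  ext p
  simp [mem_zeroSet, eq_neg_iff_add_eq_zero]

theorem isLine_curve (hφ : φ.IsProper) {a b c : ℂ} (hab : a ≠ 0 ∨ b ≠ 0)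
    (h : {t | φ.IsDefinedAt t ∧ eval (φ.point t) (affinePoly a b c) = 0}.Infinite) :
    IsLine φ.curve := by
  have hall {t : ℂ} (ht : φ.IsDefinedAt t) : a * φ.point t 0 + b * φ.point t 1 + c = 0 := by
    rw [← eval_affinePoly]
    exact eval_point_eq_zero_of_infinite h ht
  have hconj {t : ℂ} (ht : φ.IsDefinedAt t) :
      conj a * φ.point t 0 + conj b * φ.point t 1 + conj c = 0 := by
    simpa [point_conj] using congrArg conj (hall (isDefinedAt_conj.2 ht))
  by_cases hre : a.re ≠ 0 ∨ b.re ≠ 0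
  · refine isLine_curve_of_real hφ (c := c.re) hre fun t ht => ?_
    rw [eval_affinePoly, Complex.re_eq_add_conj, Complex.re_eq_add_conj, Complex.re_eq_add_conj]
    linear_combination (hall ht + hconj ht) / 2
  · have him : a.im ≠ 0 ∨ b.im ≠ 0 := by
      push Not at hre
      exact hab.imp (fun ha h0 => ha (Complex.ext hre.1 h0)) fun hb h0 =>
        hb (Complex.ext hre.2 h0)
    refine isLine_curve_of_real hφ (c := c.im) him fun t ht => ?_
    rw [eval_affinePoly, Complex.im_eq_sub_conj, Complex.im_eq_sub_conj, Complex.im_eq_sub_conj]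
    linear_combination (hall ht - hconj ht) / (2 * Complex.I)

theorem isCircle_curve_of_real (hφ : φ.IsProper) {a b d : ℝ} (hd : 0 < d)
    (h : ∀ t, φ.IsDefinedAt t → eval (φ.point t) (centeredCircle a b (d ^ 2)) = 0) :
    IsCircle φ.curve := by
  have hd2 : (d : ℂ) ^ 2 ≠ 0 := by exact_mod_cast (pow_pos hd 2).ne'
  refine ⟨a, b, d, hd, ?_⟩
  rw [curve_eq_zeroSet hφ (irreducible_centeredCircle a b hd2) h]
  ext p
  simp [mem_zeroSet, sub_eq_zero]

theorem isLine_or_isCircle_curve (hφ : φ.IsProper) {a b : ℂ} {d : ℝ} (hd : 0 < d)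
    (h : {t | φ.IsDefinedAt t ∧ eval (φ.point t) (centeredCircle a b (d ^ 2)) = 0}.Infinite) :
    IsLine φ.curve ∨ IsCircle φ.curve := by
  have hall {t : ℂ} (ht : φ.IsDefinedAt t) :
      (φ.point t 0 - a) ^ 2 + (φ.point t 1 - b) ^ 2 - d ^ 2 = 0 := by
    rw [← eval_centeredCircle]
    exact eval_point_eq_zero_of_infinite h ht
  have hconj {t : ℂ} (ht : φ.IsDefinedAt t) :
      (φ.point t 0 - conj a) ^ 2 + (φ.point t 1 - conj b) ^ 2 - d ^ 2 = 0 := by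
    simpa [point_conj] using congrArg conj (hall (isDefinedAt_conj.2 ht))
  by_cases hreal : conj a = a ∧ conj b = b
  · right
    rw [Complex.conj_eq_iff_re, Complex.conj_eq_iff_re] at hreal
    refine isCircle_curve_of_real hφ (a := a.re) (b := b.re) hd fun t ht => ?_
    rw [eval_centeredCircle, hreal.1, hreal.2, hall ht]
  · left
    refine isLine_curve hφ (a := 2 * (conj a - a)) (b := 2 * (conj b - b))
      (c := a ^ 2 - conj a ^ 2 + (b ^ 2 - conj b ^ 2)) ?_ ?_
    · rw [not_and_or] at hreal
      simpa [sub_eq_zero] using hreal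
    · refine infinite_setOf_isDefinedAt.mono fun t ht => ⟨ht, ?_⟩
      rw [eval_affinePoly]
      linear_combination hall ht - hconj ht

end Curve

end RatParam

namespace RatParam

open MvPolynomial Filter

variable {φ : RatParam} {d : ℝ} {B : Set (ℂ × ℂ)}

section Flags

/-- The standing assumptions on the curve and on the distance. -/
structure IsAdmissible (φ : RatParam) (d : ℝ) : Prop where
  pos : 0 < d
  not_isLine : ¬ IsLine φ.curve
  not_isCircle : ¬ IsCircle φ.curve
  isProper : φ.IsProper

variable (φ) in
/-- The curve parametrizing the offset: pairs `(t, s)` with `s² = U(t)² + V(t)²`. -/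
def flags : Set (ℂ × ℂ) :=
  {e | φ.IsDefinedAt e.1 ∧ e.2 ≠ 0 ∧ e.2 ^ 2 = φ.sqSpeed.eval e.1}

variable (φ) in
/-- The unit normal `(V, -U) / s` at a flag `(t, s)`. -/
def normal (e : ℂ × ℂ) : Plane := ![φ.cV.eval e.1 / e.2, -(φ.cU.eval e.1 / e.2)]

variable (φ) in
/-- The offset point generated by a flag. -/
def offsetPoint (d : ℝ) (e : ℂ × ℂ) : Plane := φ.point e.1 + (d : ℂ) • φ.normal e

theorem paramGenerates_iff {t : ℂ} {q : Plane} :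
    φ.ParamGenerates d t q ↔ ∃ s, (t, s) ∈ φ.flags ∧ φ.offsetPoint d (t, s) = q := by
  have hpoint (s : ℂ) : φ.offsetPoint d (t, s) =
      ![φ.point t 0 + (d : ℂ) * φ.cV.eval t / s, φ.point t 1 - (d : ℂ) * φ.cU.eval t / s] := by
    ext i
    fin_cases i
    · simp [offsetPoint, normal, mul_div_assoc]
    · simp [offsetPoint, normal, mul_div_assoc, sub_eq_add_neg]
  simp only [ParamGenerates, aeval_eq_eval_toC, flags, Set.mem_ofPred_eq, eval_sqSpeed, hpoint,
    ← exists_and_left, and_assoc, cU, cV, eq_comm]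

theorem offset_eq : φ.offset d = zariskiClosure (φ.offsetPoint d '' φ.flags) := by
  rw [offset]
  congr 1
  ext q
  simp only [Set.mem_ofPred_eq, paramGenerates_iff, Set.mem_image, Prod.exists]

theorem generates_iff {p q : Plane} :
    φ.Generates d p q ↔ ∃ e ∈ φ.flags, φ.offsetPoint d e = q ∧ φ.point e.1 = p := by
  simp only [Generates, paramGenerates_iff, Prod.exists]
  grind

theorem sqSpeed_eval_ne_zero {e : ℂ × ℂ} (he : e ∈ φ.flags) : φ.sqSpeed.eval e.1 ≠ 0 := by
  rw [← he.2.2]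
  exact pow_ne_zero _ he.2.1

theorem normal_sq {e : ℂ × ℂ} (he : e ∈ φ.flags) : φ.normal e 0 ^ 2 + φ.normal e 1 ^ 2 = 1 := by
  have h0 := he.2.1
  have h := he.2.2
  rw [eval_sqSpeed] at h
  simp only [normal, Matrix.cons_val_zero, Matrix.cons_val_one]
  field_simp
  linear_combination -h

theorem normal_ne_zero {e : ℂ × ℂ} (he : e ∈ φ.flags) : φ.normal e ≠ 0 := by
  intro h
  simpa [h] using normal_sq he

theorem tangent_mul_normal (e : ℂ × ℂ) :
    φ.tangent e.1 0 * φ.normal e 0 + φ.tangent e.1 1 * φ.normal e 1 = 0 := by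
  simp only [normal, tangent_zero, tangent_one, Matrix.cons_val_zero, Matrix.cons_val_one]
  ring

theorem exists_eq_smul_normal {e : ℂ × ℂ} (he : e ∈ φ.flags) {v : Plane}
    (hv : v 0 * φ.tangent e.1 0 + v 1 * φ.tangent e.1 1 = 0) : ∃ c : ℂ, v = c • φ.normal e := by
  have hs := he.2.1
  have hsq := he.2.2
  rw [eval_sqSpeed] at hsq
  rw [tangent_zero, tangent_one] at hv
  refine ⟨(v 0 * φ.cV.eval e.1 - v 1 * φ.cU.eval e.1) / e.2, ?_⟩
  ext i
  fin_cases i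
  · simp only [normal, Fin.zero_eta, Pi.smul_apply, smul_eq_mul, Matrix.cons_val_zero]
    field_simp
    linear_combination v 0 * hsq + φ.cU.eval e.1 * hv
  · simp only [normal, Fin.mk_one, Pi.smul_apply, smul_eq_mul, Matrix.cons_val_one,
      Matrix.cons_val_zero]
    field_simp
    linear_combination v 1 * hsq + φ.cV.eval e.1 * hv

theorem neg_mem_flags {e : ℂ × ℂ} (he : e ∈ φ.flags) : (e.1, -e.2) ∈ φ.flags :=
  ⟨he.1, neg_ne_zero.2 he.2.1, by simpa using he.2.2⟩

theorem normal_neg (e : ℂ × ℂ) : φ.normal (e.1, -e.2) = -φ.normal e := by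
  ext i
  fin_cases i <;> simp [normal, div_neg]

theorem flag_ext {e e' : ℂ × ℂ} (he : e ∈ φ.flags) (he' : e' ∈ φ.flags) (h1 : e.1 = e'.1)
    (h2 : φ.normal e = φ.normal e') : e = e' := by
  have hsq : e.2 ^ 2 = e'.2 ^ 2 := by rw [he.2.2, he'.2.2, h1]
  refine Prod.ext h1 ((sq_eq_sq_iff_eq_or_eq_neg.1 hsq).resolve_right fun hneg => ?_)
  have heq : e = (e'.1, -e'.2) := Prod.ext h1 hneg
  rw [heq, normal_neg, neg_eq_self] at h2
  exact normal_ne_zero he' h2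

theorem finite_flags_of_finite {T : Set ℂ} (hT : T.Finite) : {e ∈ φ.flags | e.1 ∈ T}.Finite := by
  have hs (t : ℂ) : {s : ℂ | s ^ 2 = φ.sqSpeed.eval t}.Finite := by
    refine (Polynomial.finite_setOfPred_isRoot
      (Polynomial.X_pow_sub_C_ne_zero two_pos (φ.sqSpeed.eval t))).subset fun s hs => ?_
    simpa [sub_eq_zero] using hs
  refine (hT.biUnion fun t _ => (hs t).image fun s => (t, s)).subset ?_
  rintro ⟨t, s⟩ ⟨hflag, ht⟩
  exact Set.mem_iUnion₂.2 ⟨t, ht, s, hflag.2.2, rfl⟩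

end Flags

section Branches

variable (φ) in
/-- The graph of a polynomial square root of `U² + V²`. -/
def rootBranch (S : Polynomial ℂ) : Set (ℂ × ℂ) := {e ∈ φ.flags | e.2 = S.eval e.1}

variable (φ) in
/-- The irreducible components of the curve of flags: the whole curve if `U² + V²` is not a square,
and the graphs of its two square roots otherwise. -/
def IsBranch (B : Set (ℂ × ℂ)) : Prop :=
  (B = φ.flags ∧ ¬ IsSquare φ.sqSpeed) ∨
    ∃ S : Polynomial ℂ, S ^ 2 = φ.sqSpeed ∧ B = φ.rootBranch S

theorem isBranch_rootBranch {S : Polynomial ℂ} (hS : S ^ 2 = φ.sqSpeed) :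
    φ.IsBranch (φ.rootBranch S) := Or.inr ⟨S, hS, rfl⟩

theorem isBranch_flags_or :
    φ.IsBranch φ.flags ∨ ∃ S : Polynomial ℂ, S ^ 2 = φ.sqSpeed ∧
      φ.flags = φ.rootBranch S ∪ φ.rootBranch (-S) := by
  refine or_iff_not_imp_left.2 fun h => ?_
  obtain ⟨S, hS⟩ : IsSquare φ.sqSpeed := not_not.1 fun hsq => h (Or.inl ⟨rfl, hsq⟩)
  rw [← sq] at hS
  refine ⟨S, hS.symm, Set.Subset.antisymm (fun e he => ?_)
    (Set.union_subset (fun e he => he.1) fun e he => he.1)⟩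
  have hsq : e.2 ^ 2 = S.eval e.1 ^ 2 := by rw [he.2.2, hS, Polynomial.eval_pow]
  exact (sq_eq_sq_iff_eq_or_eq_neg.1 hsq).imp (fun h => ⟨he, h⟩) fun h => ⟨he, by simpa using h⟩

theorem IsBranch.subset_flags (hB : φ.IsBranch B) : B ⊆ φ.flags := by
  rcases hB with ⟨rfl, -⟩ | ⟨S, -, rfl⟩
  · exact subset_rfl
  · exact fun e he => he.1

theorem IsBranch.exists_mem (hB : φ.IsBranch B) {t : ℂ} (hW : φ.IsDefinedAt t)
    (hE : φ.sqSpeed.eval t ≠ 0) : ∃ s, (t, s) ∈ B := by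
  have hmem {s : ℂ} (hs : s ^ 2 = φ.sqSpeed.eval t) : (t, s) ∈ φ.flags :=
    ⟨hW, ne_zero_pow two_ne_zero (hs ▸ hE), hs⟩
  rcases hB with ⟨rfl, -⟩ | ⟨S, hS, rfl⟩
  · obtain ⟨s, hs⟩ := IsAlgClosed.exists_pow_nat_eq (φ.sqSpeed.eval t) two_pos
    exact ⟨s, hmem hs⟩
  · exact ⟨S.eval t, hmem (by rw [← hS, Polynomial.eval_pow]), rfl⟩

/-- The filter of cofinite subsets of `B`; a property of flags that holds eventually along it is a
property of the generic flag of `B`. -/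
def genericOn (B : Set (ℂ × ℂ)) : Filter (ℂ × ℂ) := cofinite ⊓ 𝓟 B

theorem eventually_genericOn {p : ℂ × ℂ → Prop} :
    (∀ᶠ e in genericOn B, p e) ↔ {e ∈ B | ¬ p e}.Finite := by
  rw [genericOn, eventually_inf_principal, eventually_cofinite]
  simp only [Classical.not_imp]

theorem eventually_mem_genericOn : ∀ᶠ e in genericOn B, e ∈ B :=
  mem_inf_of_right (mem_principal_self B)

theorem IsBranch.eventually_fst_notMem (hB : φ.IsBranch B) {T : Set ℂ} (hT : T.Finite) :
    ∀ᶠ e in genericOn B, e.1 ∉ T := by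
  rw [eventually_genericOn]
  refine (finite_flags_of_finite (φ := φ) hT).subset ?_
  rintro e ⟨he, heT⟩
  exact ⟨hB.subset_flags he, not_not.1 heT⟩

theorem IsBranch.infinite_fst (hB : φ.IsBranch B) (h : φ.IsAdmissible d) :
    {t | ∃ s, (t, s) ∈ B}.Infinite := by
  have hroots := Polynomial.finite_setOfPred_isRoot (sqSpeed_ne_zero h.isProper)
  exact (infinite_setOf_isDefinedAt.sdiff hroots).mono fun t ht => hB.exists_mem ht.1 ht.2

theorem IsBranch.infinite (hB : φ.IsBranch B) (h : φ.IsAdmissible d) : B.Infinite := by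
  intro hfin
  refine hB.infinite_fst h ((hfin.image Prod.fst).subset ?_)
  rintro t ⟨s, hs⟩
  exact ⟨_, hs, rfl⟩

theorem IsBranch.exists_of_eventually (hB : φ.IsBranch B) (h : φ.IsAdmissible d)
    {p : ℂ × ℂ → Prop} (hp : ∀ᶠ e in genericOn B, p e) : ∃ e ∈ B, p e := by
  have : (genericOn B).NeBot := cofinite_inf_principal_neBot_iff.2 (hB.infinite h)
  exact (eventually_mem_genericOn.and hp).exists

theorem eventually_flags_of_isBranch {p : ℂ × ℂ → Prop}
    (h : ∀ B, φ.IsBranch B → ∀ᶠ e in genericOn B, p e) : ∀ᶠ e in genericOn φ.flags, p e := by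
  rcases isBranch_flags_or (φ := φ) with hB | ⟨S, hS, hf⟩
  · exact h _ hB
  · rw [hf, genericOn, ← sup_principal, inf_sup_left, eventually_sup]
    exact ⟨h _ (isBranch_rootBranch hS), h _ (isBranch_rootBranch (by rwa [neg_sq]))⟩

end Branches

section FlagFunctions

theorem norm_ne_zero_of_not_isSquare (h : ¬ IsSquare φ.sqSpeed) {a b : Polynomial ℂ}
    (hab : a ≠ 0 ∨ b ≠ 0) : a ^ 2 - b ^ 2 * φ.sqSpeed ≠ 0 := by
  intro hr
  rw [sub_eq_zero] at hr
  by_cases hb : b = 0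
  · exact hab.elim (fun ha => ha (by simpa [hb] using hr)) fun hb' => hb' hb
  · obtain ⟨k, rfl⟩ : b ∣ a := (UniqueFactorizationMonoid.pow_dvd_pow_iff_dvd two_ne_zero).1 ⟨_, hr⟩
    refine h ⟨k, mul_left_cancel₀ (pow_ne_zero 2 hb) ?_⟩
    rw [← hr]
    ring

theorem IsBranch.eventually_ne_zero (hB : φ.IsBranch B) (a b : Polynomial ℂ)
    (h : ∃ e ∈ B, a.eval e.1 + b.eval e.1 * e.2 ≠ 0) :
    ∀ᶠ e in genericOn B, a.eval e.1 + b.eval e.1 * e.2 ≠ 0 := by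
  -- A zero of the function is a zero of a nonzero polynomial in `t`: of its norm `a² - b² s²` if
  -- `s` is not a polynomial in `t`, of the function itself otherwise.
  obtain ⟨r, hr, hroot⟩ : ∃ r : Polynomial ℂ, r ≠ 0 ∧
      ∀ e ∈ B, a.eval e.1 + b.eval e.1 * e.2 = 0 → r.IsRoot e.1 := by
    obtain ⟨e₀, he₀, h0⟩ := h
    rcases hB with ⟨rfl, hsq⟩ | ⟨S, -, rfl⟩
    · refine ⟨_, norm_ne_zero_of_not_isSquare hsq (a := a) (b := b) ?_, fun e he h1 => ?_⟩
      · by_contra! hab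
        simp [hab] at h0
      · simp only [Polynomial.IsRoot, Polynomial.eval_sub, Polynomial.eval_mul,
          Polynomial.eval_pow, ← he.2.2]
        linear_combination (a.eval e.1 - b.eval e.1 * e.2) * h1
    · refine ⟨a + b * S, fun hr => h0 ?_, fun e he h1 => ?_⟩
      · rw [he₀.2, ← Polynomial.eval_mul, ← Polynomial.eval_add, hr, Polynomial.eval_zero]
      · simpa [he.2] using h1
  filter_upwards [hB.eventually_fst_notMem (Polynomial.finite_setOfPred_isRoot hr),
    eventually_mem_genericOn] with e he hmem h0
  exact he (hroot e hmem h0)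

variable (φ) in
/-- The functions `a(t) + b(t) s` on the curve of flags. -/
def flagFunctions : Subalgebra ℂ (φ.flags → ℂ) where
  carrier := {h | ∃ a b : Polynomial ℂ, ∀ e, h e = a.eval e.1.1 + b.eval e.1.1 * e.1.2}
  mul_mem' := by
    rintro f g ⟨a, b, hf⟩ ⟨a', b', hg⟩
    refine ⟨a * a' + b * b' * φ.sqSpeed, a * b' + a' * b, fun e => ?_⟩
    simp only [Pi.mul_apply, hf, hg, Polynomial.eval_add, Polynomial.eval_mul, ← e.2.2.2]
    ring
  add_mem' := by
    rintro f g ⟨a, b, hf⟩ ⟨a', b', hg⟩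
    refine ⟨a + a', b + b', fun e => ?_⟩
    simp only [Pi.add_apply, hf, hg, Polynomial.eval_add]
    ring
  algebraMap_mem' z := ⟨Polynomial.C z, 0, fun e => by simp⟩

theorem exists_pow_mul_eval_offsetPoint_eq (d : ℝ) (g : PolyXY) :
    ∃ (n : ℕ) (a b : Polynomial ℂ), ∀ e ∈ φ.flags,
      (φ.cW.eval e.1 * e.2) ^ n * eval (φ.offsetPoint d e) g = a.eval e.1 + b.eval e.1 * e.2 := by
  obtain ⟨n, a, b, h⟩ := exists_pow_mul_eval_mem φ.flagFunctions
    (δ := fun e => φ.cW.eval e.1.1 * e.1.2) (z := fun e => φ.offsetPoint d e.1)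
    ⟨0, φ.cW, by simp⟩ (fun i => by
      have hW (e : φ.flags) : φ.cW.eval e.1.1 ≠ 0 := isDefinedAt_iff.1 e.2.1
      have hs (e : φ.flags) : e.1.2 ≠ 0 := e.2.2.1
      fin_cases i
      · refine ⟨Polynomial.C (d : ℂ) * φ.cW * φ.cV, φ.cX, fun e => ?_⟩
        simp [offsetPoint, normal, point_zero]
        field_simp [hW e, hs e]
        ring
      · refine ⟨-(Polynomial.C (d : ℂ) * φ.cW * φ.cU), φ.cY, fun e => ?_⟩
        simp [offsetPoint, normal, point_one]
        field_simp [hW e, hs e]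
        ring) g
  exact ⟨n, a, b, fun e he => h ⟨e, he⟩⟩

theorem IsBranch.eventually_eval_offsetPoint_ne_zero (hB : φ.IsBranch B) {g : PolyXY}
    (h : ∃ e ∈ B, eval (φ.offsetPoint d e) g ≠ 0) :
    ∀ᶠ e in genericOn B, eval (φ.offsetPoint d e) g ≠ 0 := by
  obtain ⟨n, a, b, hab⟩ := exists_pow_mul_eval_offsetPoint_eq (φ := φ) d g
  obtain ⟨e₀, he₀, h0⟩ := h
  have hf := hB.subset_flags he₀
  have hab₀ : a.eval e₀.1 + b.eval e₀.1 * e₀.2 ≠ 0 := by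
    rw [← hab _ hf]
    exact mul_ne_zero (pow_ne_zero _ (mul_ne_zero (isDefinedAt_iff.1 hf.1) hf.2.1)) h0
  filter_upwards [hB.eventually_ne_zero a b ⟨e₀, he₀, hab₀⟩, eventually_mem_genericOn]
    with e he hmem hzero
  exact he (by rw [← hab _ (hB.subset_flags hmem), hzero, mul_zero])

theorem eval_point_centeredCircle_offsetPoint {e : ℂ × ℂ} (he : e ∈ φ.flags) :
    eval (φ.point e.1)
      (centeredCircle (φ.offsetPoint d e 0) (φ.offsetPoint d e 1) (d ^ 2)) = 0 := by
  simp only [eval_centeredCircle, offsetPoint, Pi.add_apply, Pi.smul_apply, smul_eq_mul]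
  linear_combination (d : ℂ) ^ 2 * normal_sq he

theorem IsBranch.eventually_offsetPoint_ne (hB : φ.IsBranch B) (h : φ.IsAdmissible d)
    (q : Plane) : ∀ᶠ e in genericOn B, φ.offsetPoint d e ≠ q := by
  -- Otherwise `q` would be at distance `d` from infinitely many points of the curve.
  obtain ⟨e, he, hne⟩ : ∃ e ∈ B, φ.offsetPoint d e ≠ q := by
    by_contra! hq
    refine (isLine_or_isCircle_curve h.isProper (a := q 0) (b := q 1) h.pos
      ((hB.infinite_fst h).mono ?_)).elim h.not_isLine h.not_isCircle
    rintro t ⟨s, hs⟩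
    have hf := hB.subset_flags hs
    have hcircle := eval_point_centeredCircle_offsetPoint (d := d) hf
    rw [hq _ hs] at hcircle
    exact ⟨hf.1, hcircle⟩
  obtain ⟨i, hi⟩ := Function.ne_iff.1 hne
  have hX : eval (φ.offsetPoint d e) (MvPolynomial.X i - C (q i) : PolyXY) ≠ 0 := by
    simpa [sub_eq_zero] using hi
  filter_upwards [hB.eventually_eval_offsetPoint_ne_zero ⟨e, he, hX⟩] with e he heq
  exact he (by simp [heq])

theorem IsBranch.eventually_offsetPoint_notMem (hB : φ.IsBranch B) (h : φ.IsAdmissible d)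
    {T : Set Plane} (hT : T.Finite) : ∀ᶠ e in genericOn B, φ.offsetPoint d e ∉ T := by
  filter_upwards [(eventually_all_finite hT).2 fun q _ => hB.eventually_offsetPoint_ne h q]
    with e he hmem
  exact he _ hmem rfl

theorem IsBranch.infinite_offsetPoint (hB : φ.IsBranch B) (h : φ.IsAdmissible d) :
    (φ.offsetPoint d '' B).Infinite := by
  intro hfin
  obtain ⟨e, he, hn⟩ := hB.exists_of_eventually h (hB.eventually_offsetPoint_notMem h hfin)
  exact hn ⟨e, he, rfl⟩

theorem IsBranch.eventually_fiber (hB : φ.IsBranch B) (h : φ.IsAdmissible d)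
    {B' : Set (ℂ × ℂ)} {p : ℂ × ℂ → Prop} (hp : ∀ᶠ e in genericOn B', p e) :
    ∀ᶠ e in genericOn B, ∀ e' ∈ B', φ.offsetPoint d e' = φ.offsetPoint d e → p e' := by
  filter_upwards [hB.eventually_offsetPoint_notMem h
    ((eventually_genericOn.1 hp).image (φ.offsetPoint d))] with e he e' he' heq
  by_contra hn
  exact he ⟨e', ⟨he', hn⟩, heq⟩

end FlagFunctions

end RatParam

section LocalSqrt

theorem exists_local_sqrt {f f' : ℂ → ℂ} {t s : ℂ} (hf : ∀ᶠ τ in nhds t, HasDerivAt f (f' τ) τ)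
    (hs : s ≠ 0) (hst : s ^ 2 = f t) :
    ∃ σ : ℂ → ℂ, σ t = s ∧
      ∀ᶠ τ in nhds t, σ τ ≠ 0 ∧ σ τ ^ 2 = f τ ∧ HasDerivAt σ (f' τ / (2 * σ τ)) τ := by
  have hft : f t ≠ 0 := hst ▸ pow_ne_zero 2 hs
  let g (τ : ℂ) : ℂ := f τ / f t
  have hg1 : g t = 1 := div_self hft
  have hgcont : ContinuousAt g t := hf.self_of_nhds.continuousAt.div_const _
  have hslit : ∀ᶠ τ in nhds t, g τ ∈ Complex.slitPlane :=
    hgcont.eventually_mem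
      (Complex.isOpen_slitPlane.mem_nhds (hg1 ▸ Complex.one_mem_slitPlane))
  refine ⟨fun τ => s * Complex.exp (Complex.log (g τ) / 2), by simp [hg1], ?_⟩
  filter_upwards [hf, hslit] with τ hfτ hτ
  have hne : s * Complex.exp (Complex.log (g τ) / 2) ≠ 0 := mul_ne_zero hs (Complex.exp_ne_zero _)
  have hsq : (s * Complex.exp (Complex.log (g τ) / 2)) ^ 2 = f τ := by
    rw [mul_pow, sq (Complex.exp _), ← Complex.exp_add, add_halves,
      Complex.exp_log (Complex.slitPlane_ne_zero hτ), hst, mul_div_cancel₀ _ hft]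
  have hlog : HasDerivAt (fun τ => Complex.log (g τ)) (f' τ / f τ) τ := by
    refine ((hfτ.div_const (f t)).clog hτ).congr_deriv ?_
    exact div_div_div_cancel_right₀ hft _ _
  refine ⟨hne, hsq, ((hlog.div_const 2).cexp.const_mul s).congr_deriv ?_⟩
  have hfτ0 : f τ ≠ 0 := hsq ▸ pow_ne_zero 2 hne
  rw [eq_div_iff (mul_ne_zero two_ne_zero hne)]
  field_simp
  linear_combination f' τ * hsq

end LocalSqrt

section Gradient

open MvPolynomial

/-- The vector of partial derivatives of `f` at `q`, a normal vector of the curve `f = 0`. -/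
def gradient (f : PolyXY) (q : Plane) : Plane := fun i => eval q (pderiv i f)

end Gradient

namespace RatParam

open MvPolynomial Filter

variable {φ : RatParam} {d : ℝ} {B : Set (ℂ × ℂ)}

section Tangents

theorem IsBranch.exists_local (hB : φ.IsBranch B) {e : ℂ × ℂ} (he : e ∈ B) :
    ∃ σ : ℂ → ℂ, σ e.1 = e.2 ∧ ∀ᶠ τ in nhds e.1, (τ, σ τ) ∈ B ∧
      HasDerivAt σ (φ.sqSpeed.derivative.eval τ / (2 * σ τ)) τ := by
  have hf := hB.subset_flags he
  rcases hB with ⟨rfl, -⟩ | ⟨S, hS, rfl⟩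
  · obtain ⟨σ, hσ, hloc⟩ :=
      exists_local_sqrt (.of_forall φ.sqSpeed.hasDerivAt) hf.2.1 hf.2.2
    refine ⟨σ, hσ, ?_⟩
    filter_upwards [hf.1.eventually, hloc] with τ hτ hστ
    exact ⟨⟨hτ, hστ.1, hστ.2.1⟩, hστ.2.2⟩
  · refine ⟨S.eval, he.2.symm, ?_⟩
    filter_upwards [hf.1.eventually, S.continuous.continuousAt.eventually_ne (he.2 ▸ hf.2.1)]
      with τ hτ hS0
    refine ⟨⟨⟨hτ, hS0, by rw [← hS, Polynomial.eval_pow]⟩, rfl⟩, (S.hasDerivAt τ).congr_deriv ?_⟩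
    rw [← hS, Polynomial.derivative_sq]
    simp only [Polynomial.eval_mul, Polynomial.eval_C]
    field_simp

variable (φ) in
/-- The factor by which the velocity of the offset point differs from `(U, V)`. -/
def velocityFactor (d : ℝ) (e : ℂ × ℂ) : ℂ :=
  1 / φ.cW.eval e.1 ^ 2 + d * (φ.cU.eval e.1 * φ.cV.derivative.eval e.1 -
    φ.cU.derivative.eval e.1 * φ.cV.eval e.1) / e.2 ^ 3

theorem hasDerivAt_normal {σ : ℂ → ℂ} {t : ℂ} (hf : (t, σ t) ∈ φ.flags)
    (hσ : HasDerivAt σ (φ.sqSpeed.derivative.eval t / (2 * σ t)) t) :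
    HasDerivAt (fun τ => φ.normal (τ, σ τ))
      (((φ.cU.eval t * φ.cV.derivative.eval t - φ.cU.derivative.eval t * φ.cV.eval t) /
        σ t ^ 3) • φ.tangent t) t := by
  have h0 : σ t ≠ 0 := hf.2.1
  have hs : σ t ^ 2 = φ.cU.eval t ^ 2 + φ.cV.eval t ^ 2 := by rw [← eval_sqSpeed]; exact hf.2.2
  have hE : φ.sqSpeed.derivative.eval t = 2 * (φ.cU.eval t * φ.cU.derivative.eval t +
      φ.cV.eval t * φ.cV.derivative.eval t) := by
    simp only [sqSpeed, Polynomial.derivative_add, Polynomial.derivative_sq, Polynomial.eval_add,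
      Polynomial.eval_mul, Polynomial.eval_C]
    ring
  rw [hE] at hσ
  refine hasDerivAt_pi.2 fun i => ?_
  fin_cases i
  · refine ((φ.cV.hasDerivAt t).div hσ h0).congr_deriv ?_
    simp only [Pi.smul_apply, smul_eq_mul, Fin.zero_eta, tangent_zero]
    field_simp
    linear_combination φ.cV.derivative.eval t * hs
  · refine ((φ.cU.hasDerivAt t).div hσ h0).neg.congr_deriv ?_
    simp only [Pi.smul_apply, smul_eq_mul, Fin.mk_one, tangent_one]
    field_simp
    linear_combination -φ.cU.derivative.eval t * hs

theorem hasDerivAt_offsetPoint {σ : ℂ → ℂ} {t : ℂ} (hf : (t, σ t) ∈ φ.flags)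
    (hσ : HasDerivAt σ (φ.sqSpeed.derivative.eval t / (2 * σ t)) t) :
    HasDerivAt (fun τ => φ.offsetPoint d (τ, σ τ))
      (φ.velocityFactor d (t, σ t) • φ.tangent t) t := by
  refine ((hasDerivAt_point hf.1).add ((hasDerivAt_normal hf hσ).const_smul (d : ℂ))).congr_deriv ?_
  rw [smul_smul, ← add_smul, velocityFactor, one_div, mul_div_assoc]

theorem IsBranch.exists_velocityFactor_ne_zero (hB : φ.IsBranch B) (h : φ.IsAdmissible d) :
    ∃ e ∈ B, φ.velocityFactor d e ≠ 0 := by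
  by_contra! hzero
  obtain ⟨e, he⟩ := (hB.infinite h).nonempty
  obtain ⟨σ, -, hloc⟩ := hB.exists_local he
  have hconst : ∀ᶠ τ in nhds e.1, φ.offsetPoint d (τ, σ τ) = φ.offsetPoint d (e.1, σ e.1) := by
    refine eventually_eq_of_hasDerivAt_zero ?_
    filter_upwards [hloc] with τ hτ
    refine (hasDerivAt_offsetPoint (hB.subset_flags hτ.1) hτ.2).congr_deriv ?_
    rw [hzero _ hτ.1, zero_smul]
  have hfin := eventually_genericOn.1
    (hB.eventually_offsetPoint_ne h (φ.offsetPoint d (e.1, σ e.1)))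
  refine infinite_of_mem_nhds e.1 (hloc.and hconst) ((hfin.image Prod.fst).subset ?_)
  rintro τ ⟨hτ, heq⟩
  exact ⟨(τ, σ τ), ⟨hτ.1, not_not.2 heq⟩, rfl⟩

theorem IsBranch.eventually_velocityFactor_ne_zero (hB : φ.IsBranch B) (h : φ.IsAdmissible d) :
    ∀ᶠ e in genericOn B, φ.velocityFactor d e ≠ 0 := by
  let a : Polynomial ℂ := Polynomial.C (d : ℂ) * φ.cW ^ 2 *
    (φ.cU * φ.cV.derivative - φ.cU.derivative * φ.cV)
  have hnum {e} (he : e ∈ φ.flags) : a.eval e.1 + φ.sqSpeed.eval e.1 * e.2 =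
      φ.velocityFactor d e * (φ.cW.eval e.1 ^ 2 * e.2 ^ 3) := by
    have hW := isDefinedAt_iff.1 he.1
    have hs := he.2.1
    simp only [a, velocityFactor, ← he.2.2, Polynomial.eval_mul, Polynomial.eval_pow,
      Polynomial.eval_sub, Polynomial.eval_C]
    field_simp
    ring
  obtain ⟨e₀, he₀, h0⟩ := hB.exists_velocityFactor_ne_zero h
  have hf := hB.subset_flags he₀
  have hne : a.eval e₀.1 + φ.sqSpeed.eval e₀.1 * e₀.2 ≠ 0 := by
    rw [hnum hf]
    exact mul_ne_zero h0
      (mul_ne_zero (pow_ne_zero _ (isDefinedAt_iff.1 hf.1)) (pow_ne_zero _ hf.2.1))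
  filter_upwards [hB.eventually_ne_zero a φ.sqSpeed ⟨e₀, he₀, hne⟩, eventually_mem_genericOn]
    with e he hmem hzero
  exact he (by rw [hnum (hB.subset_flags hmem), hzero, zero_mul])

theorem IsBranch.exists_gradient_eq_smul_normal (hB : φ.IsBranch B) {f : PolyXY}
    (hf : ∀ e ∈ B, eval (φ.offsetPoint d e) f = 0) {e : ℂ × ℂ} (he : e ∈ B)
    (hs : φ.velocityFactor d e ≠ 0) :
    ∃ c : ℂ, gradient f (φ.offsetPoint d e) = c • φ.normal e := by
  obtain ⟨σ, hσ, hloc⟩ := hB.exists_local he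
  have hself := hloc.self_of_nhds
  have hd := hasDerivAt_eval_comp f
    (hasDerivAt_pi.1 (hasDerivAt_offsetPoint (d := d) (hB.subset_flags hself.1) hself.2))
  have h0 : HasDerivAt (fun τ => eval (φ.offsetPoint d (τ, σ τ)) f) 0 e.1 := by
    refine (hasDerivAt_const e.1 (0 : ℂ)).congr_of_eventuallyEq ?_
    filter_upwards [hloc] with τ hτ
    exact hf _ hτ.1
  have hzero := hd.unique h0
  rw [show (e.1, σ e.1) = e from Prod.ext rfl hσ] at hzero
  simp only [Pi.smul_apply, smul_eq_mul, mul_left_comm _ (φ.velocityFactor d e),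
    ← Finset.mul_sum, Fin.sum_univ_two] at hzero
  exact exists_eq_smul_normal (hB.subset_flags he) ((mul_eq_zero.1 hzero).resolve_left hs)

end Tangents

end RatParam

section AffinePrimitivePart

open MvPolynomial

theorem associated_eval_of_eq_inT_mul {A P : PolyXYT} {c : Polynomial ℂ} (h : A = inT c * P)
    {t : ℂ} (hA : A.eval (C t) ≠ 0) : Associated (P.eval (C t)) (A.eval (C t)) := by
  have heval : A.eval (C t) = C (c.eval t) * P.eval (C t) := by
    rw [h, Polynomial.eval_mul, eval_inT]
  have hc : c.eval t ≠ 0 := fun h0 => hA (by rw [heval, h0, C_0, zero_mul])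
  rw [heval]
  exact associated_unit_mul_right _ _ (hc.isUnit.map C)

theorem exists_eq_affine_of_inT_mul {k a b c : Polynomial ℂ} {P : PolyXYT} (hk : k ≠ 0)
    (h : inT k * P = inT a * varX + inT b * varY + inT c) :
    ∃ a' b' c' : Polynomial ℂ, P = inT a' * varX + inT b' * varY + inT c' := by
  have hmap (q : Plane) :
      k * P.map (eval q) = a * Polynomial.C (q 0) + b * Polynomial.C (q 1) + c := by
    simpa [varX, varY, map_inT] using congrArg (Polynomial.map (eval q)) h
  have hc := hmap ![0, 0]
  have hac := hmap ![1, 0]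
  have hbc := hmap ![0, 1]
  simp only [Matrix.cons_val_zero, Matrix.cons_val_one, map_zero, map_one, mul_zero, mul_one,
    zero_add, add_zero] at hc hac hbc
  refine ⟨P.map (eval ![1, 0]) - P.map (eval ![0, 0]), P.map (eval ![0, 1]) - P.map (eval ![0, 0]),
    P.map (eval ![0, 0]), mul_left_cancel₀ (inT_ne_zero hk) ?_⟩
  rw [h, mul_add, mul_add, ← mul_assoc, ← mul_assoc, ← inT_mul, ← inT_mul, ← inT_mul, mul_sub,
    mul_sub, hac, hbc, hc, add_sub_cancel_right, add_sub_cancel_right]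

theorem eval_eq_zero_iff_of_associated {f g : PolyXY} (h : Associated f g) (q : Plane) :
    eval q f = 0 ↔ eval q g = 0 :=
  Set.ext_iff.1 (zeroSet_eq_of_associated h) q

end AffinePrimitivePart

namespace RatParam

open MvPolynomial Filter

variable {φ : RatParam} {d : ℝ} {B : Set (ℂ × ℂ)}

section NormalAndCircle

variable {t : ℂ} {q : Plane} {P Q : PolyXYT}

variable (φ) in
/-- The parameters at which the point and the normal direction are defined. -/
def regularParams : Set ℂ := {t | φ.IsDefinedAt t ∧ φ.sqSpeed.eval t ≠ 0}

theorem fst_mem_regularParams {e : ℂ × ℂ} (he : e ∈ φ.flags) : e.1 ∈ φ.regularParams :=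
  ⟨he.1, sqSpeed_eval_ne_zero he⟩

theorem finite_compl_regularParams (hφ : φ.IsProper) : φ.regularParamsᶜ.Finite := by
  refine ((finite_not_isDefinedAt (φ := φ)).union
    (Polynomial.finite_setOfPred_isRoot (sqSpeed_ne_zero hφ))).subset fun t ht => ?_
  exact (not_and_or.1 ht).imp id not_not.1

theorem regularParams_nonempty (hφ : φ.IsProper) : φ.regularParams.Nonempty := by
  simpa using (finite_compl_regularParams hφ).infinite_compl.nonempty

variable (φ) in
/-- The equation of the normal line of the curve at a parameter. -/
def normalLine (t : ℂ) : PolyXY :=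
  affinePoly (φ.tangent t 0) (φ.tangent t 1)
    (-(φ.tangent t 0 * φ.point t 0 + φ.tangent t 1 * φ.point t 1))

variable (φ) in
/-- The equation of the circle of radius `d` around a point of the curve. -/
def offsetCircle (d : ℝ) (t : ℂ) : PolyXY := centeredCircle (φ.point t 0) (φ.point t 1) (d ^ 2)

theorem eval_normalLine (t : ℂ) (q : Plane) : eval q (φ.normalLine t) =
    (q - φ.point t) 0 * φ.tangent t 0 + (q - φ.point t) 1 * φ.tangent t 1 := by
  rw [normalLine, eval_affinePoly, Pi.sub_apply, Pi.sub_apply]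
  ring

theorem eval_offsetCircle (t : ℂ) (q : Plane) : eval q (φ.offsetCircle d t) =
    (q - φ.point t) 0 ^ 2 + (q - φ.point t) 1 ^ 2 - d ^ 2 :=
  eval_centeredCircle _ _ _ _

theorem normalLine_ne_zero (ht : t ∈ φ.regularParams) : φ.normalLine t ≠ 0 := by
  rw [normalLine, Ne, affinePoly_eq_zero_iff]
  rintro ⟨hU, hV, -⟩
  rw [tangent_zero] at hU
  rw [tangent_one] at hV
  exact ht.2 (by rw [eval_sqSpeed, hU, hV]; ring)

theorem eval_normalPoly (ht : φ.IsDefinedAt t) :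
    φ.normalPoly.eval (C t) = C (φ.cW.eval t) * φ.normalLine t := by
  have hW := isDefinedAt_iff.1 ht
  have h (p : Polynomial ℝ) : (realInT p).eval (C t) = C ((toC p).eval t) := eval_inT _ _
  refine MvPolynomial.funext fun q => ?_
  simp only [normalPoly, h, varX, varY, Polynomial.eval_add, Polynomial.eval_mul,
    Polynomial.eval_sub, Polynomial.eval_C, map_add, map_mul, map_sub, eval_C, eval_X,
    eval_normalLine, Pi.sub_apply, tangent_zero, tangent_one, point_zero, point_one, cU, cV, cX, cY]
  rw [cW] at hW ⊢
  field_simp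

theorem eval_circlePoly (ht : φ.IsDefinedAt t) :
    (φ.circlePoly d).eval (C t) = C (φ.cW.eval t ^ 2) * φ.offsetCircle d t := by
  have hW := isDefinedAt_iff.1 ht
  have h (p : Polynomial ℝ) : (realInT p).eval (C t) = C ((toC p).eval t) := eval_inT _ _
  have hd : (toC (Polynomial.C (d ^ 2) * φ.W ^ 2)).eval t = d ^ 2 * (toC φ.W).eval t ^ 2 := by
    simp [toC]
  refine MvPolynomial.funext fun q => ?_
  simp only [circlePoly, h, hd, varX, varY, Polynomial.eval_add, Polynomial.eval_mul,
    Polynomial.eval_pow, Polynomial.eval_sub, Polynomial.eval_C, map_add, map_mul, map_sub,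
    eval_C, eval_X, map_pow (eval q), eval_offsetCircle, Pi.sub_apply, point_zero, point_one,
    cX, cY]
  rw [cW] at hW ⊢
  field_simp

theorem associated_eval_normalLine (hP : IsPrimitivePartT φ.normalPoly P)
    (ht : t ∈ φ.regularParams) : Associated (P.eval (C t)) (φ.normalLine t) := by
  obtain ⟨⟨c, -, hc⟩, -⟩ := hP
  have hW : IsUnit (C (φ.cW.eval t) : PolyXY) := (isDefinedAt_iff.1 ht.1).isUnit.map C
  have h := associated_eval_of_eq_inT_mul hc (t := t)
  rw [eval_normalPoly ht.1] at h
  exact (h (mul_ne_zero hW.ne_zero (normalLine_ne_zero ht))).trans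
    (associated_unit_mul_left _ _ hW)

theorem irreducible_offsetCircle (hd : d ≠ 0) (t : ℂ) : Irreducible (φ.offsetCircle d t) :=
  irreducible_centeredCircle _ _ (pow_ne_zero 2 (Complex.ofReal_ne_zero.2 hd))

theorem associated_eval_offsetCircle (hd : d ≠ 0) (hQ : IsPrimitivePartT (φ.circlePoly d) Q)
    (ht : φ.IsDefinedAt t) : Associated (Q.eval (C t)) (φ.offsetCircle d t) := by
  obtain ⟨⟨c, -, hc⟩, -⟩ := hQ
  have hW : IsUnit (C (φ.cW.eval t ^ 2) : PolyXY) :=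
    (pow_ne_zero 2 (isDefinedAt_iff.1 ht)).isUnit.map C
  have h := associated_eval_of_eq_inT_mul hc (t := t)
  rw [eval_circlePoly ht] at h
  exact (h (mul_ne_zero hW.ne_zero (irreducible_offsetCircle hd t).ne_zero)).trans
    (associated_unit_mul_left _ _ hW)

theorem eval_offsetPoint_normalLine (e : ℂ × ℂ) :
    eval (φ.offsetPoint d e) (φ.normalLine e.1) = 0 := by
  rw [eval_normalLine, offsetPoint, add_sub_cancel_left, Pi.smul_apply, Pi.smul_apply,
    smul_eq_mul, smul_eq_mul]
  linear_combination (d : ℂ) * tangent_mul_normal (φ := φ) e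

theorem eval_offsetPoint_offsetCircle {e : ℂ × ℂ} (he : e ∈ φ.flags) :
    eval (φ.offsetPoint d e) (φ.offsetCircle d e.1) = 0 := by
  rw [eval_offsetCircle, offsetPoint, add_sub_cancel_left, Pi.smul_apply, Pi.smul_apply,
    smul_eq_mul, smul_eq_mul]
  linear_combination (d : ℂ) ^ 2 * normal_sq he

theorem exists_mem_flags (ht : t ∈ φ.regularParams) : ∃ s, (t, s) ∈ φ.flags := by
  obtain ⟨s, hs⟩ := IsAlgClosed.exists_pow_nat_eq (φ.sqSpeed.eval t) two_pos
  exact ⟨s, ht.1, ne_zero_pow two_ne_zero (hs ▸ ht.2), hs⟩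

theorem exists_eq_point_add_smul_normal {e : ℂ × ℂ} (he : e ∈ φ.flags)
    (hq : eval q (φ.normalLine e.1) = 0) : ∃ c : ℂ, q = φ.point e.1 + c • φ.normal e := by
  rw [eval_normalLine] at hq
  obtain ⟨c, hc⟩ := exists_eq_smul_normal he hq
  exact ⟨c, eq_add_of_sub_eq' hc⟩

theorem exists_offsetPoint_eq (ht : t ∈ φ.regularParams) (hn : eval q (φ.normalLine t) = 0)
    (hc : eval q (φ.offsetCircle d t) = 0) :
    ∃ s, (t, s) ∈ φ.flags ∧ φ.offsetPoint d (t, s) = q := by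
  obtain ⟨s, hs⟩ := exists_mem_flags ht
  obtain ⟨c, rfl⟩ := exists_eq_point_add_smul_normal hs hn
  have hcd : c ^ 2 = d ^ 2 := by
    simp only [eval_offsetCircle, add_sub_cancel_left, Pi.smul_apply, smul_eq_mul] at hc
    linear_combination hc - c ^ 2 * normal_sq hs
  rcases sq_eq_sq_iff_eq_or_eq_neg.1 hcd with rfl | rfl
  · exact ⟨s, hs, rfl⟩
  · exact ⟨-s, neg_mem_flags hs, by rw [offsetPoint, normal_neg (t, s), smul_neg, neg_smul]⟩

theorem eval_offsetPoint_eq_zero (hP : IsPrimitivePartT φ.normalPoly P) {e : ℂ × ℂ}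
    (he : e ∈ φ.flags) : eval (φ.offsetPoint d e) (P.eval (C e.1)) = 0 :=
  (eval_eq_zero_iff_of_associated (associated_eval_normalLine hP (fst_mem_regularParams he)) _).2
    (eval_offsetPoint_normalLine e)

theorem eval_offsetPoint_eq_zero_of_circlePoly (hd : d ≠ 0)
    (hQ : IsPrimitivePartT (φ.circlePoly d) Q) {e : ℂ × ℂ} (he : e ∈ φ.flags) :
    eval (φ.offsetPoint d e) (Q.eval (C e.1)) = 0 :=
  (eval_eq_zero_iff_of_associated (associated_eval_offsetCircle hd hQ he.1) _).2
    (eval_offsetPoint_offsetCircle he)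

theorem exists_offsetPoint_eq_of_eval_eq_zero (hd : d ≠ 0) (hP : IsPrimitivePartT φ.normalPoly P)
    (hQ : IsPrimitivePartT (φ.circlePoly d) Q) (ht : t ∈ φ.regularParams)
    (hPt : eval q (P.eval (C t)) = 0) (hQt : eval q (Q.eval (C t)) = 0) :
    ∃ s, (t, s) ∈ φ.flags ∧ φ.offsetPoint d (t, s) = q :=
  exists_offsetPoint_eq ht
    ((eval_eq_zero_iff_of_associated (associated_eval_normalLine hP ht) q).1 hPt)
    ((eval_eq_zero_iff_of_associated (associated_eval_offsetCircle hd hQ ht.1) q).1 hQt)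

theorem normalPoly_ne_zero (hφ : φ.IsProper) : φ.normalPoly ≠ 0 := by
  obtain ⟨t, ht⟩ := regularParams_nonempty hφ
  intro h0
  refine mul_ne_zero (C_ne_zero.2 (isDefinedAt_iff.1 ht.1)) (normalLine_ne_zero ht) ?_
  rw [← eval_normalPoly ht.1, h0, Polynomial.eval_zero]

theorem circlePoly_ne_zero (hd : d ≠ 0) : φ.circlePoly d ≠ 0 := by
  obtain ⟨t, ht⟩ := (infinite_setOf_isDefinedAt (φ := φ)).nonempty
  intro h0
  refine mul_ne_zero (C_ne_zero.2 (pow_ne_zero 2 (isDefinedAt_iff.1 ht)))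
    (irreducible_offsetCircle (φ := φ) hd t).ne_zero ?_
  rw [← eval_circlePoly ht, h0, Polynomial.eval_zero]

theorem exists_eq_affine (hP : IsPrimitivePartT φ.normalPoly P) :
    ∃ a b c : Polynomial ℂ, P = inT a * varX + inT b * varY + inT c := by
  obtain ⟨⟨k, hk, hkP⟩, -⟩ := hP
  refine exists_eq_affine_of_inT_mul (a := φ.cU * φ.cW) (b := φ.cV * φ.cW)
    (c := -(φ.cU * φ.cX + φ.cV * φ.cY)) hk ?_
  have h (p : Polynomial ℝ) : realInT p = inT (toC p) := rfl
  have hadd (p q : Polynomial ℂ) : inT (p + q) = inT p + inT q := Polynomial.map_add _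
  have hneg (p : Polynomial ℂ) : inT (-p) = -inT p := Polynomial.map_neg _
  simp only [← hkP, normalPoly, h, inT_mul, hadd, hneg, cU, cV, cW, cX, cY]
  ring

theorem exists_eval_eq_affinePoly (hP : IsPrimitivePartT φ.normalPoly P) (t : ℂ) :
    ∃ a b c : ℂ, P.eval (C t) = affinePoly a b c := by
  obtain ⟨a, b, c, h⟩ := exists_eq_affine hP
  exact ⟨a.eval t, b.eval t, c.eval t, by simp [h, affinePoly, varX, varY, eval_inT]⟩

theorem exists_leadingCoeff_eq_affinePoly (hP : IsPrimitivePartT φ.normalPoly P) :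
    ∃ a b c : ℂ, P.leadingCoeff = affinePoly a b c := by
  obtain ⟨a, b, c, h⟩ := exists_eq_affine hP
  refine ⟨a.coeff P.natDegree, b.coeff P.natDegree, c.coeff P.natDegree, ?_⟩
  have hc (n : ℕ) : P.coeff n = affinePoly (a.coeff n) (b.coeff n) (c.coeff n) := by
    simp [h, inT, affinePoly, varX, varY]
  exact hc _

end NormalAndCircle

end RatParam

namespace RatParam

open MvPolynomial Filter

variable {φ : RatParam} {d : ℝ} {B : Set (ℂ × ℂ)} {P Q : PolyXYT}

section NonvanishingResultant

theorem eval_resultant_eq_zero_iff {q : Plane} (hlc : eval q P.leadingCoeff ≠ 0) :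
    eval q (Polynomial.resultant P Q) = 0 ↔
      ∃ t, eval q (P.eval (C t)) = 0 ∧ eval q (Q.eval (C t)) = 0 := by
  simpa only [eval_map_eval] using map_resultant_eq_zero_iff (L := Q) hlc le_rfl

theorem leadingCoeff_ne_zero (hP : IsPrimitivePartT φ.normalPoly P) : P.leadingCoeff ≠ 0 := by
  rw [Polynomial.leadingCoeff_ne_zero]
  rintro rfl
  exact hP.eval_ne_zero 0 Polynomial.eval_zero

theorem IsAdmissible.ne_zero (h : φ.IsAdmissible d) : d ≠ 0 := h.pos.ne'

theorem exists_forall_isBranch_offsetPoint_zero_ne (h : φ.IsAdmissible d) {R : PolyXY}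
    (hR : R ≠ 0) :
    ∃ p, eval p R ≠ 0 ∧ ∀ B, φ.IsBranch B → ∃ e ∈ B, φ.offsetPoint d e 0 ≠ p 0 := by
  obtain ⟨t, ht⟩ := regularParams_nonempty h.isProper
  have hfin := finite_flags_of_finite (φ := φ) (Set.finite_singleton t)
  let K : PolyXY := ∏ e ∈ hfin.toFinset, (MvPolynomial.X 0 - C (φ.offsetPoint d e 0))
  have hK : K ≠ 0 := by
    refine Finset.prod_ne_zero_iff.2 fun e _ h0 => ?_
    have hval := congrArg (eval (fun _ => φ.offsetPoint d e 0 + 1)) h0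
    simp at hval
  obtain ⟨p, hp⟩ := exists_eval_ne_zero (mul_ne_zero hR hK)
  rw [map_mul, mul_ne_zero_iff, map_prod, Finset.prod_ne_zero_iff] at hp
  refine ⟨p, hp.1, fun B hB => ?_⟩
  obtain ⟨s, hs⟩ := hB.exists_mem ht.1 ht.2
  refine ⟨_, hs, fun heq => hp.2 _ (hfin.mem_toFinset.2 ⟨hB.subset_flags hs, rfl⟩) ?_⟩
  simp [heq]

theorem exists_eval_ne_zero_notMem_image (h : φ.IsAdmissible d) {R : PolyXY} (hR : R ≠ 0) :
    ∃ q, eval q R ≠ 0 ∧ q ∉ φ.offsetPoint d '' φ.flags := by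
  obtain ⟨p, hp, hbranch⟩ := exists_forall_isBranch_offsetPoint_zero_ne h hR
  -- The line `x = p 0` contains only finitely many generated points.
  have hline : ∀ᶠ e in genericOn φ.flags, φ.offsetPoint d e 0 ≠ p 0 := by
    refine eventually_flags_of_isBranch fun B hB => ?_
    obtain ⟨e, he, hne⟩ := hbranch B hB
    have hX : eval (φ.offsetPoint d e) (MvPolynomial.X 0 - C (p 0) : PolyXY) ≠ 0 := by
      simpa [sub_eq_zero] using hne
    filter_upwards [hB.eventually_eval_offsetPoint_ne_zero ⟨e, he, hX⟩] with e he heq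
    exact he (by simp [heq])
  have hroots : (lineHom p ![0, 1] R) ≠ 0 := by
    intro h0
    have hval := eval_lineHom (q := p) (v := ![0, 1]) R 0
    rw [h0, Polynomial.eval_zero, zero_smul, add_zero] at hval
    exact hp hval.symm
  have hfin := (Polynomial.finite_setOfPred_isRoot hroots).union
    ((eventually_genericOn.1 hline).image fun e => φ.offsetPoint d e 1 - p 1)
  obtain ⟨τ, hτ⟩ := hfin.infinite_compl.nonempty
  rw [Set.mem_compl_iff, Set.mem_union, not_or] at hτ
  refine ⟨p + τ • ![0, 1], fun h0 => hτ.1 ((eval_lineHom _ _ R τ).trans h0), ?_⟩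
  rintro ⟨e, he, heq⟩
  exact hτ.2 ⟨e, ⟨he, by simp [heq]⟩, by simp [heq]⟩

theorem resultant_ne_zero (h : φ.IsAdmissible d) (hP : IsPrimitivePartT φ.normalPoly P)
    (hQ : IsPrimitivePartT (φ.circlePoly d) Q) : Polynomial.resultant P Q ≠ 0 := by
  have hfin := finite_compl_regularParams h.isProper
  obtain ⟨q, hq, hmem⟩ := exists_eval_ne_zero_notMem_image h
    (mul_ne_zero (leadingCoeff_ne_zero hP)
      (Finset.prod_ne_zero_iff.2 fun t (_ : t ∈ hfin.toFinset) => hP.eval_ne_zero t))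
  rw [map_mul, mul_ne_zero_iff, map_prod, Finset.prod_ne_zero_iff] at hq
  intro hres
  obtain ⟨t, hPt, hQt⟩ := (eval_resultant_eq_zero_iff (Q := Q) hq.1).1 (by rw [hres, map_zero])
  have ht : t ∈ φ.regularParams := by
    by_contra ht
    exact hq.2 t (hfin.mem_toFinset.2 ht) hPt
  obtain ⟨s, hs, heq⟩ := exists_offsetPoint_eq_of_eval_eq_zero h.ne_zero hP hQ ht hPt hQt
  exact hmem ⟨_, hs, heq⟩

end NonvanishingResultant

section Equations

variable {f : PolyXY}

variable (φ d B) in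
/-- `f` is an irreducible equation of the Zariski closure of the points generated by `B`. -/
structure IsEquation (f : PolyXY) : Prop where
  irreducible : Irreducible f
  zariskiClosure_eq : zariskiClosure (φ.offsetPoint d '' B) = zeroSet f

theorem IsEquation.eval_offsetPoint (hf : φ.IsEquation d B f) {e : ℂ × ℂ} (he : e ∈ B) :
    eval (φ.offsetPoint d e) f = 0 := by
  rw [← mem_zeroSet, ← hf.zariskiClosure_eq]
  exact subset_zariskiClosure _ (Set.mem_image_of_mem _ he)

theorem IsEquation.dvd_iff {g : PolyXY} (hf : φ.IsEquation d B f) :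
    f ∣ g ↔ ∀ e ∈ B, eval (φ.offsetPoint d e) g = 0 := by
  rw [dvd_iff_zeroSet_subset hf.irreducible, ← hf.zariskiClosure_eq]
  exact ⟨fun h e he => h (subset_zariskiClosure _ (Set.mem_image_of_mem _ he)),
    fun h => zariskiClosure_subset_zeroSet (Set.image_subset_iff.2 h)⟩

theorem IsEquation.eventually_ne_zero {g : PolyXY} (hf : φ.IsEquation d B f) (hB : φ.IsBranch B)
    (hg : ¬ f ∣ g) : ∀ᶠ e in genericOn B, eval (φ.offsetPoint d e) g ≠ 0 := by
  rw [hf.dvd_iff] at hg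
  push Not at hg
  exact hB.eventually_eval_offsetPoint_ne_zero hg

theorem IsBranch.isPrime_vanishingIdeal (hB : φ.IsBranch B) (h : φ.IsAdmissible d) :
    (vanishingIdeal ℂ (φ.offsetPoint d '' B)).IsPrime := by
  have hmem {g : PolyXY} :
      g ∈ vanishingIdeal ℂ (φ.offsetPoint d '' B) ↔ ∀ e ∈ B, eval (φ.offsetPoint d e) g = 0 :=
    mem_vanishingIdeal_iff_subset_zeroSet.trans Set.image_subset_iff
  refine ⟨fun htop => ?_, fun {f g} hfg => ?_⟩
  · obtain ⟨e, he⟩ := (hB.infinite h).nonempty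
    rw [Ideal.eq_top_iff_one, hmem] at htop
    exact one_ne_zero ((map_one _).symm.trans (htop e he))
  · by_contra! hc
    rw [hmem, hmem] at hc
    push Not at hc
    obtain ⟨e, he, hf, hg⟩ := hB.exists_of_eventually h
      ((hB.eventually_eval_offsetPoint_ne_zero hc.1).and
        (hB.eventually_eval_offsetPoint_ne_zero hc.2))
    exact mul_ne_zero hf hg ((map_mul _ f g).symm.trans (hmem.1 hfg e he))

theorem eval_offsetPoint_leadingCoeff_mul_resultant (hd : d ≠ 0)
    (hP : IsPrimitivePartT φ.normalPoly P) (hQ : IsPrimitivePartT (φ.circlePoly d) Q)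
    {e : ℂ × ℂ} (he : e ∈ φ.flags) :
    eval (φ.offsetPoint d e) (P.leadingCoeff * Polynomial.resultant P Q) = 0 := by
  rw [map_mul, mul_eq_zero, or_iff_not_imp_left]
  exact fun hlc => (eval_resultant_eq_zero_iff hlc).2
    ⟨e.1, eval_offsetPoint_eq_zero hP he, eval_offsetPoint_eq_zero_of_circlePoly hd hQ he⟩

theorem IsBranch.exists_isEquation (hB : φ.IsBranch B) (h : φ.IsAdmissible d) :
    ∃ f, φ.IsEquation d B f := by
  obtain ⟨P, hP⟩ := exists_isPrimitivePartT (normalPoly_ne_zero h.isProper)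
  obtain ⟨Q, hQ⟩ := exists_isPrimitivePartT (circlePoly_ne_zero (φ := φ) h.ne_zero)
  have hbot : vanishingIdeal ℂ (φ.offsetPoint d '' B) ≠ ⊥ := by
    refine (Submodule.ne_bot_iff _).2 ⟨_, ?_,
      mul_ne_zero (leadingCoeff_ne_zero hP) (resultant_ne_zero h hP hQ)⟩
    rw [mem_vanishingIdeal_iff_subset_zeroSet, Set.image_subset_iff]
    exact fun e he =>
      eval_offsetPoint_leadingCoeff_mul_resultant h.ne_zero hP hQ (hB.subset_flags he)
  obtain ⟨f, hfI, hf⟩ := (hB.isPrime_vanishingIdeal h).exists_mem_prime_of_ne_bot hbot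
  exact ⟨f, hf.irreducible, zariskiClosure_eq_zeroSet hf.irreducible (hB.infinite_offsetPoint h)
    (mem_vanishingIdeal_iff_subset_zeroSet.1 hfI)⟩

end Equations

section LinesInTheOffset

variable {a b c : ℂ}

theorem IsBranch.not_eventually_point_mem_lines (hB : φ.IsBranch B) (h : φ.IsAdmissible d)
    (hab : a ≠ 0 ∨ b ≠ 0) (c₁ c₂ : ℂ) :
    ¬ ∀ᶠ e in genericOn B, eval (φ.point e.1) (affinePoly a b c₁) = 0 ∨
      eval (φ.point e.1) (affinePoly a b c₂) = 0 := by
  intro hev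
  have hinf : {t | φ.IsDefinedAt t ∧ (eval (φ.point t) (affinePoly a b c₁) = 0 ∨
      eval (φ.point t) (affinePoly a b c₂) = 0)}.Infinite := by
    refine ((hB.infinite_fst h).sdiff ((eventually_genericOn.1 hev).image Prod.fst)).mono ?_
    rintro t ⟨⟨s, hs⟩, ht⟩
    refine ⟨(hB.subset_flags hs).1, ?_⟩
    by_contra hn
    exact ht ⟨_, ⟨hs, hn⟩, rfl⟩
  simp only [and_or_left, Set.ofPred_or] at hinf
  rcases Set.infinite_union.1 hinf with h₁ | h₂
  · exact h.not_isLine (isLine_curve h.isProper hab h₁)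
  · exact h.not_isLine (isLine_curve h.isProper hab h₂)

theorem IsBranch.exists_eval_offsetPoint_affinePoly_ne_zero (hB : φ.IsBranch B)
    (h : φ.IsAdmissible d) (hab : a ≠ 0 ∨ b ≠ 0) (c : ℂ) :
    ∃ e ∈ B, eval (φ.offsetPoint d e) (affinePoly a b c) ≠ 0 := by
  -- Otherwise the normal is constant, so the curve lies on two translates of the line.
  by_contra! hvan
  obtain ⟨ρ, hρ⟩ := IsAlgClosed.exists_pow_nat_eq (a ^ 2 + b ^ 2) two_pos
  refine hB.not_eventually_point_mem_lines h hab (c + d * ρ) (c - d * ρ) ?_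
  filter_upwards [hB.eventually_velocityFactor_ne_zero h, eventually_mem_genericOn] with e hs he
  obtain ⟨k, hk⟩ := hB.exists_gradient_eq_smul_normal hvan he hs
  have ha : a = k * φ.normal e 0 := by simpa [gradient, affinePoly] using congrFun hk 0
  have hb : b = k * φ.normal e 1 := by simpa [gradient, affinePoly] using congrFun hk 1
  have hN := normal_sq (hB.subset_flags he)
  have hkρ : k ^ 2 = ρ ^ 2 := by
    rw [hρ]
    linear_combination -k ^ 2 * hN - (a + k * φ.normal e 0) * ha - (b + k * φ.normal e 1) * hb
  have hq := hvan e he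
  simp only [eval_affinePoly, offsetPoint, Pi.add_apply, Pi.smul_apply, smul_eq_mul] at hq ⊢
  refine (sq_eq_sq_iff_eq_or_eq_neg.1 hkρ).imp (fun hkρ => ?_) fun hkρ => ?_
  · linear_combination hq - d * φ.normal e 0 * ha - d * φ.normal e 1 * hb - d * k * hN - d * hkρ
  · linear_combination hq - d * φ.normal e 0 * ha - d * φ.normal e 1 * hb - d * k * hN - d * hkρ

theorem IsEquation.not_dvd_affinePoly {f : PolyXY} (hf : φ.IsEquation d B f)
    (hB : φ.IsBranch B) (h : φ.IsAdmissible d) (h0 : affinePoly a b c ≠ 0) :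
    ¬ f ∣ affinePoly a b c := by
  suffices ∃ e ∈ B, eval (φ.offsetPoint d e) (affinePoly a b c) ≠ 0 by
    rw [hf.dvd_iff]
    push Not
    exact this
  by_cases hab : a ≠ 0 ∨ b ≠ 0
  · exact hB.exists_eval_offsetPoint_affinePoly_ne_zero h hab c
  · push Not at hab
    obtain ⟨rfl, rfl⟩ := hab
    obtain ⟨e, he⟩ := (hB.infinite h).nonempty
    exact ⟨e, he, fun hval => h0 (affinePoly_eq_zero_iff.2 ⟨rfl, rfl, by simpa using hval⟩)⟩

theorem IsEquation.not_dvd_leadingCoeff {f : PolyXY} (hf : φ.IsEquation d B f)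
    (hB : φ.IsBranch B) (h : φ.IsAdmissible d) (hP : IsPrimitivePartT φ.normalPoly P) :
    ¬ f ∣ P.leadingCoeff := by
  obtain ⟨a, b, c, hl⟩ := exists_leadingCoeff_eq_affinePoly hP
  rw [hl]
  exact hf.not_dvd_affinePoly hB h (hl ▸ leadingCoeff_ne_zero hP)

theorem IsEquation.not_dvd_eval {f : PolyXY} (hf : φ.IsEquation d B f) (hB : φ.IsBranch B)
    (h : φ.IsAdmissible d) (hP : IsPrimitivePartT φ.normalPoly P) (t : ℂ) :
    ¬ f ∣ P.eval (C t) := by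
  obtain ⟨a, b, c, hl⟩ := exists_eval_eq_affinePoly hP t
  rw [hl]
  exact hf.not_dvd_affinePoly hB h (hl ▸ hP.eval_ne_zero t)

end LinesInTheOffset

end RatParam

section RootMultiplicity

open Polynomial

theorem rootMultiplicity_prod {ι R : Type*} [CommRing R] [IsDomain R] {S : Finset ι} {p : ι → R[X]}
    (h : ∀ i ∈ S, p i ≠ 0) (a : R) :
    (∏ i ∈ S, p i).rootMultiplicity a = ∑ i ∈ S, (p i).rootMultiplicity a := by
  classical
  rw [← count_roots, roots_prod p S (Finset.prod_ne_zero_iff.2 h), Multiset.count_bind]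
  simp only [count_roots]
  rfl

theorem rootMultiplicity_prod_mul_eq_card {ι R : Type*} [CommRing R] [IsDomain R] {S : Finset ι}
    {p : ι → R[X]} {r : R[X]} {a : R} (hp : ∀ i ∈ S, (p i).rootMultiplicity a = 1)
    (hr : r.eval a ≠ 0) : ((∏ i ∈ S, p i) * r).rootMultiplicity a = S.card := by
  have hp0 (i : ι) (hi : i ∈ S) : p i ≠ 0 := by
    intro h0
    simpa [h0] using hp i hi
  have hr0 : r ≠ 0 := by
    rintro rfl
    exact hr eval_zero
  rw [rootMultiplicity_mul (mul_ne_zero (Finset.prod_ne_zero_iff.2 hp0) hr0),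
    rootMultiplicity_prod hp0, rootMultiplicity_eq_zero hr, Finset.sum_congr rfl hp,
    Finset.sum_const, smul_eq_mul, mul_one, add_zero]

end RootMultiplicity

namespace RatParam

open MvPolynomial Filter

variable {φ : RatParam} {d : ℝ} {B : Set (ℂ × ℂ)} {f : PolyXY} {P Q : PolyXYT}

section GenericFibers

variable (φ) in
/-- The parametrization takes its value at `t` at no other parameter. -/
def IsInjectiveAt (t : ℂ) : Prop :=
  ∀ t', φ.IsDefinedAt t' → φ.point t' = φ.point t → t' = t

theorem IsBranch.eventually_isInjectiveAt (hB : φ.IsBranch B) (h : φ.IsAdmissible d) :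
    ∀ᶠ e in genericOn B, φ.IsInjectiveAt e.1 := by
  filter_upwards [hB.eventually_fst_notMem h.isProper, eventually_mem_genericOn]
    with e he hmem t ht hpt
  by_contra hne
  exact he ⟨(hB.subset_flags hmem).1, t, ht, hne, hpt⟩

variable (φ d) in
/-- The flags `e` and `e'` generate the same offset point from its two sides. -/
def IsOpposite (e e' : ℂ × ℂ) : Prop :=
  φ.normal e' = -φ.normal e ∧ φ.offsetPoint d e' = φ.offsetPoint d e

theorem IsOpposite.point_eq {e e' : ℂ × ℂ} (h : φ.IsOpposite d e e') :
    φ.point e'.1 = φ.point e.1 + (2 * d : ℂ) • φ.normal e := by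
  have heq := h.2
  rw [offsetPoint, offsetPoint, h.1, smul_neg, ← sub_eq_add_neg, sub_eq_iff_eq_add] at heq
  rw [heq, two_mul, add_smul, add_assoc]

theorem normal_eq_or_eq_neg {e e' : ℂ × ℂ} (he : e ∈ φ.flags) (he' : e' ∈ φ.flags) {v : Plane}
    (hv : v ≠ 0) {c c' : ℂ} (hc : v = c • φ.normal e) (hc' : v = c' • φ.normal e') :
    φ.normal e' = φ.normal e ∨ φ.normal e' = -φ.normal e := by
  have hnorm {e : ℂ × ℂ} (he : e ∈ φ.flags) {c : ℂ} (hc : v = c • φ.normal e) :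
      v 0 ^ 2 + v 1 ^ 2 = c ^ 2 := by
    simp only [hc, Pi.smul_apply, smul_eq_mul]
    linear_combination c ^ 2 * normal_sq he
  have hc0 : c ≠ 0 := by
    rintro rfl
    exact hv (hc.trans (zero_smul _ _))
  refine (sq_eq_sq_iff_eq_or_eq_neg.1 ((hnorm he' hc').symm.trans (hnorm he hc))).imp ?_ ?_
  · rintro rfl
    exact smul_right_injective _ hc0 (hc'.symm.trans hc)
  · rintro rfl
    refine smul_right_injective _ hc0 ?_
    simp only [smul_neg, ← hc, hc', neg_smul, neg_neg]

theorem eventually_exists_isBranch (f : PolyXY) :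
    ∀ᶠ e in genericOn φ.flags, eval (φ.offsetPoint d e) f = 0 →
      ∃ B, φ.IsBranch B ∧ e ∈ B ∧ ∀ e' ∈ B, eval (φ.offsetPoint d e') f = 0 := by
  refine eventually_flags_of_isBranch fun B hB => ?_
  by_cases hz : ∀ e' ∈ B, eval (φ.offsetPoint d e') f = 0
  · filter_upwards [eventually_mem_genericOn] with e he _
    exact ⟨B, hB, he, hz⟩
  · push Not at hz
    filter_upwards [hB.eventually_eval_offsetPoint_ne_zero hz] with e he h0
    exact absurd h0 he

theorem IsEquation.eventually_gradient_ne_zero (hf : φ.IsEquation d B f) (hB : φ.IsBranch B) :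
    ∀ᶠ e in genericOn B, gradient f (φ.offsetPoint d e) ≠ 0 := by
  obtain ⟨i, hi⟩ := exists_not_dvd_pderiv (totalDegree_ne_zero_of_irreducible hf.irreducible)
  filter_upwards [hf.eventually_ne_zero hB hi] with e he h0
  exact he (congrFun h0 i)

theorem IsEquation.eventually_fiber (hf : φ.IsEquation d B f) (hB : φ.IsBranch B)
    (h : φ.IsAdmissible d) : ∀ᶠ e in genericOn B, ∀ e' ∈ φ.flags,
      φ.offsetPoint d e' = φ.offsetPoint d e →
        φ.velocityFactor d e' ≠ 0 ∧ φ.IsInjectiveAt e'.1 ∧ (e' = e ∨ φ.IsOpposite d e e') := by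
  have hspeed : ∀ᶠ e in genericOn φ.flags, φ.velocityFactor d e ≠ 0 :=
    eventually_flags_of_isBranch fun _ hB => hB.eventually_velocityFactor_ne_zero h
  have hinjective : ∀ᶠ e in genericOn φ.flags, φ.IsInjectiveAt e.1 :=
    eventually_flags_of_isBranch fun _ hB => hB.eventually_isInjectiveAt h
  filter_upwards [hB.eventually_fiber h hspeed, hB.eventually_fiber h hinjective,
    hB.eventually_fiber h (eventually_exists_isBranch f), hf.eventually_gradient_ne_zero hB,
    eventually_mem_genericOn] with e hs hinj hbranch hgrad he e' he' hgen
  have heF := hB.subset_flags he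
  refine ⟨hs e' he' hgen, hinj e' he' hgen, ?_⟩
  -- Both normals are orthogonal to the tangent of the curve `f = 0` at the common offset point.
  obtain ⟨B', hB', heB', hz⟩ := hbranch e' he' hgen (by rw [hgen]; exact hf.eval_offsetPoint he)
  obtain ⟨c, hc⟩ :=
    hB.exists_gradient_eq_smul_normal (fun _ => hf.eval_offsetPoint) he (hs e heF rfl)
  obtain ⟨c', hc'⟩ := hB'.exists_gradient_eq_smul_normal hz heB' (hs e' he' hgen)
  rw [hgen] at hc'
  refine (normal_eq_or_eq_neg heF he' hgrad hc hc').imp (fun hn => ?_) fun hn => ⟨hn, hgen⟩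
  refine flag_ext he' heF (hinj e heF rfl _ he'.1 ?_) hn
  simpa only [offsetPoint, hn, add_left_inj] using hgen

theorem IsEquation.eventually_sum_gradient_mul_normal_ne_zero (hf : φ.IsEquation d B f)
    (hB : φ.IsBranch B) (h : φ.IsAdmissible d) : ∀ᶠ e in genericOn B,
      ∑ i, eval (φ.offsetPoint d e) (pderiv i f) * φ.normal e i ≠ 0 := by
  filter_upwards [hB.eventually_velocityFactor_ne_zero h, hf.eventually_gradient_ne_zero hB,
    eventually_mem_genericOn] with e hs hgrad he h0
  obtain ⟨c, hc⟩ := hB.exists_gradient_eq_smul_normal (fun _ => hf.eval_offsetPoint) he hs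
  have hi (i : Fin 2) : eval (φ.offsetPoint d e) (pderiv i f) = c * φ.normal e i := congrFun hc i
  rw [Fin.sum_univ_two, hi, hi] at h0
  have hc0 : c = 0 := by linear_combination h0 - c * normal_sq (hB.subset_flags he)
  exact hgrad (by rw [hc, hc0, zero_smul])

end GenericFibers

section RestrictionToTheNormal

theorem lineHom_eval_eq_zero (hP : IsPrimitivePartT φ.normalPoly P) {e e' : ℂ × ℂ}
    (he' : e' ∈ φ.flags) (hgen : φ.offsetPoint d e' = φ.offsetPoint d e)
    (hn : φ.normal e' = φ.normal e ∨ φ.normal e' = -φ.normal e) :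
    lineHom (φ.offsetPoint d e) (φ.normal e) (P.eval (C e'.1)) = 0 := by
  have hassoc := (associated_eval_normalLine hP (fst_mem_regularParams he')).map
    (lineHom (φ.offsetPoint d e) (φ.normal e))
  have hq := eval_offsetPoint_normalLine (φ := φ) (d := d) e'
  have hv : φ.tangent e'.1 0 * φ.normal e 0 + φ.tangent e'.1 1 * φ.normal e 1 = 0 := by
    have hv' := tangent_mul_normal (φ := φ) e'
    rcases hn with hn | hn
    · rwa [hn] at hv'
    · simp only [hn, Pi.neg_apply] at hv'
      linear_combination -hv'
  rw [hgen, normalLine, eval_affinePoly] at hq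
  rw [hassoc.eq_zero_iff, normalLine, lineHom_affinePoly, hq, hv, map_zero, zero_mul, zero_add]

theorem hasDerivAt_eval_normalLine {e : ℂ × ℂ} (he : e ∈ φ.flags) :
    HasDerivAt (fun τ => eval (φ.offsetPoint d e) (φ.normalLine τ))
      (-(e.2 ^ 2 * φ.velocityFactor d e)) e.1 := by
  have hpoint := hasDerivAt_pi.1 (hasDerivAt_point he.1)
  have hfun : (fun τ => eval (φ.offsetPoint d e) (φ.normalLine τ)) = fun τ =>
      (φ.offsetPoint d e 0 - φ.point τ 0) * φ.cU.eval τ +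
        (φ.offsetPoint d e 1 - φ.point τ 1) * φ.cV.eval τ := by
    funext τ
    rw [eval_normalLine, tangent_zero, tangent_one, Pi.sub_apply, Pi.sub_apply]
  rw [hfun]
  refine ((((hpoint 0).const_sub _).mul (φ.cU.hasDerivAt e.1)).add
    (((hpoint 1).const_sub _).mul (φ.cV.hasDerivAt e.1))).congr_deriv ?_
  have hs := he.2.1
  have hW := isDefinedAt_iff.1 he.1
  have hsq := he.2.2
  rw [eval_sqSpeed] at hsq
  simp only [offsetPoint, velocityFactor, normal, Pi.add_apply, Pi.smul_apply, smul_eq_mul,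
    tangent_zero, tangent_one, add_sub_cancel_left, Matrix.cons_val_zero, Matrix.cons_val_one]
  field_simp
  linear_combination e.2 * hsq

theorem eval_derivative_map_ne_zero (hP : IsPrimitivePartT φ.normalPoly P) {e : ℂ × ℂ}
    (he : e ∈ φ.flags) (hs : φ.velocityFactor d e ≠ 0) :
    (Polynomial.derivative (P.map (eval (φ.offsetPoint d e)))).eval e.1 ≠ 0 := by
  intro h0
  have hroot : (P.map (eval (φ.offsetPoint d e))).eval e.1 = 0 := by
    rw [eval_map_eval]
    exact eval_offsetPoint_eq_zero hP he
  obtain ⟨⟨c, -, hc⟩, -⟩ := hP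
  have hprod : ∀ᶠ τ in nhds e.1, φ.cW.eval τ * eval (φ.offsetPoint d e) (φ.normalLine τ) =
      c.eval τ * (P.map (eval (φ.offsetPoint d e))).eval τ := by
    filter_upwards [he.1.eventually] with τ hτ
    have hτc := congrArg (fun p => eval (φ.offsetPoint d e) (p.eval (C τ))) hc
    simpa only [eval_normalPoly hτ, Polynomial.eval_mul, map_mul, eval_inT, eval_C,
      eval_map_eval] using hτc
  have hW := (φ.cW.hasDerivAt e.1).mul (hasDerivAt_eval_normalLine (d := d) he)
  have hcP := (c.hasDerivAt e.1).mul
    ((P.map (eval (φ.offsetPoint d e))).hasDerivAt e.1)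
  have hderiv := hW.unique (hcP.congr_of_eventuallyEq hprod)
  rw [hroot, h0, eval_offsetPoint_normalLine, mul_zero, mul_zero, mul_zero, zero_add,
    zero_add] at hderiv
  exact mul_ne_zero (isDefinedAt_iff.1 he.1)
    (neg_ne_zero.2 (mul_ne_zero (pow_ne_zero 2 he.2.1) hs)) hderiv

theorem rootMultiplicity_lineHom_offsetCircle (hd : d ≠ 0) {e e' : ℂ × ℂ} (he' : e' ∈ φ.flags)
    (hgen : φ.offsetPoint d e' = φ.offsetPoint d e)
    (hn : φ.normal e' = φ.normal e ∨ φ.normal e' = -φ.normal e) :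
    (lineHom (φ.offsetPoint d e) (φ.normal e) (φ.offsetCircle d e'.1)).rootMultiplicity 0 = 1 := by
  have hd' : (d : ℂ) ≠ 0 := Complex.ofReal_ne_zero.2 hd
  rw [← hgen]
  apply rootMultiplicity_lineHom_eq_one (eval_offsetPoint_offsetCircle he')
  have hgrad : ∑ i, eval (φ.offsetPoint d e') (pderiv i (φ.offsetCircle d e'.1)) * φ.normal e i =
      2 * d * (φ.normal e' 0 * φ.normal e 0 + φ.normal e' 1 * φ.normal e 1) := by
    simp [Fin.sum_univ_two, offsetCircle, centeredCircle, offsetPoint, pderiv_X]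
    ring
  have hsq := normal_sq he'
  rw [hgrad]
  refine mul_ne_zero (mul_ne_zero two_ne_zero hd') fun hdot => one_ne_zero (α := ℂ) ?_
  rcases hn with hn | hn
  · rw [← hn] at hdot
    linear_combination hdot - hsq
  · rw [eq_neg_iff_add_eq_zero, add_comm, ← eq_neg_iff_add_eq_zero] at hn
    simp only [hn, Pi.neg_apply] at hdot
    linear_combination -hdot - hsq

theorem finite_setOf_paramGenerates {q : Plane} (hP : IsPrimitivePartT φ.normalPoly P)
    (hlc : eval q P.leadingCoeff ≠ 0) : {t | φ.ParamGenerates d t q}.Finite := by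
  have hne : P.map (eval q) ≠ 0 := map_ne_zero_of_leadingCoeff hlc
  refine (Polynomial.finite_setOfPred_isRoot hne).subset fun t ht => ?_
  obtain ⟨s, hs, rfl⟩ := paramGenerates_iff.1 ht
  rw [Set.mem_ofPred_eq, Polynomial.IsRoot, eval_map_eval]
  exact eval_offsetPoint_eq_zero hP hs

theorem exists_lineHom_resultant_eq_prod_mul (hd : d ≠ 0)
    (hP : IsPrimitivePartT φ.normalPoly P) (hQ : IsPrimitivePartT (φ.circlePoly d) Q) {e : ℂ × ℂ}
    {S : Finset ℂ} (hS : ∀ t, t ∈ S ↔ φ.ParamGenerates d t (φ.offsetPoint d e))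
    (hlc : eval (φ.offsetPoint d e) P.leadingCoeff ≠ 0)
    (hreg : ∀ t ∉ φ.regularParams, eval (φ.offsetPoint d e) (P.eval (C t)) ≠ 0)
    (hfib : ∀ e' ∈ φ.flags, φ.offsetPoint d e' = φ.offsetPoint d e →
      φ.velocityFactor d e' ≠ 0 ∧ (φ.normal e' = φ.normal e ∨ φ.normal e' = -φ.normal e)) :
    ∃ r : Polynomial ℂ, r.eval 0 ≠ 0 ∧
      lineHom (φ.offsetPoint d e) (φ.normal e) (Polynomial.resultant P Q) =
        (∏ t ∈ S, lineHom (φ.offsetPoint d e) (φ.normal e) (Q.eval (C t))) * r := by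
  have heval : (Polynomial.evalRingHom 0).comp (lineHom (φ.offsetPoint d e) (φ.normal e)) =
      eval (φ.offsetPoint d e) := by
    rw [evalRingHom_comp_lineHom, zero_smul, add_zero]
  have hflag {t : ℂ} (ht : t ∈ S) :
      ∃ e' ∈ φ.flags, e'.1 = t ∧ φ.offsetPoint d e' = φ.offsetPoint d e := by
    obtain ⟨s, hs, hgen⟩ := paramGenerates_iff.1 ((hS t).1 ht)
    exact ⟨(t, s), hs, rfl, hgen⟩
  have hroot : ∀ t ∈ S, lineHom (φ.offsetPoint d e) (φ.normal e) (P.eval (C t)) = 0 := by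
    intro t ht
    obtain ⟨e', he', rfl, hgen⟩ := hflag ht
    exact lineHom_eval_eq_zero hP he' hgen (hfib e' he' hgen).2
  have hsimple : ∀ t ∈ S, (P.map (eval (φ.offsetPoint d e))).derivative.eval t ≠ 0 := by
    intro t ht
    obtain ⟨e', he', rfl, hgen⟩ := hflag ht
    rw [← hgen]
    exact eval_derivative_map_ne_zero hP he' (hfib e' he' hgen).1
  have hcommon (t : ℂ) (hPt : (P.map (eval (φ.offsetPoint d e))).eval t = 0)
      (hQt : (Q.map (eval (φ.offsetPoint d e))).eval t = 0) : t ∈ S := by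
    rw [eval_map_eval] at hPt hQt
    exact (hS t).2 (paramGenerates_iff.2 (exists_offsetPoint_eq_of_eval_eq_zero hd hP hQ
      (not_not.1 fun ht => hreg t ht hPt) hPt hQt))
  obtain ⟨r, hr, hres⟩ := exists_map_resultant_eq_prod_mul (L := Q) (S := S) (P := P)
    (ρ := lineHom (φ.offsetPoint d e) (φ.normal e)) (by simpa using hlc)
    (fun t ht => (eval_map_lineHom ..).trans (hroot t ht)) (by rwa [heval]) (by rwa [heval])
  simp only [eval_map_lineHom] at hres
  exact ⟨r, hr, hres⟩

theorem rootMultiplicity_lineHom_resultant (hd : d ≠ 0) (hP : IsPrimitivePartT φ.normalPoly P)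
    (hQ : IsPrimitivePartT (φ.circlePoly d) Q) {e : ℂ × ℂ}
    (hlc : eval (φ.offsetPoint d e) P.leadingCoeff ≠ 0)
    (hreg : ∀ t ∉ φ.regularParams, eval (φ.offsetPoint d e) (P.eval (C t)) ≠ 0)
    (hfib : ∀ e' ∈ φ.flags, φ.offsetPoint d e' = φ.offsetPoint d e →
      φ.velocityFactor d e' ≠ 0 ∧ (φ.normal e' = φ.normal e ∨ φ.normal e' = -φ.normal e)) :
    (lineHom (φ.offsetPoint d e) (φ.normal e) (Polynomial.resultant P Q)).rootMultiplicity 0 =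
      {t | φ.ParamGenerates d t (φ.offsetPoint d e)}.ncard := by
  have hfin := finite_setOf_paramGenerates (d := d) hP hlc
  have hS (t : ℂ) : t ∈ hfin.toFinset ↔ φ.ParamGenerates d t (φ.offsetPoint d e) :=
    hfin.mem_toFinset
  obtain ⟨r, hr, hres⟩ := exists_lineHom_resultant_eq_prod_mul hd hP hQ hS hlc hreg hfib
  rw [hres, rootMultiplicity_prod_mul_eq_card (fun t ht => ?_) hr,
    Set.ncard_eq_toFinset_card _ hfin]
  obtain ⟨s, hs, hgen⟩ := paramGenerates_iff.1 ((hS t).1 ht)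
  rw [← Polynomial.count_roots, ((associated_eval_offsetCircle hd hQ hs.1).map _).roots_eq,
    Polynomial.count_roots]
  exact rootMultiplicity_lineHom_offsetCircle hd hs hgen (hfib _ hs hgen).2

end RestrictionToTheNormal

section Multiplicity

theorem IsEquation.eventually_ncard_paramGenerates_eq (hf : φ.IsEquation d B f)
    (hB : φ.IsBranch B) (h : φ.IsAdmissible d) (hP : IsPrimitivePartT φ.normalPoly P)
    (hQ : IsPrimitivePartT (φ.circlePoly d) Q) {m : ℕ} {g : PolyXY}
    (hres : Polynomial.resultant P Q = f ^ m * g) (hg : ¬ f ∣ g) :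
    ∀ᶠ e in genericOn B, {t | φ.ParamGenerates d t (φ.offsetPoint d e)}.ncard = m := by
  have hreg : ∀ᶠ e in genericOn B,
      ∀ t ∈ φ.regularParamsᶜ, eval (φ.offsetPoint d e) (P.eval (C t)) ≠ 0 :=
    (eventually_all_finite (finite_compl_regularParams h.isProper)).2 fun t _ =>
      hf.eventually_ne_zero hB (hf.not_dvd_eval hB h hP t)
  filter_upwards [hf.eventually_fiber hB h,
    hf.eventually_ne_zero hB (hf.not_dvd_leadingCoeff hB h hP), hreg, hf.eventually_ne_zero hB hg,
    hf.eventually_sum_gradient_mul_normal_ne_zero hB h, eventually_mem_genericOn]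
    with e hfib hlc hreg hge hgrad he
  rw [← rootMultiplicity_lineHom_resultant h.ne_zero hP hQ hlc hreg, hres,
    rootMultiplicity_lineHom_pow_mul (hf.eval_offsetPoint he) hgrad hge]
  intro e' he' hgen
  obtain ⟨hs, -, rfl | hopp⟩ := hfib e' he' hgen
  · exact ⟨hs, .inl rfl⟩
  · exact ⟨hs, .inr hopp.1⟩

theorem setOf_paramGenerates_eq_singleton {e : ℂ × ℂ} (he : e ∈ φ.flags)
    (huniq : ∀ e' ∈ φ.flags, φ.offsetPoint d e' = φ.offsetPoint d e → e' = e) :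
    {t | φ.ParamGenerates d t (φ.offsetPoint d e)} = {e.1} := by
  ext t
  rw [Set.mem_ofPred_eq, paramGenerates_iff, Set.mem_singleton_iff]
  refine ⟨?_, ?_⟩
  · rintro ⟨s, hs, hgen⟩
    rw [← huniq _ hs hgen]
  · rintro rfl
    exact ⟨e.2, he, rfl⟩

theorem IsOpposite.fst_ne (hd : d ≠ 0) {e e' : ℂ × ℂ} (hopp : φ.IsOpposite d e e')
    (he : e ∈ φ.flags) : e.1 ≠ e'.1 := by
  intro heq
  have hpoint := hopp.point_eq
  rw [← heq, left_eq_add, smul_eq_zero] at hpoint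
  exact hpoint.elim (mul_ne_zero two_ne_zero (Complex.ofReal_ne_zero.2 hd)) (normal_ne_zero he)

theorem setOf_paramGenerates_eq_pair {e e' : ℂ × ℂ} (he : e ∈ φ.flags) (he' : e' ∈ φ.flags)
    (hopp : φ.IsOpposite d e e') (hinj : φ.IsInjectiveAt e'.1)
    (hfib : ∀ e'' ∈ φ.flags, φ.offsetPoint d e'' = φ.offsetPoint d e →
      e'' = e ∨ φ.IsOpposite d e e'') :
    {t | φ.ParamGenerates d t (φ.offsetPoint d e)} = {e.1, e'.1} := by
  ext t
  rw [Set.mem_ofPred_eq, paramGenerates_iff, Set.mem_insert_iff, Set.mem_singleton_iff]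
  refine ⟨?_, ?_⟩
  · rintro ⟨s, hs, hgen⟩
    refine (hfib _ hs hgen).imp (fun heq => congrArg Prod.fst heq) fun hopp' => ?_
    exact hinj t hs.1 (hopp'.point_eq.trans hopp.point_eq.symm)
  · rintro (rfl | rfl)
    · exact ⟨e.2, he, rfl⟩
    · exact ⟨e'.2, he', hopp.2⟩

theorem IsEquation.eventually_multiplicity (hf : φ.IsEquation d B f) (hB : φ.IsBranch B)
    (h : φ.IsAdmissible d) (hP : IsPrimitivePartT φ.normalPoly P)
    (hQ : IsPrimitivePartT (φ.circlePoly d) Q) {m : ℕ} {g : PolyXY}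
    (hres : Polynomial.resultant P Q = f ^ m * g) (hg : ¬ f ∣ g) :
    ∀ᶠ e in genericOn B,
      (m = 1 ∧ ∀ e' ∈ φ.flags, φ.offsetPoint d e' = φ.offsetPoint d e → e' = e) ∨
        (m = 2 ∧ ∃ e' ∈ φ.flags, φ.IsOpposite d e e') := by
  filter_upwards [hf.eventually_fiber hB h,
    hf.eventually_ncard_paramGenerates_eq hB h hP hQ hres hg, eventually_mem_genericOn]
    with e hfib hcard he
  have heF := hB.subset_flags he
  by_cases huniq : ∀ e' ∈ φ.flags, φ.offsetPoint d e' = φ.offsetPoint d e → e' = e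
  · refine .inl ⟨?_, huniq⟩
    rw [← hcard, setOf_paramGenerates_eq_singleton heF huniq, Set.ncard_singleton]
  · push Not at huniq
    obtain ⟨e', he', hgen, hne⟩ := huniq
    obtain ⟨-, hinj, hor⟩ := hfib e' he' hgen
    have hopp := hor.resolve_left hne
    refine .inr ⟨?_, e', he', hopp⟩
    rw [← hcard, setOf_paramGenerates_eq_pair heF he' hopp hinj fun e'' he'' hgen'' =>
      (hfib e'' he'' hgen'').2.2, Set.ncard_pair (hopp.fst_ne h.ne_zero heF)]

end Multiplicity

end RatParam

namespace RatParam

open MvPolynomial Filter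

variable {φ : RatParam} {d : ℝ} {B : Set (ℂ × ℂ)} {f : PolyXY}

section ImageOfBranch

theorem IsEquation.finite_not_exists_eval_eq_zero (hf : φ.IsEquation d B f) (hB : φ.IsBranch B)
    (h : φ.IsAdmissible d) {L : PolyXYT}
    (hL : ∀ e ∈ B, eval (φ.offsetPoint d e) (L.eval (C e.1)) = 0) :
    {q ∈ zeroSet f | ¬ ∃ t ∈ φ.regularParams, eval q (φ.normalLine t) = 0 ∧
      eval q (L.eval (C t)) = 0}.Finite := by
  obtain ⟨P, hP⟩ := exists_isPrimitivePartT (normalPoly_ne_zero h.isProper)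
  have hlc := hf.not_dvd_leadingCoeff hB h hP
  have hres : f ∣ Polynomial.resultant P L := by
    refine (hf.irreducible.prime.dvd_or_dvd
      ((hf.dvd_iff (g := P.leadingCoeff * _)).2 fun e he => ?_)).resolve_left hlc
    by_cases hlc : eval (φ.offsetPoint d e) P.leadingCoeff = 0
    · rw [map_mul, hlc, zero_mul]
    · rw [map_mul, (eval_resultant_eq_zero_iff hlc).2
        ⟨e.1, eval_offsetPoint_eq_zero hP (hB.subset_flags he), hL e he⟩, mul_zero]
  refine ((finite_zeroSet_inter_zeroSet hf.irreducible hlc).union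
    ((finite_compl_regularParams h.isProper).biUnion fun t _ =>
      finite_zeroSet_inter_zeroSet hf.irreducible (hf.not_dvd_eval hB h hP t))).subset ?_
  rintro q ⟨hq, hno⟩
  by_contra hc
  simp only [Set.mem_union, Set.mem_inter_iff, Set.mem_iUnion, not_or, not_and, not_exists] at hc
  obtain ⟨t, hPt, hLt⟩ := (eval_resultant_eq_zero_iff (hc.1 hq)).1 (zeroSet_subset_of_dvd hres hq)
  have ht : t ∈ φ.regularParams := not_not.1 fun ht => hc.2 t ht hq hPt
  exact hno ⟨t, ht,
    (eval_eq_zero_iff_of_associated (associated_eval_normalLine hP ht) q).1 hPt, hLt⟩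

theorem IsEquation.finite_notMem_image_flags (hf : φ.IsEquation d B f) (hB : φ.IsBranch B)
    (h : φ.IsAdmissible d) : {q ∈ zeroSet f | q ∉ φ.offsetPoint d '' φ.flags}.Finite := by
  obtain ⟨Q, hQ⟩ := exists_isPrimitivePartT (circlePoly_ne_zero (φ := φ) h.ne_zero)
  refine (hf.finite_not_exists_eval_eq_zero hB h fun e he =>
    eval_offsetPoint_eq_zero_of_circlePoly h.ne_zero hQ (hB.subset_flags he)).subset ?_
  rintro q ⟨hq, hno⟩
  refine ⟨hq, ?_⟩
  rintro ⟨t, ht, hn, hc⟩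
  rw [eval_eq_zero_iff_of_associated (associated_eval_offsetCircle h.ne_zero hQ ht.1)] at hc
  obtain ⟨s, hs, hgen⟩ := exists_offsetPoint_eq ht hn hc
  exact hno ⟨_, hs, hgen⟩

variable (φ d) in
/-- The polynomial `V (W x - X) - U (W y - Y) - d W S`, which tells apart the two points of a
normal line at distance `d` from the curve: it vanishes at the one generated by `(t, S(t))`. -/
def signedDistancePoly (S : Polynomial ℂ) : PolyXYT :=
  inT φ.cV * (inT φ.cW * varX - inT φ.cX) - inT φ.cU * (inT φ.cW * varY - inT φ.cY) -
    inT (Polynomial.C (d : ℂ) * φ.cW * S)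

theorem eval_signedDistancePoly {S : Polynomial ℂ} {e : ℂ × ℂ} (he : e ∈ φ.rootBranch S) (c : ℂ) :
    eval (φ.point e.1 + c • φ.normal e) ((φ.signedDistancePoly d S).eval (C e.1)) =
      φ.cW.eval e.1 * e.2 * (c - d) := by
  obtain ⟨⟨hW, hs0, hs⟩, hS⟩ := he
  have hW := isDefinedAt_iff.1 hW
  rw [eval_sqSpeed] at hs
  simp only [signedDistancePoly, varX, varY, Polynomial.eval_sub, Polynomial.eval_mul, eval_inT,
    Polynomial.eval_C, map_sub, map_mul, eval_C, eval_X, Pi.add_apply, Pi.smul_apply, smul_eq_mul,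
    point_zero, point_one, normal, Matrix.cons_val_zero, Matrix.cons_val_one, ← hS]
  field_simp
  linear_combination -φ.cW.eval e.1 * c * hs

theorem IsEquation.finite_notMem_image_rootBranch {S : Polynomial ℂ} (hS : S ^ 2 = φ.sqSpeed)
    (hf : φ.IsEquation d (φ.rootBranch S) f) (h : φ.IsAdmissible d) :
    {q ∈ zeroSet f | q ∉ φ.offsetPoint d '' φ.rootBranch S}.Finite := by
  refine (hf.finite_not_exists_eval_eq_zero (isBranch_rootBranch hS) h
    (L := φ.signedDistancePoly d S) fun e he => ?_).subset ?_
  · rw [offsetPoint, eval_signedDistancePoly he, sub_self, mul_zero]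
  rintro q ⟨hq, hno⟩
  refine ⟨hq, ?_⟩
  rintro ⟨t, ht, hn, hL⟩
  obtain ⟨s, he⟩ := (isBranch_rootBranch hS).exists_mem ht.1 ht.2
  obtain ⟨c, rfl⟩ := exists_eq_point_add_smul_normal he.1 hn
  rw [eval_signedDistancePoly he] at hL
  have hc : c = d := sub_eq_zero.1
    ((mul_eq_zero.1 hL).resolve_left (mul_ne_zero (isDefinedAt_iff.1 ht.1) he.1.2.1))
  exact hno ⟨_, he, by rw [hc, offsetPoint]⟩

end ImageOfBranch

section Translations

variable (φ) in
/-- The flag `e'` is the translate of the flag `e` by `c` times its unit normal. -/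
def IsNormalTranslate (c : ℂ) (e e' : ℂ × ℂ) : Prop :=
  φ.normal e' = φ.normal e ∧ φ.point e'.1 = φ.point e.1 + c • φ.normal e

theorem IsNormalTranslate.trans {c c' : ℂ} {e e' e'' : ℂ × ℂ} (h : φ.IsNormalTranslate c e e')
    (h' : φ.IsNormalTranslate c' e' e'') : φ.IsNormalTranslate (c + c') e e'' :=
  ⟨h'.1.trans h.1, by rw [h'.2, h.2, h.1, add_smul, add_assoc]⟩

theorem IsOpposite.isNormalTranslate {e e' : ℂ × ℂ} (h : φ.IsOpposite d e e') :
    φ.IsNormalTranslate (2 * d) e (e'.1, -e'.2) :=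
  ⟨by rw [normal_neg, h.1, neg_neg], h.point_eq⟩

theorem IsAdmissible.finite_setOf_point_eq (h : φ.IsAdmissible d) (p : Plane) :
    {t | φ.IsDefinedAt t ∧ φ.point t = p}.Finite := by
  by_cases hinj : ∃ t₀, φ.IsInjectiveAt t₀ ∧ φ.point t₀ = p
  · obtain ⟨t₀, ht₀, rfl⟩ := hinj
    exact (Set.finite_singleton t₀).subset fun t ht => ht₀ t ht.1 ht.2
  · refine h.isProper.subset fun t ht => ⟨ht.1, ?_⟩
    push Not at hinj
    have hnot : ¬ φ.IsInjectiveAt t := fun hi => hinj t hi ht.2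
    simp only [IsInjectiveAt, not_forall] at hnot
    obtain ⟨t', h1, h2, h3⟩ := hnot
    exact ⟨t', h1, h3, h2⟩

theorem IsBranch.exists_forall_isNormalTranslate (hB : φ.IsBranch B) (h : φ.IsAdmissible d) {c : ℂ}
    (hev : ∀ᶠ e in genericOn B, ∃ e' ∈ B, φ.IsNormalTranslate c e e') :
    ∃ e ∈ B, ∀ n : ℕ, ∃ e' ∈ B, φ.IsNormalTranslate (n * c) e e' := by
  -- Start outside the countable set of parameters whose iterated translates meet the finitely
  -- many flags without a translate.
  rw [eventually_genericOn] at hev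
  set Z := {e ∈ B | ¬ ∃ e' ∈ B, φ.IsNormalTranslate c e e'}
  let T : Set ℂ := φ.regularParamsᶜ ∪ ⋃ z ∈ Z, ⋃ n : ℕ,
    {t | φ.IsDefinedAt t ∧ φ.point t = φ.point z.1 - (n * c) • φ.normal z}
  have hT : T.Countable := (finite_compl_regularParams h.isProper).countable.union
    (hev.countable.biUnion fun z _ => Set.countable_iUnion fun n =>
      (h.finite_setOf_point_eq _).countable)
  obtain ⟨t, ht⟩ : ∃ t, t ∉ T := by
    by_contra! hall
    exact not_countable_complex (hT.mono fun t _ => hall t)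
  have htreg : t ∈ φ.regularParams := not_not.1 fun hb => ht (Or.inl hb)
  obtain ⟨s, hs⟩ := hB.exists_mem htreg.1 htreg.2
  refine ⟨(t, s), hs, fun n => ?_⟩
  induction n with
  | zero => exact ⟨_, hs, rfl, by simp⟩
  | succ n ih =>
    obtain ⟨e, he, htrans⟩ := ih
    obtain ⟨e', he', htrans'⟩ : ∃ e' ∈ B, φ.IsNormalTranslate c e e' := by
      by_contra hno
      refine ht (Or.inr ?_)
      simp only [Set.mem_iUnion]
      refine ⟨e, ⟨he, hno⟩, n, htreg.1, ?_⟩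
      rw [htrans.2, htrans.1, add_sub_cancel_right]
    refine ⟨e', he', ?_⟩
    convert htrans.trans htrans' using 1
    push_cast
    ring

theorem IsBranch.not_eventually_isNormalTranslate (hB : φ.IsBranch B) (h : φ.IsAdmissible d)
    {c : ℂ} (hc : c ≠ 0) :
    ¬ ∀ᶠ e in genericOn B, ∃ e' ∈ B, φ.IsNormalTranslate c e e' := by
  -- Otherwise some normal of the curve would meet it in infinitely many points.
  intro hev
  obtain ⟨e₀, he₀, hchain⟩ := hB.exists_forall_isNormalTranslate h hev
  choose e he htrans using hchain
  have hflag := hB.subset_flags he₀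
  have hinj : Function.Injective fun n => (e n).1 := by
    intro m n hmn
    have hpoint : φ.point (e m).1 = φ.point (e n).1 := congrArg φ.point hmn
    rw [(htrans m).2, (htrans n).2, add_right_inj] at hpoint
    exact_mod_cast mul_right_cancel₀ hc (smul_left_injective ℂ (normal_ne_zero hflag) hpoint)
  let c₀ := -(φ.tangent e₀.1 0 * φ.point e₀.1 0 + φ.tangent e₀.1 1 * φ.point e₀.1 1)
  have htangent : φ.tangent e₀.1 0 ≠ 0 ∨ φ.tangent e₀.1 1 ≠ 0 := by
    by_contra! h0
    apply sqSpeed_eval_ne_zero hflag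
    rw [eval_sqSpeed, ← tangent_zero, ← tangent_one, h0.1, h0.2]
    ring
  refine h.not_isLine (isLine_curve h.isProper htangent (c := c₀)
    (Set.infinite_of_injective_forall_mem hinj fun n => ⟨(hB.subset_flags (he n)).1, ?_⟩))
  rw [eval_affinePoly, (htrans n).2]
  simp only [Pi.add_apply, Pi.smul_apply, smul_eq_mul, c₀]
  linear_combination n * c * tangent_mul_normal (φ := φ) e₀

end Translations

section DoubleBranches

variable (φ d B) in
/-- Generic flags of `B` have an opposite flag, i.e. generic offset points of `B` are generated
twice. -/
def IsDouble : Prop :=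
  ∀ᶠ e in genericOn B, ∃ e' ∈ φ.flags, φ.IsOpposite d e e'

theorem two_mul_ne_zero (h : φ.IsAdmissible d) : (2 * d : ℂ) ≠ 0 :=
  mul_ne_zero two_ne_zero (Complex.ofReal_ne_zero.2 h.ne_zero)

theorem IsBranch.not_isDouble_flags (hB : φ.IsBranch φ.flags) (h : φ.IsAdmissible d) :
    ¬ φ.IsDouble d φ.flags := by
  intro hdouble
  refine hB.not_eventually_isNormalTranslate h (two_mul_ne_zero h) ?_
  filter_upwards [hdouble] with e ⟨e', he', hopp⟩
  exact ⟨_, neg_mem_flags he', hopp.isNormalTranslate⟩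

variable {S : Polynomial ℂ}

theorem mem_rootBranch_neg_iff {e : ℂ × ℂ} :
    e ∈ φ.rootBranch (-S) ↔ (e.1, -e.2) ∈ φ.rootBranch S := by
  refine ⟨fun he => ⟨neg_mem_flags he.1, ?_⟩, fun he => ⟨?_, ?_⟩⟩
  · rw [he.2, Polynomial.eval_neg, neg_neg]
  · simpa using neg_mem_flags he.1
  · rw [Polynomial.eval_neg, ← he.2, neg_neg]

theorem eventually_genericOn_rootBranch_of_neg {p : ℂ × ℂ → Prop}
    (hp : ∀ᶠ e in genericOn (φ.rootBranch (-S)), p e) :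
    ∀ᶠ e in genericOn (φ.rootBranch S), p (e.1, -e.2) := by
  rw [eventually_genericOn] at hp ⊢
  refine (hp.image fun e => (e.1, -e.2)).subset ?_
  rintro e ⟨he, hn⟩
  exact ⟨(e.1, -e.2), ⟨mem_rootBranch_neg_iff.2 (by simpa using he), hn⟩, by simp⟩

theorem IsEquation.zeroSet_rootBranch_ne (hS : S ^ 2 = φ.sqSpeed) (h : φ.IsAdmissible d)
    {f₁ f₂ : PolyXY} (hf₁ : φ.IsEquation d (φ.rootBranch S) f₁)
    (hf₂ : φ.IsEquation d (φ.rootBranch (-S)) f₂) : zeroSet f₁ ≠ zeroSet f₂ := by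
  intro heq
  have hB := isBranch_rootBranch hS
  refine hB.not_eventually_isNormalTranslate h (two_mul_ne_zero h) ?_
  filter_upwards [hf₁.eventually_fiber hB h, eventually_mem_genericOn,
    hB.eventually_offsetPoint_notMem h (hf₂.finite_notMem_image_rootBranch (by rwa [neg_sq]) h)]
    with e hfib he hcov
  obtain ⟨e', he', hgen⟩ : φ.offsetPoint d e ∈ φ.offsetPoint d '' φ.rootBranch (-S) :=
    not_not.1 fun hno => hcov ⟨heq ▸ hf₁.eval_offsetPoint he, hno⟩
  rcases (hfib e' he'.1 hgen).2.2 with rfl | hopp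
  · have hneg := (mem_rootBranch_neg_iff.1 he').2
    exact absurd (self_eq_neg.1 (he.2.trans hneg.symm)) he.1.2.1
  · exact ⟨_, mem_rootBranch_neg_iff.1 he', hopp.isNormalTranslate⟩

theorem IsDouble.eventually_exists_mem_rootBranch (hS : S ^ 2 = φ.sqSpeed) (h : φ.IsAdmissible d)
    (hdouble : φ.IsDouble d (φ.rootBranch S)) :
    ∀ᶠ e in genericOn (φ.rootBranch S), ∃ e' ∈ φ.rootBranch S, φ.IsOpposite d e e' := by
  have hB := isBranch_rootBranch hS
  obtain ⟨f₁, hf₁⟩ := hB.exists_isEquation h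
  obtain ⟨f₂, hf₂⟩ := (isBranch_rootBranch (by rwa [neg_sq] : (-S) ^ 2 = _)).exists_isEquation h
  have hndvd : ¬ f₁ ∣ f₂ := fun hdvd => hf₁.zeroSet_rootBranch_ne hS h hf₂
    (zeroSet_eq_of_associated (hf₁.irreducible.associated_of_dvd hf₂.irreducible hdvd))
  filter_upwards [hdouble, hf₁.eventually_ne_zero hB hndvd] with e ⟨e', he', hopp⟩ hne
  refine ⟨e', ⟨he', (sq_eq_sq_iff_eq_or_eq_neg.1 ?_).resolve_right fun hneg => hne ?_⟩, hopp⟩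
  · rw [he'.2.2, ← hS, Polynomial.eval_pow]
  · rw [← hopp.2]
    exact hf₂.eval_offsetPoint ⟨he', by rw [hneg, Polynomial.eval_neg]⟩

theorem IsDouble.not_isDouble_neg (hS : S ^ 2 = φ.sqSpeed) (h : φ.IsAdmissible d)
    (hdouble : φ.IsDouble d (φ.rootBranch S)) : ¬ φ.IsDouble d (φ.rootBranch (-S)) := by
  -- Otherwise the curve would be invariant under translation by `4 d` along its normals.
  intro hdouble'
  have hB := isBranch_rootBranch hS
  have hopp := hdouble.eventually_exists_mem_rootBranch hS h
  have hopp' := hdouble'.eventually_exists_mem_rootBranch (by rwa [neg_sq]) h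
  refine hB.not_eventually_isNormalTranslate h
    (mul_ne_zero two_ne_zero (two_mul_ne_zero h)) ?_
  filter_upwards [hopp, hB.eventually_fiber h (eventually_genericOn_rootBranch_of_neg hopp')]
    with e ⟨e', he', ho⟩ hfib
  obtain ⟨e'', he'', ho'⟩ := hfib e' he' ho.2
  refine ⟨_, mem_rootBranch_neg_iff.1 he'', ?_⟩
  rw [two_mul]
  exact ho.isNormalTranslate.trans ho'.isNormalTranslate

end DoubleBranches

end RatParam

namespace RatParam

open MvPolynomial Filter

variable {φ : RatParam} {d : ℝ} {B : Set (ℂ × ℂ)} {f f₁ f₂ : PolyXY} {P Q : PolyXYT}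

section Components

theorem IsAdmissible.exists_offset_eq (h : φ.IsAdmissible d) :
    (∃ f, φ.IsBranch φ.flags ∧ φ.IsEquation d φ.flags f ∧ φ.offset d = zeroSet (f * f)) ∨
    ∃ S f₁ f₂, S ^ 2 = φ.sqSpeed ∧ φ.IsEquation d (φ.rootBranch S) f₁ ∧
      φ.IsEquation d (φ.rootBranch (-S)) f₂ ∧ φ.offset d = zeroSet (f₁ * f₂) := by
  rcases isBranch_flags_or (φ := φ) with hB | ⟨S, hS, hflags⟩
  · obtain ⟨f, hf⟩ := hB.exists_isEquation h
    exact Or.inl ⟨f, hB, hf, by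
      rw [offset_eq, hf.zariskiClosure_eq, zeroSet_mul, Set.union_self]⟩
  · obtain ⟨f₁, hf₁⟩ := (isBranch_rootBranch hS).exists_isEquation h
    obtain ⟨f₂, hf₂⟩ := (isBranch_rootBranch (by rwa [neg_sq] : (-S) ^ 2 = _)).exists_isEquation h
    refine Or.inr ⟨S, f₁, f₂, hS, hf₁, hf₂, ?_⟩
    rw [offset_eq, hflags, Set.image_union,
      zariskiClosure_union_eq_zeroSet_mul hf₁.zariskiClosure_eq hf₂.zariskiClosure_eq]

theorem IsAdmissible.exists_isEquation_offset_eq (h : φ.IsAdmissible d) :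
    ∃ B₁ B₂ f₁ f₂, φ.IsBranch B₁ ∧ φ.IsBranch B₂ ∧ φ.IsEquation d B₁ f₁ ∧
      φ.IsEquation d B₂ f₂ ∧ φ.offset d = zeroSet (f₁ * f₂) := by
  rcases h.exists_offset_eq with ⟨f, hB, hf, ho⟩ | ⟨S, f₁, f₂, hS, hf₁, hf₂, ho⟩
  · exact ⟨_, _, f, f, hB, hB, hf, hf, ho⟩
  · exact ⟨_, _, f₁, f₂, isBranch_rootBranch hS, isBranch_rootBranch (by rwa [neg_sq]), hf₁, hf₂,
      ho⟩

theorem IsAdmissible.exists_isEquation_of_isComponent (h : φ.IsAdmissible d) (hf : Irreducible f)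
    (hcomp : IsComponent (zeroSet f) (φ.offset d)) : ∃ B, φ.IsBranch B ∧ φ.IsEquation d B f := by
  obtain ⟨B₁, B₂, f₁, f₂, hB₁, hB₂, hf₁, hf₂, ho⟩ := h.exists_isEquation_offset_eq
  rw [ho, isComponent_zeroSet_mul_iff hf₁.irreducible hf₂.irreducible] at hcomp
  rcases hcomp with heq | heq
  · exact ⟨B₁, hB₁, hf, hf₁.zariskiClosure_eq.trans heq.symm⟩
  · exact ⟨B₂, hB₂, hf, hf₂.zariskiClosure_eq.trans heq.symm⟩

theorem IsEquation.isComponent (hf : φ.IsEquation d B f) (hB : φ.IsBranch B)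
    (h : φ.IsAdmissible d) : IsComponent (zeroSet f) (φ.offset d) := by
  obtain ⟨_, _, f₁, f₂, -, -, hf₁, hf₂, ho⟩ := h.exists_isEquation_offset_eq
  have hsub : zeroSet f ⊆ zeroSet (f₁ * f₂) := by
    rw [← hf.zariskiClosure_eq, ← ho, offset_eq]
    exact zariskiClosure_mono (Set.image_mono hB.subset_flags)
  rw [ho, isComponent_zeroSet_mul_iff hf₁.irreducible hf₂.irreducible]
  exact ((isIrreducibleClosed_zeroSet hf.irreducible).subset_or_subset hsub).imp
    (zeroSet_eq_of_subset hf.irreducible hf₁.irreducible)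
    (zeroSet_eq_of_subset hf.irreducible hf₂.irreducible)

theorem IsBranch.isEquation_of_forall_eval_eq_zero (hB : φ.IsBranch B) (h : φ.IsAdmissible d)
    (hf : Irreducible f) (hz : ∀ e ∈ B, eval (φ.offsetPoint d e) f = 0) : φ.IsEquation d B f :=
  ⟨hf, zariskiClosure_eq_zeroSet hf (hB.infinite_offsetPoint h) (Set.image_subset_iff.2 hz)⟩

theorem isSimpleComponent_of_eventually_flags (hcomp : IsComponent (zeroSet f) (φ.offset d))
    (hfin : {q ∈ zeroSet f | q ∉ φ.offsetPoint d '' φ.flags}.Finite)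
    (huniq : ∀ᶠ e in genericOn φ.flags, eval (φ.offsetPoint d e) f = 0 →
      ∀ e' ∈ φ.flags, φ.offsetPoint d e' = φ.offsetPoint d e → e' = e) :
    φ.IsSimpleComponent d (zeroSet f) := by
  refine ⟨hcomp, (hfin.union ((eventually_genericOn.1 huniq).image (φ.offsetPoint d))).subset ?_⟩
  rintro q ⟨hq, hnot⟩
  by_cases hmem : q ∈ φ.offsetPoint d '' φ.flags
  · obtain ⟨e, he, rfl⟩ := hmem
    refine Or.inr ⟨e, ⟨he, fun hu => hnot ?_⟩, rfl⟩
    refine ⟨φ.point e.1, generates_iff.2 ⟨e, he, rfl, rfl⟩, fun p hp => ?_⟩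
    obtain ⟨e', he', hgen, rfl⟩ := generates_iff.1 hp
    rw [hu hq e' he' hgen]
  · exact Or.inl ⟨hq, hmem⟩

theorem IsEquation.isSimpleComponent (hf : φ.IsEquation d B f) (hB : φ.IsBranch B)
    (h : φ.IsAdmissible d) (huniq : ∀ B', φ.IsBranch B' → φ.IsEquation d B' f →
      ∀ᶠ e in genericOn B', ∀ e' ∈ φ.flags, φ.offsetPoint d e' = φ.offsetPoint d e → e' = e) :
    φ.IsSimpleComponent d (zeroSet f) := by
  refine isSimpleComponent_of_eventually_flags (hf.isComponent hB h)
    (hf.finite_notMem_image_flags hB h) (eventually_flags_of_isBranch fun B' hB' => ?_)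
  by_cases hz : ∀ e ∈ B', eval (φ.offsetPoint d e) f = 0
  · filter_upwards [huniq B' hB' (hB'.isEquation_of_forall_eval_eq_zero h hf.irreducible hz)]
      with e he _ using he
  · push Not at hz
    filter_upwards [hB'.eventually_eval_offsetPoint_ne_zero hz] with e hne h0 using absurd h0 hne

theorem IsEquation.isSpecialComponent (hf : φ.IsEquation d B f) (hB : φ.IsBranch B)
    (h : φ.IsAdmissible d) (hdouble : φ.IsDouble d B) : φ.IsSpecialComponent d (zeroSet f) := by
  refine ⟨hf.isComponent hB h, fun hsimple => ?_⟩
  obtain ⟨e, he, ⟨e', he', hopp⟩, hnot⟩ := hB.exists_of_eventually h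
    (hdouble.and (hB.eventually_offsetPoint_notMem h hsimple.2))
  have hflag := hB.subset_flags he
  refine hnot ⟨hf.eval_offsetPoint he, fun hunique => ?_⟩
  have heq : φ.point e'.1 = φ.point e.1 := hunique.unique
    (generates_iff.2 ⟨e', he', hopp.2, rfl⟩) (generates_iff.2 ⟨e, hflag, rfl, rfl⟩)
  rw [hopp.point_eq, add_eq_left, smul_eq_zero] at heq
  exact heq.elim (two_mul_ne_zero h) (normal_ne_zero hflag)

theorem IsEquation.exists_resultant_eq_pow_mul (hf : φ.IsEquation d B f) (hB : φ.IsBranch B)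
    (h : φ.IsAdmissible d) (hP : IsPrimitivePartT φ.normalPoly P)
    (hQ : IsPrimitivePartT (φ.circlePoly d) Q) :
    ∃ (m : ℕ) (g : PolyXY), Polynomial.resultant P Q = f ^ m * g ∧ ¬ f ∣ g ∧
      (m = 1 ∧ φ.IsSimpleComponent d (zeroSet f) ∨ m = 2 ∧ φ.IsDouble d B) := by
  obtain ⟨m, g, hg, hres⟩ :=
    WfDvdMonoid.max_power_factor (resultant_ne_zero h hP hQ) hf.irreducible
  refine ⟨m, g, hres, hg, ?_⟩
  have hmult := hf.eventually_multiplicity hB h hP hQ hres hg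
  obtain ⟨e, -, ⟨rfl, -⟩ | ⟨rfl, -⟩⟩ := hB.exists_of_eventually h hmult
  · refine Or.inl ⟨rfl, hf.isSimpleComponent hB h fun B' hB' hf' => ?_⟩
    filter_upwards [hf'.eventually_multiplicity hB' h hP hQ hres hg] with e he
    exact (he.resolve_right fun h2 => absurd h2.1 (by norm_num)).2
  · refine Or.inr ⟨rfl, ?_⟩
    filter_upwards [hmult] with e he
    exact (he.resolve_left fun h1 => absurd h1.1 (by norm_num)).2

theorem IsEquation.isDouble_of_isSpecialComponent (hf : φ.IsEquation d B f) (hB : φ.IsBranch B)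
    (h : φ.IsAdmissible d) (hspecial : φ.IsSpecialComponent d (zeroSet f)) : φ.IsDouble d B := by
  obtain ⟨P, hP⟩ := exists_isPrimitivePartT (normalPoly_ne_zero h.isProper)
  obtain ⟨Q, hQ⟩ := exists_isPrimitivePartT (circlePoly_ne_zero (φ := φ) h.ne_zero)
  obtain ⟨m, g, -, -, hm⟩ := hf.exists_resultant_eq_pow_mul hB h hP hQ
  exact (hm.resolve_left fun hsimple => hspecial.2 hsimple.2).2

theorem IsAdmissible.exists_resultant_eq_pow_mul (h : φ.IsAdmissible d)
    (hP : IsPrimitivePartT φ.normalPoly P) (hQ : IsPrimitivePartT (φ.circlePoly d) Q)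
    (hf : Irreducible f) (hcomp : IsComponent (zeroSet f) (φ.offset d)) :
    ∃ (m : ℕ) (g : PolyXY), Polynomial.resultant P Q = f ^ m * g ∧ ¬ f ∣ g ∧
      (m = 1 ∧ ¬ φ.IsSpecialComponent d (zeroSet f) ∨
        m = 2 ∧ φ.IsSpecialComponent d (zeroSet f)) := by
  obtain ⟨B, hB, hfB⟩ := h.exists_isEquation_of_isComponent hf hcomp
  obtain ⟨m, g, hres, hg, hm⟩ := hfB.exists_resultant_eq_pow_mul hB h hP hQ
  exact ⟨m, g, hres, hg, hm.imp (fun h1 => ⟨h1.1, fun hspecial => hspecial.2 h1.2⟩)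
    fun h2 => ⟨h2.1, hfB.isSpecialComponent hB h h2.2⟩⟩

end Components

section ComponentEquations

theorem isComponentEquations_of_offset_eq_mul (hf₁ : Irreducible f₁) (hf₂ : Irreducible f₂)
    (ho : φ.offset d = zeroSet (f₁ * f₂)) (hne : zeroSet f₁ ≠ zeroSet f₂)
    (hspecial : ¬ φ.IsSpecialComponent d (zeroSet f₁)) : φ.IsComponentEquations d f₁ f₂ := by
  have hcomp {D : Set Plane} : IsComponent D (φ.offset d) ↔ D = zeroSet f₁ ∨ D = zeroSet f₂ := by
    rw [ho, isComponent_zeroSet_mul_iff hf₁ hf₂]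
  exact {
    irreducible_fst := hf₁
    irreducible_snd := fun _ => hf₂
    component_iff := fun D => by simp [hcomp, hf₂.ne_one]
    distinct := fun _ => hne
    special := fun D hD => ⟨hf₂.ne_one, (hcomp.1 hD.1).resolve_left fun heq =>
      hspecial (heq ▸ hD)⟩ }

theorem isComponentEquations_one (hf : Irreducible f) (ho : φ.offset d = zeroSet (f * f))
    (hspecial : ¬ φ.IsSpecialComponent d (zeroSet f)) : φ.IsComponentEquations d f 1 := by
  have hcomp {D : Set Plane} : IsComponent D (φ.offset d) ↔ D = zeroSet f := by
    rw [ho, isComponent_zeroSet_mul_iff hf hf, or_self]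
  exact {
    irreducible_fst := hf
    irreducible_snd := fun h1 => absurd rfl h1
    component_iff := fun D => by simp [hcomp]
    distinct := fun h1 => absurd rfl h1
    special := fun D hD => absurd (hcomp.1 hD.1 ▸ hD) hspecial }

theorem IsAdmissible.exists_isComponentEquations (h : φ.IsAdmissible d) :
    ∃ f₁ f₂, φ.IsComponentEquations d f₁ f₂ := by
  rcases h.exists_offset_eq with ⟨f, hB, hf, ho⟩ | ⟨S, f₁, f₂, hS, hf₁, hf₂, ho⟩
  · exact ⟨f, 1, isComponentEquations_one hf.irreducible ho fun hspecial =>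
      hB.not_isDouble_flags h (hf.isDouble_of_isSpecialComponent hB h hspecial)⟩
  · have hS' : (-S) ^ 2 = φ.sqSpeed := by rwa [neg_sq]
    have hne := hf₁.zeroSet_rootBranch_ne hS h hf₂
    by_cases hspecial : φ.IsSpecialComponent d (zeroSet f₁)
    · have hdouble := hf₁.isDouble_of_isSpecialComponent (isBranch_rootBranch hS) h hspecial
      exact ⟨f₂, f₁, isComponentEquations_of_offset_eq_mul hf₂.irreducible hf₁.irreducible
        (by rw [ho, mul_comm]) hne.symm fun hspecial₂ => hdouble.not_isDouble_neg hS h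
          (hf₂.isDouble_of_isSpecialComponent (isBranch_rootBranch hS') h hspecial₂)⟩
    · exact ⟨f₁, f₂, isComponentEquations_of_offset_eq_mul hf₁.irreducible hf₂.irreducible ho hne
        hspecial⟩

theorem IsComponentEquations.isComponent_fst (hf : φ.IsComponentEquations d f₁ f₂) :
    IsComponent (zeroSet f₁) (φ.offset d) :=
  (hf.component_iff _).2 (Or.inl rfl)

theorem IsComponentEquations.isComponent_snd (hf : φ.IsComponentEquations d f₁ f₂) (h2 : f₂ ≠ 1) :
    IsComponent (zeroSet f₂) (φ.offset d) :=
  (hf.component_iff _).2 (Or.inr ⟨h2, rfl⟩)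

theorem IsComponentEquations.not_dvd (hf : φ.IsComponentEquations d f₁ f₂) : ¬ f₁ ∣ f₂ := by
  intro hdvd
  by_cases h2 : f₂ = 1
  · exact hf.irreducible_fst.not_dvd_one (h2 ▸ hdvd)
  · exact hf.distinct h2 (zeroSet_eq_of_associated
      (hf.irreducible_fst.associated_of_dvd (hf.irreducible_snd h2) hdvd))

theorem IsComponentEquations.squarefree_mul (hf : φ.IsComponentEquations d f₁ f₂) :
    Squarefree (f₁ * f₂) := by
  refine squarefree_mul_iff.2 ⟨hf.irreducible_fst.isRelPrime_iff_not_dvd.2 hf.not_dvd,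
    hf.irreducible_fst.squarefree, ?_⟩
  by_cases h2 : f₂ = 1
  · exact h2 ▸ squarefree_one
  · exact (hf.irreducible_snd h2).squarefree

theorem IsComponentEquations.offset_eq (hf : φ.IsComponentEquations d f₁ f₂)
    (h : φ.IsAdmissible d) : φ.offset d = zeroSet (f₁ * f₂) := by
  obtain ⟨B₁, B₂, g₁, g₂, hB₁, hB₂, hg₁, hg₂, ho⟩ := h.exists_isEquation_offset_eq
  have hsub {g : PolyXY} (hg : IsComponent (zeroSet g) (φ.offset d)) :
      zeroSet g ⊆ zeroSet (f₁ * f₂) := by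
    rw [zeroSet_mul]
    rcases (hf.component_iff _).1 hg with heq | ⟨-, heq⟩
    · exact heq ▸ Set.subset_union_left
    · exact heq ▸ Set.subset_union_right
  apply Set.Subset.antisymm
  · rw [ho, zeroSet_mul]
    exact Set.union_subset (hsub (hg₁.isComponent hB₁ h)) (hsub (hg₂.isComponent hB₂ h))
  · rw [zeroSet_mul]
    refine Set.union_subset hf.isComponent_fst.1.2 ?_
    by_cases h2 : f₂ = 1
    · simp [h2, zeroSet_one]
    · exact (hf.isComponent_snd h2).1.2

theorem IsComponentEquations.associated_of_subset_offset (hf : φ.IsComponentEquations d f₁ f₂)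
    (h : φ.IsAdmissible d) {k : PolyXY} (hk : Irreducible k) (hsub : zeroSet k ⊆ φ.offset d) :
    Associated k f₁ ∨ (f₂ ≠ 1 ∧ Associated k f₂) := by
  rw [hf.offset_eq h, ← dvd_iff_zeroSet_subset hk] at hsub
  refine (hk.prime.dvd_or_dvd hsub).imp (hk.associated_of_dvd hf.irreducible_fst) fun hk₂ => ?_
  have h2 : f₂ ≠ 1 := fun h2 => hk.not_dvd_one (h2 ▸ hk₂)
  exact ⟨h2, hk.associated_of_dvd (hf.irreducible_snd h2) hk₂⟩

theorem IsComponentEquations.hasSpecialComponent_iff (hf : φ.IsComponentEquations d f₁ f₂) :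
    φ.HasSpecialComponent d ↔ f₂ ≠ 1 ∧ φ.IsSpecialComponent d (zeroSet f₂) := by
  refine ⟨?_, fun h2 => ⟨_, h2.2⟩⟩
  rintro ⟨D, hD⟩
  obtain ⟨h2, rfl⟩ := hf.special D hD
  exact ⟨h2, hD⟩

end ComponentEquations

section Resultant

theorem totalDegree_eq_one_of_dvd_affinePoly {k : PolyXY} {a b c : ℂ} (hk : Irreducible k)
    (h0 : affinePoly a b c ≠ 0) (hdvd : k ∣ affinePoly a b c) : k.totalDegree = 1 :=
  le_antisymm
    ((totalDegree_le_of_dvd_of_isDomain hdvd h0).trans (totalDegree_affinePoly_le a b c))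
    (Nat.one_le_iff_ne_zero.2 (totalDegree_ne_zero_of_irreducible hk))

theorem totalDegree_eq_one_of_dvd_leadingCoeff {k : PolyXY} (hk : Irreducible k)
    (hP : IsPrimitivePartT φ.normalPoly P) (hdvd : k ∣ P.leadingCoeff) : k.totalDegree = 1 := by
  obtain ⟨a, b, c, hl⟩ := exists_leadingCoeff_eq_affinePoly hP
  exact totalDegree_eq_one_of_dvd_affinePoly hk (hl ▸ leadingCoeff_ne_zero hP) (hl ▸ hdvd)

theorem totalDegree_eq_one_of_dvd_eval {k : PolyXY} (hk : Irreducible k)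
    (hP : IsPrimitivePartT φ.normalPoly P) {t : ℂ} (hdvd : k ∣ P.eval (C t)) :
    k.totalDegree = 1 := by
  obtain ⟨a, b, c, hl⟩ := exists_eval_eq_affinePoly hP t
  exact totalDegree_eq_one_of_dvd_affinePoly hk (hl ▸ hP.eval_ne_zero t) (hl ▸ hdvd)

theorem zeroSet_resultant_subset (h : φ.IsAdmissible d) (hP : IsPrimitivePartT φ.normalPoly P)
    (hQ : IsPrimitivePartT (φ.circlePoly d) Q) : zeroSet (Polynomial.resultant P Q) ⊆
      φ.offset d ∪ zeroSet P.leadingCoeff ∪ ⋃ t ∈ φ.regularParamsᶜ, zeroSet (P.eval (C t)) := by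
  intro q hq
  by_cases hlc : eval q P.leadingCoeff = 0
  · exact Or.inl (Or.inr hlc)
  obtain ⟨t, hPt, hQt⟩ := (eval_resultant_eq_zero_iff hlc).1 hq
  by_cases ht : t ∈ φ.regularParams
  · obtain ⟨s, hs, hgen⟩ := exists_offsetPoint_eq_of_eval_eq_zero h.ne_zero hP hQ ht hPt hQt
    rw [RatParam.offset_eq]
    exact Or.inl (Or.inl (subset_zariskiClosure _ ⟨_, hs, hgen⟩))
  · exact Or.inr (Set.mem_biUnion ht hPt)

theorem subset_offset_or_totalDegree_eq_one (h : φ.IsAdmissible d)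
    (hP : IsPrimitivePartT φ.normalPoly P) (hQ : IsPrimitivePartT (φ.circlePoly d) Q) {k : PolyXY}
    (hk : Irreducible k) (hdvd : k ∣ Polynomial.resultant P Q) :
    zeroSet k ⊆ φ.offset d ∨ k.totalDegree = 1 := by
  obtain ⟨f₁, f₂, hf⟩ := h.exists_isComponentEquations
  have hfin := finite_compl_regularParams h.isProper
  have hprod : k ∣ f₁ * f₂ * P.leadingCoeff * ∏ t ∈ hfin.toFinset, P.eval (C t) := by
    refine (dvd_iff_zeroSet_subset hk).2 fun q hq => ?_
    rw [zeroSet_mul, zeroSet_mul, ← hf.offset_eq h]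
    refine (zeroSet_resultant_subset h hP hQ (zeroSet_subset_of_dvd hdvd hq)).imp_right fun hq => ?_
    obtain ⟨t, ht, hqt⟩ := Set.mem_iUnion₂.1 hq
    exact zeroSet_subset_of_dvd (Finset.dvd_prod_of_mem _ (hfin.mem_toFinset.2 ht)) hqt
  rcases hk.prime.dvd_or_dvd hprod with hleft | hright
  · rw [hf.offset_eq h, ← dvd_iff_zeroSet_subset hk]
    exact (hk.prime.dvd_or_dvd hleft).imp id (totalDegree_eq_one_of_dvd_leadingCoeff hk hP)
  · obtain ⟨t, -, ht⟩ := (hk.prime.dvd_finsetProd_iff _).1 hright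
    exact Or.inr (totalDegree_eq_one_of_dvd_eval hk hP ht)

theorem IsComponentEquations.exists_resultant_eq (hf : φ.IsComponentEquations d f₁ f₂)
    (h : φ.IsAdmissible d) (hP : IsPrimitivePartT φ.normalPoly P)
    (hQ : IsPrimitivePartT (φ.circlePoly d) Q) :
    ∃ (n : ℕ) (g : PolyXY), Polynomial.resultant P Q = f₁ * f₂ ^ n * g ∧
      (∀ k, Irreducible k → k ∣ g → ¬ zeroSet k ⊆ φ.offset d) ∧
      (n = 1 ∧ ¬ φ.HasSpecialComponent d ∨ n = 2 ∧ φ.HasSpecialComponent d) := by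
  obtain ⟨m, g₁, hres₁, hg₁, hm⟩ :=
    h.exists_resultant_eq_pow_mul hP hQ hf.irreducible_fst hf.isComponent_fst
  obtain ⟨rfl, -⟩ := hm.resolve_right fun hm =>
    have hspecial := hf.special _ hm.2
    hf.distinct hspecial.1 hspecial.2
  rw [hf.hasSpecialComponent_iff]
  by_cases h2 : f₂ = 1
  · refine ⟨1, g₁, by rw [hres₁, h2, pow_one, one_pow, mul_one], fun k hk hdvd hsub => hg₁ ?_,
      Or.inl ⟨rfl, fun hspecial => hspecial.1 h2⟩⟩
    exact ((hf.associated_of_subset_offset h hk hsub).resolve_right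
      fun hassoc => hassoc.1 h2).symm.dvd.trans hdvd
  · have hf₂ := hf.irreducible_snd h2
    obtain ⟨n, g₂, hres₂, hg₂, hn⟩ :=
      h.exists_resultant_eq_pow_mul hP hQ hf₂ (hf.isComponent_snd h2)
    obtain ⟨g, hres, hg₁, hg₂⟩ := exists_eq_pow_mul_pow_mul hf.irreducible_fst.prime
      hf.not_dvd hres₁ hg₁ hres₂ hg₂
    refine ⟨n, g, by rw [hres, pow_one], fun k hk hdvd hsub => ?_, by simpa [h2] using hn⟩
    rcases hf.associated_of_subset_offset h hk hsub with hassoc | ⟨-, hassoc⟩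
    · exact hg₁ (hassoc.symm.dvd.trans hdvd)
    · exact hg₂ (hassoc.symm.dvd.trans hdvd)

theorem zeroSet_mul_pow {n : ℕ} (hn : n ≠ 0) : zeroSet (f₁ * f₂ ^ n) = zeroSet (f₁ * f₂) := by
  ext p
  simp [mem_zeroSet, hn]

theorem IsAdmissible.exists_isNonExtraneousPart (h : φ.IsAdmissible d)
    (hP : IsPrimitivePartT φ.normalPoly P) (hQ : IsPrimitivePartT (φ.circlePoly d) Q) :
    ∃ F G, φ.IsNonExtraneousPart d (Polynomial.resultant P Q) F G := by
  obtain ⟨f₁, f₂, hf⟩ := h.exists_isComponentEquations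
  obtain ⟨n, g, hres, hg, hn⟩ := hf.exists_resultant_eq h hP hQ
  have hg0 : g ≠ 0 := right_ne_zero_of_mul (hres ▸ resultant_ne_zero h hP hQ)
  obtain ⟨c, L, hc, hgL, hL⟩ := exists_eq_C_mul_prod hg0
  refine ⟨f₁ * f₂ ^ n, g, hres, ?_, c, L, hc, hgL, fun l hl => ?_⟩
  · rw [hf.offset_eq h, zeroSet_mul_pow (by omega)]
  · obtain ⟨hirr, hdvd⟩ := hL l hl
    have hnot := hg l hirr hdvd
    exact ⟨(subset_offset_or_totalDegree_eq_one h hP hQ hirr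
      (hres ▸ hdvd.mul_left _)).resolve_left hnot, hnot⟩

theorem IsNonExtraneousPart.not_subset_offset {H F G k : PolyXY}
    (hFG : φ.IsNonExtraneousPart d H F G) (hk : Irreducible k) (hdvd : k ∣ G) :
    ¬ zeroSet k ⊆ φ.offset d := by
  obtain ⟨-, -, c, L, hc, rfl, hL⟩ := hFG
  obtain ⟨l, hl, hkl⟩ := exists_associated_of_dvd_C_mul_prod hk hc
    (fun l hl => irreducible_of_totalDegree_eq_one_of_field (hL l hl).1) hdvd
  exact zeroSet_eq_of_associated hkl ▸ (hL l hl).2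

theorem IsNonExtraneousPart.exists_eq_C_mul {F G : PolyXY}
    (hFG : φ.IsNonExtraneousPart d (Polynomial.resultant P Q) F G) (h : φ.IsAdmissible d)
    (hP : IsPrimitivePartT φ.normalPoly P) (hQ : IsPrimitivePartT (φ.circlePoly d) Q)
    (hf : φ.IsComponentEquations d f₁ f₂) :
    ∃ (n : ℕ) (c : ℂ), c ≠ 0 ∧ F = C c * (f₁ * f₂ ^ n) ∧
      (n = 1 ∧ ¬ φ.HasSpecialComponent d ∨ n = 2 ∧ φ.HasSpecialComponent d) := by
  obtain ⟨n, g, hres, hg, hn⟩ := hf.exists_resultant_eq h hP hQ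
  have hzero : zeroSet (f₁ * f₂ ^ n) = φ.offset d := by
    rw [hf.offset_eq h, zeroSet_mul_pow (by omega)]
  have hassoc : Associated (f₁ * f₂ ^ n) F :=
    associated_of_mul_eq_mul_of_forall_irreducible (hres ▸ hFG.1)
      (hres ▸ resultant_ne_zero h hP hQ) (fun k _ hdvd => hzero ▸ zeroSet_subset_of_dvd hdvd) hg
      (fun k _ hdvd => hFG.2.1 ▸ zeroSet_subset_of_dvd hdvd) fun k => hFG.not_subset_offset
  obtain ⟨c, hc, hF⟩ := exists_eq_C_mul_of_associated hassoc
  exact ⟨n, c, hc, hF, hn⟩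

end Resultant

end RatParam

end Offset

end

theorem theorem2 (φ : Offset.RatParam) (d : ℝ) (hd : 0 < d)
    (hline : ¬ Offset.IsLine φ.curve) (hcircle : ¬ Offset.IsCircle φ.curve)
    (hproper : φ.IsProper) :
    (∃ f₁ f₂ : Offset.PolyXY, φ.IsComponentEquations d f₁ f₂) ∧
    ∀ P Q : Offset.PolyXYT,
      Offset.IsPrimitivePartT φ.normalPoly P →
      Offset.IsPrimitivePartT (φ.circlePoly d) Q →
      (∃ F G : Offset.PolyXY, φ.IsNonExtraneousPart d (Polynomial.resultant P Q) F G) ∧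
      ∀ F G : Offset.PolyXY, φ.IsNonExtraneousPart d (Polynomial.resultant P Q) F G →
      ∀ f₁ f₂ : Offset.PolyXY, φ.IsComponentEquations d f₁ f₂ →
        (¬ φ.HasSpecialComponent d →
          (∃ c : ℂ, c ≠ 0 ∧ F = MvPolynomial.C c * (f₁ * f₂)) ∧ Squarefree F) ∧
        (φ.HasSpecialComponent d →
          ∃ c : ℂ, c ≠ 0 ∧ F = MvPolynomial.C c * (f₁ * f₂ ^ 2)) := by
  have h : φ.IsAdmissible d := ⟨hd, hline, hcircle, hproper⟩
  refine ⟨h.exists_isComponentEquations, fun P Q hP hQ =>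
    ⟨h.exists_isNonExtraneousPart hP hQ, fun F G hFG f₁ f₂ hf => ?_⟩⟩
  obtain ⟨n, c, hc, rfl, hn⟩ := hFG.exists_eq_C_mul h hP hQ hf
  rcases hn with ⟨rfl, hnot⟩ | ⟨rfl, hspecial⟩
  · rw [pow_one]
    refine ⟨fun _ => ⟨⟨c, hc, rfl⟩, ?_⟩, fun hspecial => absurd hspecial hnot⟩
    have hunit : IsUnit (MvPolynomial.C c : Offset.PolyXY) :=
      Offset.isUnit_iff_exists_eq_C.2 ⟨c, hc, rfl⟩
    exact (associated_unit_mul_left _ _ hunit).squarefree_iff.2 hf.squarefree_mul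
  · exact ⟨fun hnot => absurd hspecial hnot, fun _ => ⟨c, hc, rfl⟩⟩
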